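/- Let $K$ be a compact connected semisimple Lie group with Lie algebra $\mathfrak k$ and Cartan–Killing form $B$, let $Z\subset K$ be a torus, let $H$ be the centralizer of $Z$ in $K$, and let $F=K/H$ be the corresponding (generalized) flag manifold, with its standard smooth structure (the one for which $K\to K/H$ is a submersion) and base point $o=eH$. Let $\mathfrak h$ be the Lie algebra of $H$ and let $\mathfrak m$ be the $B$-orthogonal complement of $\mathfrak h$ in $\mathfrak k$. For $X\in\mathfrak k$ let $X^*$ be the vector field $X^*|_p=\frac{d}{dt}\big|_{t=0}\exp(tX)\,p$ on $F$. Then $\mathfrak k=\mathfrak h\oplus\mathfrak m$ with $[\mathfrak h,\mathfrak m]\subseteq\mathfrak m$, and there is exactly one $K$-invariant Riemannian metric $g_o$ on $F$ induced by $-B$, i.e. with $g_o(X^*|_o,Y^*|_o)=-B(X,Y)$ for $X,Y\in\mathfrak m$. For every $K$-invariant complex structure $J$ on $F$ the following hold. 1. The metric $g_o$ is Hermitian with respect to $J$, i.e. $g_o(J\cdot,J\cdot)=g_o$. 2. The Hermitian manifold $(F,g_o,J)$ has a unique Bismut connection $\nabla^b$, i.e. a unique linear connection with $\nabla^b g_o=0$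 and $\nabla^b J=0$ whose torsion $T^b$ is totally skew-symmetric (that is, $(X,Y,Z)\mapsto g_o(T^b(X,Y),Z)$ is a $3$-form). It coincides with the canonical connection of the reductive homogeneous space $K/H$, $\mathfrak k=\mathfrak h\oplus\mathfrak m$, i.e. with the $K$-invariant linear connection $\nabla$ determined by $(\nabla_{X^*}Y^*)|_o+[X,Y]^*|_o=0$ for all $X,Y\in\mathfrak m$. 3. $(F,g_o,J)$ is Bismut torsion parallel (BTP), i.e. $\nabla^bT^b=0$. In fact it is Bismut Ambrose–Singer (BAS), i.e. both $\nabla^bT^b=0$ and $\nabla^bR^b=0$, where $R^b$ is the curvature of $\nabla^b$. -/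

import Mathlib

open scoped Manifold ContDiff Bundle
open Bundle VectorField

noncomputable section

/-- A subgroup of a topological group is a torus if, with the subspace topology, it is isomorphic
as a topological group to a finite power `(S¹)ⁿ` of the circle group. -/
def IsTorus {K : Type*} [Group K] [TopologicalSpace K] (Z : Subgroup K) : Prop :=
  ∃ n : ℕ, Nonempty (Z ≃ₜ* (Fin n → Circle))

/-- A smooth real Lie group has the regularity used for its Lie algebra. -/
instance instLieGroupMinSmoothness {E : Type*} [NormedAddCommGroup E] [NormedSpace ℝ E]
    {K : Type*} [Group K] [TopologicalSpace K] [ChartedSpace E K]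
    [LieGroup 𝓘(ℝ, E) ∞ K] : LieGroup 𝓘(ℝ, E) (minSmoothness ℝ 3) K := by
  rw [minSmoothness_of_isRCLikeNormedField]
  infer_instance

/-! ### Hermitian geometry on a smooth manifold -/

section Geometry

variable {E : Type*} [NormedAddCommGroup E] [NormedSpace ℝ E]
  {M : Type*} [TopologicalSpace M] [ChartedSpace E M]

/-- A vector field is smooth. -/
def IsSmoothField [IsManifold 𝓘(ℝ, E) ∞ M]
    (X : ∀ x : M, TangentSpace 𝓘(ℝ, E) x) : Prop :=
  ContMDiff 𝓘(ℝ, E) (𝓘(ℝ, E).prod 𝓘(ℝ, E)) ∞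
    (fun x => (⟨x, X x⟩ : TangentBundle 𝓘(ℝ, E) M))

/-- A vector field is differentiable at a point. -/
def IsDiffFieldAt [IsManifold 𝓘(ℝ, E) ∞ M]
    (X : ∀ x : M, TangentSpace 𝓘(ℝ, E) x) (x : M) : Prop :=
  MDifferentiableAt 𝓘(ℝ, E) (𝓘(ℝ, E).prod 𝓘(ℝ, E))
    (fun y => (⟨y, X y⟩ : TangentBundle 𝓘(ℝ, E) M)) x

/-- An (integrable) complex structure on a smooth manifold: a smooth field `J` of endomorphisms of
the tangent bundle with `J² = -1` and vanishing Nijenhuis tensor. -/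
structure IsComplexStructure [IsManifold 𝓘(ℝ, E) ∞ M]
    (J : ∀ x : M, TangentSpace 𝓘(ℝ, E) x →L[ℝ] TangentSpace 𝓘(ℝ, E) x) : Prop where
  smooth : ContMDiff 𝓘(ℝ, E) (𝓘(ℝ, E).prod 𝓘(ℝ, E →L[ℝ] E)) ∞
    (fun x => (⟨x, J x⟩ : TotalSpace (E →L[ℝ] E)
      fun x : M => TangentSpace 𝓘(ℝ, E) x →L[ℝ] TangentSpace 𝓘(ℝ, E) x))
  sq_eq_neg : ∀ (x : M) (v : TangentSpace 𝓘(ℝ, E) x), J x (J x v) = -v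
  nijenhuis : ∀ X Y : ∀ x : M, TangentSpace 𝓘(ℝ, E) x, IsSmoothField X → IsSmoothField Y →
    ∀ x : M,
      mlieBracket 𝓘(ℝ, E) (fun y => J y (X y)) (fun y => J y (Y y)) x
        - J x (mlieBracket 𝓘(ℝ, E) (fun y => J y (X y)) Y x)
        - J x (mlieBracket 𝓘(ℝ, E) X (fun y => J y (Y y)) x)
        - mlieBracket 𝓘(ℝ, E) X Y x = 0

/-- Smooth Riemannian metrics on a smooth manifold. -/
abbrev SmoothMetric (E : Type*) [NormedAddCommGroup E] [NormedSpace ℝ E]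
    (M : Type*) [TopologicalSpace M] [ChartedSpace E M] [IsManifold 𝓘(ℝ, E) ∞ M] :=
  ContMDiffRiemannianMetric 𝓘(ℝ, E) ∞ E (fun x : M => TangentSpace 𝓘(ℝ, E) x)

/-- The metric `g` is Hermitian with respect to `J`: `g(Ju, Jv) = g(u, v)`. -/
def IsHermitianMetric [IsManifold 𝓘(ℝ, E) ∞ M] (g : SmoothMetric E M)
    (J : ∀ x : M, TangentSpace 𝓘(ℝ, E) x →L[ℝ] TangentSpace 𝓘(ℝ, E) x) : Prop :=
  ∀ (x : M) (u v : TangentSpace 𝓘(ℝ, E) x), g.inner x (J x u) (J x v) = g.inner x u v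

/-- Linear connections on the tangent bundle. In `D Y x v`, the field `Y` is differentiated at the
point `x` in the direction `v`. -/
abbrev LinearConnection (E : Type*) [NormedAddCommGroup E] [NormedSpace ℝ E]
    (M : Type*) [TopologicalSpace M] [ChartedSpace E M] [IsManifold 𝓘(ℝ, E) ∞ M] :=
  CovariantDerivative 𝓘(ℝ, E) E (fun x : M => TangentSpace 𝓘(ℝ, E) x)

/-- Two connections are the same: they agree on every vector field at every point where that field
is differentiable. (The value of `CovariantDerivative` elsewhere is irrelevant.) -/
def LinearConnection.Agree [IsManifold 𝓘(ℝ, E) ∞ M] (D D' : LinearConnection E M) : Prop :=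
  ∀ (Y : ∀ x : M, TangentSpace 𝓘(ℝ, E) x) (x : M), IsDiffFieldAt Y x → D Y x = D' Y x

variable [CompleteSpace E] [FiniteDimensional ℝ E]

/-- `D` is a Bismut connection of `(g, J)`: a smooth connection that leaves `g` and `J` parallel
and whose torsion is totally skew-symmetric. -/
structure IsBismutConnection [IsManifold 𝓘(ℝ, E) ∞ M]
    (g : SmoothMetric E M)
    (J : ∀ x : M, TangentSpace 𝓘(ℝ, E) x →L[ℝ] TangentSpace 𝓘(ℝ, E) x)
    (D : LinearConnection E M) : Prop where
  smooth : ContMDiffCovariantDerivativeOn E ∞ D.toFun Set.univ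
  metric : ∀ (X Y : ∀ x : M, TangentSpace 𝓘(ℝ, E) x) (x : M),
    IsDiffFieldAt X x → IsDiffFieldAt Y x → ∀ v : TangentSpace 𝓘(ℝ, E) x,
      mfderiv 𝓘(ℝ, E) 𝓘(ℝ, ℝ) (fun y => g.inner y (X y) (Y y)) x v
        = g.inner x (D X x v) (Y x) + g.inner x (X x) (D Y x v)
  complex : ∀ (Y : ∀ x : M, TangentSpace 𝓘(ℝ, E) x) (x : M), IsDiffFieldAt Y x →
    ∀ v : TangentSpace 𝓘(ℝ, E) x, D (fun y => J y (Y y)) x v = J x (D Y x v)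
  skew : ∀ (x : M) (u v w : TangentSpace 𝓘(ℝ, E) x),
    g.inner x (D.torsion x u v) w = -g.inner x (D.torsion x u w) v

/-- `(D_W T)(X, Y) = 0` for all smooth vector fields, where `T` is the torsion of `D`. -/
def HasParallelTorsion [IsManifold 𝓘(ℝ, E) ∞ M]
    (D : LinearConnection E M) : Prop :=
  ∀ W X Y : ∀ x : M, TangentSpace 𝓘(ℝ, E) x,
    IsSmoothField W → IsSmoothField X → IsSmoothField Y → ∀ x : M,
      D (fun y => D.torsion y (X y) (Y y)) x (W x)
        = D.torsion x (D X x (W x)) (Y x) + D.torsion x (X x) (D Y x (W x))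

/-- The curvature `R(X, Y)Z = D_X D_Y Z - D_Y D_X Z - D_[X,Y] Z` of a connection. -/
def connectionCurvature [IsManifold 𝓘(ℝ, E) ∞ M] (D : LinearConnection E M)
    (X Y Z : ∀ x : M, TangentSpace 𝓘(ℝ, E) x) (x : M) : TangentSpace 𝓘(ℝ, E) x :=
  D (fun y => D Z y (Y y)) x (X x) - D (fun y => D Z y (X y)) x (Y x)
    - D Z x (mlieBracket 𝓘(ℝ, E) X Y x)

/-- `(D_W R)(X, Y)Z = 0` for all smooth vector fields, where `R` is the curvature of `D`. -/
def HasParallelCurvature [IsManifold 𝓘(ℝ, E) ∞ M] (D : LinearConnection E M) : Prop :=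
  ∀ W X Y Z : ∀ x : M, TangentSpace 𝓘(ℝ, E) x,
    IsSmoothField W → IsSmoothField X → IsSmoothField Y → IsSmoothField Z → ∀ x : M,
      D (connectionCurvature D X Y Z) x (W x)
        = connectionCurvature D (fun y => D X y (W y)) Y Z x
          + connectionCurvature D X (fun y => D Y y (W y)) Z x
          + connectionCurvature D X Y (fun y => D Z y (W y)) x

/-- Bismut torsion parallel (BTP) Hermitian structures: the Bismut connection has parallel
torsion. -/
def IsBTP [IsManifold 𝓘(ℝ, E) ∞ M] (g : SmoothMetric E M)
    (J : ∀ x : M, TangentSpace 𝓘(ℝ, E) x →L[ℝ] TangentSpace 𝓘(ℝ, E) x) : Prop :=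
  IsComplexStructure J ∧ IsHermitianMetric g J ∧
    ∃ D : LinearConnection E M, IsBismutConnection g J D ∧ HasParallelTorsion D

/-- Bismut Ambrose-Singer (BAS) Hermitian structures: the Bismut connection has parallel torsion
and parallel curvature. -/
def IsBAS [IsManifold 𝓘(ℝ, E) ∞ M] (g : SmoothMetric E M)
    (J : ∀ x : M, TangentSpace 𝓘(ℝ, E) x →L[ℝ] TangentSpace 𝓘(ℝ, E) x) : Prop :=
  IsComplexStructure J ∧ IsHermitianMetric g J ∧
    ∃ D : LinearConnection E M,
      IsBismutConnection g J D ∧ HasParallelTorsion D ∧ HasParallelCurvature D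

end Geometry

/-! ### Homogeneous spaces -/

section Homogeneous

variable {E : Type*} [NormedAddCommGroup E] [NormedSpace ℝ E] [CompleteSpace E]
  (E' : Type*) [NormedAddCommGroup E'] [NormedSpace ℝ E']
  {K : Type*} [Group K] [TopologicalSpace K] [ChartedSpace E K] [LieGroup 𝓘(ℝ, E) ∞ K]
  (H : Subgroup K) [ChartedSpace E' (K ⧸ H)]

/-- The smooth structure of the homogeneous space `K/H`: a manifold structure on the quotient
topological space `K/H` is the homogeneous one if the projection `K → K/H` is a smooth submersion
(this determines it uniquely). -/
def IsHomogeneousManifold : Prop :=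
  Manifold.IsSubmersion 𝓘(ℝ, E) 𝓘(ℝ, E') ∞ (fun k : K => (k : K ⧸ H))

/-- The isotropy subalgebra `𝔥`, i.e. the Lie algebra of `H`, seen as the kernel of the differential
at the identity of the projection `K → K/H`. -/
def isotropyAlgebra : Submodule ℝ (GroupLieAlgebra 𝓘(ℝ, E) K) :=
  (mfderiv 𝓘(ℝ, E) 𝓘(ℝ, E') (fun k : K => (k : K ⧸ H)) (1 : K)).ker

/-- The complement `𝔪` of `𝔥`: the orthogonal complement with respect to the Cartan-Killing form. -/
def isotropyComplement : Submodule ℝ (GroupLieAlgebra 𝓘(ℝ, E) K) :=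
  (isotropyAlgebra (E := E) E' H).orthogonalBilin
    (killingForm ℝ (GroupLieAlgebra 𝓘(ℝ, E) K))

variable {E'} {H}

/-- The fundamental vector field `X*` on `K/H`: `X*|_p = d/dt|_{t=0} exp(tX) p`, i.e. the image of
`X` under the differential at the identity of `k ↦ k p`. -/
def fundamentalField (X : GroupLieAlgebra 𝓘(ℝ, E) K) (p : K ⧸ H) : TangentSpace 𝓘(ℝ, E') p :=
  mfderiv 𝓘(ℝ, E) 𝓘(ℝ, E') (fun k : K => k • p) (1 : K) X

/-- The differential at `p` of the translation `p ↦ k p` of `K/H`. -/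
def translationDeriv (k : K) (p : K ⧸ H) :
    TangentSpace 𝓘(ℝ, E') p →L[ℝ] TangentSpace 𝓘(ℝ, E') (k • p) :=
  mfderiv 𝓘(ℝ, E') 𝓘(ℝ, E') (fun q : K ⧸ H => k • q) p

/-- The tensor field `J` on `K/H` is `K`-invariant. -/
def IsInvariantEndo
    (J : ∀ p : K ⧸ H, TangentSpace 𝓘(ℝ, E') p →L[ℝ] TangentSpace 𝓘(ℝ, E') p) : Prop :=
  ∀ (k : K) (p : K ⧸ H) (v : TangentSpace 𝓘(ℝ, E') p),
    J (k • p) (translationDeriv k p v) = translationDeriv k p (J p v)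

/-- The metric `g` on `K/H` is the one induced by `-B`: for every `k`, the isomorphism
`𝔪 → T_{kH}(K/H)` that is the differential at `e` of `x ↦ kxH` is an isometry from `-B`
restricted to `𝔪`. (For `k = e` this prescribes `g` at the base point, for the other `k` it says
that `g` is `K`-invariant.) -/
def IsCartanKillingMetric [IsManifold 𝓘(ℝ, E') ∞ (K ⧸ H)] (g : SmoothMetric E' (K ⧸ H)) : Prop :=
  ∀ k : K, ∀ X ∈ isotropyComplement (E := E) E' H, ∀ Y ∈ isotropyComplement (E := E) E' H,
    g.inner (k : K ⧸ H)
        (mfderiv 𝓘(ℝ, E) 𝓘(ℝ, E') (fun x : K => (x : K ⧸ H)) k (mulInvariantVectorField X k))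
        (mfderiv 𝓘(ℝ, E) 𝓘(ℝ, E') (fun x : K => (x : K ⧸ H)) k (mulInvariantVectorField Y k))
      = -killingForm ℝ (GroupLieAlgebra 𝓘(ℝ, E) K) X Y

/-- `D` is the canonical connection of the reductive homogeneous space `K/H`, `𝔨 = 𝔥 + 𝔪`: the
smooth `K`-invariant connection with vanishing Nomizu operator
`Λ(X)(Y) = (D_{X*} Y*)|_o + [X, Y]*|_o` for `X, Y ∈ 𝔪`, where `o = eH`. -/
structure IsCanonicalConnection (E : Type*) [NormedAddCommGroup E] [NormedSpace ℝ E]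
    [CompleteSpace E] {E' : Type*} [NormedAddCommGroup E'] [NormedSpace ℝ E']
    {K : Type*} [Group K] [TopologicalSpace K] [ChartedSpace E K] [LieGroup 𝓘(ℝ, E) ∞ K]
    {H : Subgroup K} [ChartedSpace E' (K ⧸ H)] [IsManifold 𝓘(ℝ, E') ∞ (K ⧸ H)]
    (D : LinearConnection E' (K ⧸ H)) : Prop where
  smooth : ContMDiffCovariantDerivativeOn E' ∞ D.toFun Set.univ
  invariant : ∀ (k : K) (Y : ∀ p : K ⧸ H, TangentSpace 𝓘(ℝ, E') p) (p : K ⧸ H),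
    IsDiffFieldAt Y (k • p) → ∀ v : TangentSpace 𝓘(ℝ, E') p,
      D Y (k • p) (translationDeriv k p v)
        = translationDeriv k p
            (D (mpullback 𝓘(ℝ, E') 𝓘(ℝ, E') (fun q : K ⧸ H => k • q) Y) p v)
  nomizu : ∀ X ∈ isotropyComplement (E := E) E' H, ∀ Y ∈ isotropyComplement (E := E) E' H,
    D (fundamentalField Y) ((1 : K) : K ⧸ H) (fundamentalField X ((1 : K) : K ⧸ H))
      + fundamentalField ⁅X, Y⁆ ((1 : K) : K ⧸ H) = 0

end Homogeneous

end

noncomputable section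
open scoped Topology
set_option linter.unusedSectionVars false

lemma two_le_smooth : (2 : ℕ∞ω) ≤ ∞ := by
  have : ((2 : ℕ∞) : ℕ∞ω) ≤ ((⊤ : ℕ∞) : ℕ∞ω) := WithTop.coe_le_coe.2 le_top
  exact this

section Calc
variable {E : Type*} [NormedAddCommGroup E] [NormedSpace ℝ E]
  {E' : Type*} [NormedAddCommGroup E'] [NormedSpace ℝ E']
  {E'' : Type*} [NormedAddCommGroup E''] [NormedSpace ℝ E'']
  {M : Type*} [TopologicalSpace M] [ChartedSpace E M]
  {N : Type*} [TopologicalSpace N] [ChartedSpace E' N]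
  {N' : Type*} [TopologicalSpace N'] [ChartedSpace E'' N']
  {W : Type*} [NormedAddCommGroup W] [NormedSpace ℝ W]

variable (E E') in
/-- The differential of a map between manifolds, as a map between the model spaces. -/
def tder (f : M → N) (p : M) : E →L[ℝ] E' := mfderiv 𝓘(ℝ, E) 𝓘(ℝ, E') f p

lemma tder_comp {g : N → N'} {f : M → N} {p : M}
    (hg : MDifferentiableAt 𝓘(ℝ, E') 𝓘(ℝ, E'') g (f p)) (hf : MDifferentiableAt 𝓘(ℝ, E) 𝓘(ℝ, E') f p) :
    tder E E'' (g ∘ f) p = (tder E' E'' g (f p)).comp (tder E E' f p) :=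
  mfderiv_comp p hg hf

lemma tder_comp_apply {g : N → N'} {f : M → N} {p : M}
    (hg : MDifferentiableAt 𝓘(ℝ, E') 𝓘(ℝ, E'') g (f p)) (hf : MDifferentiableAt 𝓘(ℝ, E) 𝓘(ℝ, E') f p)
    (v : E) :
    tder E E'' (fun x => g (f x)) p v = tder E' E'' g (f p) (tder E E' f p v) := by
  have := tder_comp hg hf
  exact congrArg (fun L => L v) this

lemma tder_id (p : M) : tder E E (id : M → M) p = ContinuousLinearMap.id ℝ E := mfderiv_id

lemma tder_congr {f g : M → N} {p : M} (h : f =ᶠ[𝓝 p] g) : tder E E' f p = tder E E' g p :=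
  h.mfderiv_eq

lemma tder_const (c : N) (p : M) : tder E E' (fun _ : M => c) p = 0 := mfderiv_const

lemma tder_eq_fderiv (f : E → E') (p : E) : tder E E' f p = fderiv ℝ f p := mfderiv_eq_fderiv

variable [IsManifold 𝓘(ℝ, E) ∞ M]

lemma mdiffAt_chart {p q : M} (hq : q ∈ (extChartAt 𝓘(ℝ, E) p).source) :
    MDifferentiableAt 𝓘(ℝ, E) 𝓘(ℝ, E) (extChartAt 𝓘(ℝ, E) p) q :=
  mdifferentiableAt_extChartAt (by simpa using hq)

lemma mdiffAt_chart_symm {p : M} {e : E} (he : e ∈ (extChartAt 𝓘(ℝ, E) p).target) :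
    MDifferentiableAt 𝓘(ℝ, E) 𝓘(ℝ, E) (extChartAt 𝓘(ℝ, E) p).symm e := by
  have := mdifferentiableWithinAt_extChartAt_symm (I := 𝓘(ℝ, E)) he
  rwa [modelWithCornersSelf_coe, Set.range_id, mdifferentiableWithinAt_univ] at this

/-- A vector field read in the chart at `p`. -/
def chartField (p : M) (X : M → E) (e : E) : E :=
  tder E E (extChartAt 𝓘(ℝ, E) p) ((extChartAt 𝓘(ℝ, E) p).symm e)
    (X ((extChartAt 𝓘(ℝ, E) p).symm e))

lemma chartField_eventuallyEq (p : M) (X : M → E) :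
    mpullbackWithin 𝓘(ℝ, E) 𝓘(ℝ, E) (extChartAt 𝓘(ℝ, E) p).symm X (Set.range 𝓘(ℝ, E)) =ᶠ[𝓝 (extChartAt 𝓘(ℝ, E) p p)]
      chartField p X  := by
  filter_upwards [extChartAt_target_mem_nhds (I := 𝓘(ℝ, E)) p] with e he
  have h1 := mfderivWithin_extChartAt_symm_comp_mfderiv_extChartAt (I := 𝓘(ℝ, E)) he
  have h2 := mfderiv_extChartAt_comp_mfderivWithin_extChartAt_symm (I := 𝓘(ℝ, E)) he
  have h3 := ContinuousLinearMap.inverse_eq h1 h2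
  exact congrArg (fun L : E →L[ℝ] E => L (X ((extChartAt 𝓘(ℝ, E) p).symm e))) h3

lemma differentiableAt_chartField [CompleteSpace E] {p : M}
    {X : M → E} (hX : IsDiffFieldAt X p) :
    DifferentiableAt ℝ (chartField p X) (extChartAt 𝓘(ℝ, E) p p) := by
  have h := (mdifferentiableWithinAt_univ.2 hX).differentiableWithinAt_mpullbackWithin_vectorField
  have h2 : (↑(extChartAt 𝓘(ℝ, E) p).symm ⁻¹' Set.univ ∩ Set.range 𝓘(ℝ, E)) = Set.univ := by simp
  rw [h2] at h
  exact ((chartField_eventuallyEq p X).differentiableAt_iff (𝕜 := ℝ)).1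
    (differentiableWithinAt_univ.1 h)

/-- The pullback of a vector field by the inverse of the chart at `p`, as in the definition of
`mlieBracket`. -/
def chartPullback (p : M) (X : M → E) : E → E :=
  mpullbackWithin 𝓘(ℝ, E) 𝓘(ℝ, E) (extChartAt 𝓘(ℝ, E) p).symm X (Set.range 𝓘(ℝ, E))

lemma mlieBracket_eq_chart {p : M} (X Y : M → E) :
    (mlieBracket 𝓘(ℝ, E) X Y p : E) =
      lieBracket ℝ (chartField p X) (chartField p Y) (extChartAt 𝓘(ℝ, E) p p) := by
  have h1 : (mlieBracket 𝓘(ℝ, E) X Y p : E) =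
      (tder E E (extChartAt 𝓘(ℝ, E) p) p).inverse
       (lieBracketWithin ℝ (chartPullback p X) (chartPullback p Y)
      ((extChartAt 𝓘(ℝ, E) p).symm ⁻¹' Set.univ ∩ Set.range 𝓘(ℝ, E))
        (extChartAt 𝓘(ℝ, E) p p)) := rfl
  have h2 : (↑(extChartAt 𝓘(ℝ, E) p).symm ⁻¹' Set.univ ∩ Set.range 𝓘(ℝ, E)) = Set.univ := by simp
  have h3 : tder E E (extChartAt 𝓘(ℝ, E) p) p = ContinuousLinearMap.id ℝ E :=
    mfderiv_extChartAt_self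
  rw [h1, h2, h3, ContinuousLinearMap.inverse_id, lieBracketWithin_univ]
  exact (chartField_eventuallyEq p X).lieBracket_vectorField_eq (chartField_eventuallyEq p Y)

lemma tder_apply_eq_chart {p q : M}
    (hq : q ∈ (extChartAt 𝓘(ℝ, E) p).source) {f : M → W} (hf : MDifferentiableAt 𝓘(ℝ, E) 𝓘(ℝ, W) f q)
    (X : M → E) :
    tder E W f q (X q) =
      fderiv ℝ (f ∘ (extChartAt 𝓘(ℝ, E) p).symm) (extChartAt 𝓘(ℝ, E) p q)
        (chartField p X (extChartAt 𝓘(ℝ, E) p q)) := by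
  set φ := extChartAt 𝓘(ℝ, E) p with hφ
  have h1 : MDifferentiableAt 𝓘(ℝ, E) 𝓘(ℝ, E) φ q := mdiffAt_chart hq
  have h2 : MDifferentiableAt 𝓘(ℝ, E) 𝓘(ℝ, E) φ.symm (φ q) := mdiffAt_chart_symm (φ.map_source hq)
  have h3 : MDifferentiableAt 𝓘(ℝ, E) 𝓘(ℝ, W) (f ∘ φ.symm) (φ q) := by
    refine MDifferentiableAt.comp _ ?_ h2
    rwa [φ.left_inv hq]
  have h4 : f =ᶠ[𝓝 q] (f ∘ φ.symm) ∘ φ := by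
    filter_upwards [extChartAt_source_mem_nhds' (I := 𝓘(ℝ, E)) hq] with y hy
    simp only [Function.comp, φ.left_inv hy]
  rw [← tder_eq_fderiv, tder_congr h4, tder_comp h3 h1, chartField, ← hφ, φ.left_inv hq]
  rfl

/-- Vector fields act as derivations, and the Lie bracket is the commutator. -/
theorem tder_mlieBracket [CompleteSpace E] {p : M} {f : M → W}
    (hf : ContMDiffAt 𝓘(ℝ, E) 𝓘(ℝ, W) 2 f p)
    {X Y : M → E} (hX : IsDiffFieldAt X p) (hY : IsDiffFieldAt Y p) :
    tder E W f p (mlieBracket 𝓘(ℝ, E) X Y p) =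
      tder E W (fun q => tder E W f q (Y q)) p (X p) -
        tder E W (fun q => tder E W f q (X q)) p (Y p) := by
  set φ := extChartAt 𝓘(ℝ, E) p with hφ
  have hps : p ∈ φ.source := mem_extChartAt_source p
  set f' := f ∘ φ.symm
  have hf' : ContDiffAt ℝ 2 f' (φ p) := by
    refine ContMDiffAt.contDiffAt (ContMDiffAt.comp_of_eq (I' := 𝓘(ℝ, E)) (y := p) hf ?_ ?_)
    · exact ((contMDiffOn_extChartAt_symm (n := ∞) p).contMDiffAt
        (extChartAt_target_mem_nhds p)).of_le two_le_smooth
    · exact φ.left_inv hps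
  have hdf : DifferentiableAt ℝ (fderiv ℝ f') (φ p) :=
    (hf'.fderiv_right (m := 1) le_rfl).differentiableAt one_ne_zero
  have hev : ∀ᶠ q in 𝓝 p, MDifferentiableAt 𝓘(ℝ, E) 𝓘(ℝ, W) f q :=
    ((contMDiffAt_iff_contMDiffAt_nhds (by simp)).1 (hf.of_le one_le_two)).mono
      fun q hq => hq.mdifferentiableAt one_ne_zero
  have key : ∀ Z V : M → E, IsDiffFieldAt Z p → IsDiffFieldAt V p →
      tder E W (fun q => tder E W f q (Z q)) p (V p) =
        fderiv ℝ (fderiv ℝ f') (φ p) (chartField p V (φ p)) (chartField p Z (φ p)) +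
        fderiv ℝ f' (φ p) (fderiv ℝ (chartField p Z) (φ p) (chartField p V (φ p))) := by
    intro Z V hZ hV
    have h1 : (fun q => tder E W f q (Z q)) =ᶠ[𝓝 p]
        (fun e => fderiv ℝ f' e (chartField p Z e)) ∘ φ := by
      filter_upwards [hev, extChartAt_source_mem_nhds (I := 𝓘(ℝ, E)) p] with q hq hqs
      exact tder_apply_eq_chart hqs hq Z
    have h2 : DifferentiableAt ℝ (fun e => fderiv ℝ f' e (chartField p Z e)) (φ p) :=
      hdf.clm_apply (differentiableAt_chartField hZ)
    rw [tder_congr h1, tder_comp h2.mdifferentiableAt (mdiffAt_chart hps), tder_eq_fderiv,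
      fderiv_clm_apply hdf (differentiableAt_chartField hZ)]
    have h3 : chartField p V (φ p) = tder E E φ p (V p) := by
      rw [chartField, ← hφ, φ.left_inv hps]
    rw [h3]
    simp only [ContinuousLinearMap.comp_apply, add_apply,
      ContinuousLinearMap.flip_apply]
    rw [add_comm]
  have hsymm : IsSymmSndFDerivAt ℝ f' (φ p) := hf'.isSymmSndFDerivAt (by simp)
  rw [key Y X hY hX, key X Y hX hY, mlieBracket_eq_chart,
    hsymm.eq (chartField p X (φ p)) (chartField p Y (φ p))]
  have h5 : ∀ v : E, tder E W f p v = fderiv ℝ f' (φ p) v := by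
    intro v
    have := tder_apply_eq_chart hps (hf.mdifferentiableAt two_ne_zero) (fun _ => v)
    rw [this, chartField, ← hφ, φ.left_inv hps]
    have h3 : tder E E φ p = ContinuousLinearMap.id ℝ E := mfderiv_extChartAt_self
    rw [h3]; rfl
  rw [h5, lieBracket_eq]
  simp only [map_sub]
  abel

end Calc

section Calc
variable {E : Type*} [NormedAddCommGroup E] [NormedSpace ℝ E]
  {E' : Type*} [NormedAddCommGroup E'] [NormedSpace ℝ E']
  {E'' : Type*} [NormedAddCommGroup E''] [NormedSpace ℝ E'']
  {M : Type*} [TopologicalSpace M] [ChartedSpace E M]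
  {N : Type*} [TopologicalSpace N] [ChartedSpace E' N]
  {N' : Type*} [TopologicalSpace N'] [ChartedSpace E'' N']
  {W : Type*} [NormedAddCommGroup W] [NormedSpace ℝ W]

variable [IsManifold 𝓘(ℝ, E) ∞ M] [IsManifold 𝓘(ℝ, E') ∞ N] [IsManifold 𝓘(ℝ, E'') ∞ N']

lemma tder_eq_fderiv_chart {p : M} {f : M → W} (hf : MDifferentiableAt 𝓘(ℝ, E) 𝓘(ℝ, W) f p) :
    tder E W f p = fderiv ℝ (f ∘ (extChartAt 𝓘(ℝ, E) p).symm) (extChartAt 𝓘(ℝ, E) p p) := by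
  ext v
  have := tder_apply_eq_chart (mem_extChartAt_source p) hf (fun _ => v)
  rw [this, chartField, (extChartAt 𝓘(ℝ, E) p).left_inv (mem_extChartAt_source p)]
  have h3 : tder E E (extChartAt 𝓘(ℝ, E) p) p = ContinuousLinearMap.id ℝ E :=
    mfderiv_extChartAt_self
  rw [h3]; rfl

/-- Mixed partial derivatives commute. -/
theorem tder_tder_comm {p : M} {q : N} {G : M × N → W}
    (hG : ContMDiffAt (𝓘(ℝ, E).prod 𝓘(ℝ, E')) 𝓘(ℝ, W) 2 G (p, q)) (X : E) (Y : E') :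
    tder E W (fun k => tder E' W (fun y => G (k, y)) q Y) p X =
      tder E' W (fun y => tder E W (fun k => G (k, y)) p X) q Y := by
  set φ := extChartAt 𝓘(ℝ, E) p with hφ
  set ψ := extChartAt 𝓘(ℝ, E') q with hψ
  have hps : p ∈ φ.source := mem_extChartAt_source p
  have hqs : q ∈ ψ.source := mem_extChartAt_source q
  set G' : E × E' → W := fun z => G (φ.symm z.1, ψ.symm z.2) with hG'def
  have hφs : ContMDiffAt 𝓘(ℝ, E) 𝓘(ℝ, E) ∞ φ.symm (φ p) :=
    (contMDiffOn_extChartAt_symm (n := ∞) p).contMDiffAt (extChartAt_target_mem_nhds p)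
  have hψs : ContMDiffAt 𝓘(ℝ, E') 𝓘(ℝ, E') ∞ ψ.symm (ψ q) :=
    (contMDiffOn_extChartAt_symm (n := ∞) q).contMDiffAt (extChartAt_target_mem_nhds q)
  have hG' : ContDiffAt ℝ 2 G' (φ p, ψ q) := by
    refine ContMDiffAt.contDiffAt ?_
    refine ContMDiffAt.comp_of_eq (I' := 𝓘(ℝ, E).prod 𝓘(ℝ, E')) (y := (p, q)) hG ?_ ?_
    · exact ((hφs.of_le two_le_smooth).comp_of_eq contDiffAt_fst.contMDiffAt rfl).prodMk
        ((hψs.of_le two_le_smooth).comp_of_eq contDiffAt_snd.contMDiffAt rfl)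
    · simp only [φ.left_inv hps, ψ.left_inv hqs]
  have hev : ∀ᶠ z in 𝓝 (φ p, ψ q), DifferentiableAt ℝ G' z :=
    ((hG'.of_le one_le_two).eventually (by simp)).mono fun z hz => hz.differentiableAt one_ne_zero
  have hevM : ∀ᶠ z in 𝓝 (p, q),
      MDifferentiableAt (𝓘(ℝ, E).prod 𝓘(ℝ, E')) 𝓘(ℝ, W) G z :=
    ((contMDiffAt_iff_contMDiffAt_nhds (by simp)).1 (hG.of_le one_le_two)).mono
      fun q hq => hq.mdifferentiableAt one_ne_zero
  have hdf : DifferentiableAt ℝ (fderiv ℝ G') (φ p, ψ q) :=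
    (hG'.fderiv_right (m := 1) le_rfl).differentiableAt one_ne_zero
  have hφc : ContinuousAt φ p := continuousAt_extChartAt p
  have hψc : ContinuousAt ψ q := continuousAt_extChartAt q
  have h1 : (fun k => tder E' W (fun y => G (k, y)) q Y) =ᶠ[𝓝 p]
      (fun e => fderiv ℝ G' (e, ψ q) (0, Y)) ∘ φ := by
    have t1 : Filter.Tendsto (fun k : M => (φ k, ψ q)) (𝓝 p) (𝓝 (φ p, ψ q)) :=
      hφc.prodMk continuousAt_const
    have t2 : Filter.Tendsto (fun k : M => (k, q)) (𝓝 p) (𝓝 (p, q)) :=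
      continuousAt_id.prodMk continuousAt_const
    filter_upwards [t1.eventually hev, t2.eventually hevM,
      extChartAt_source_mem_nhds (I := 𝓘(ℝ, E)) p] with k hk hkM hks
    have hm : MDifferentiableAt 𝓘(ℝ, E') 𝓘(ℝ, W) (fun y => G (k, y)) q :=
      MDifferentiableAt.comp q (I' := 𝓘(ℝ, E).prod 𝓘(ℝ, E')) hkM
        (mdifferentiableAt_const.prodMk mdifferentiableAt_id)
    rw [tder_eq_fderiv_chart hm]
    have he : ((fun y => G (k, y)) ∘ ψ.symm) = G' ∘ (fun b => (φ k, b)) := by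
      ext b; simp only [Function.comp, hG'def, φ.left_inv hks]
    have hd : HasFDerivAt (fun b : E' => (φ k, b)) (ContinuousLinearMap.inr ℝ E E') (ψ q) :=
      hasFDerivAt_prodMk_right _ _
    rw [← hψ, he, (hk.hasFDerivAt.comp (ψ q) hd).fderiv]
    rfl
  have h2 : (fun y => tder E W (fun k => G (k, y)) p X) =ᶠ[𝓝 q]
      (fun e => fderiv ℝ G' (φ p, e) (X, 0)) ∘ ψ := by
    have t1 : Filter.Tendsto (fun k : N => (φ p, ψ k)) (𝓝 q) (𝓝 (φ p, ψ q)) :=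
      continuousAt_const.prodMk hψc
    have t2 : Filter.Tendsto (fun k : N => (p, k)) (𝓝 q) (𝓝 (p, q)) :=
      continuousAt_const.prodMk continuousAt_id
    filter_upwards [t1.eventually hev, t2.eventually hevM,
      extChartAt_source_mem_nhds (I := 𝓘(ℝ, E')) q] with k hk hkM hks
    have hm : MDifferentiableAt 𝓘(ℝ, E) 𝓘(ℝ, W) (fun y => G (y, k)) p :=
      MDifferentiableAt.comp p (I' := 𝓘(ℝ, E).prod 𝓘(ℝ, E')) hkM
        (mdifferentiableAt_id.prodMk mdifferentiableAt_const)
    rw [tder_eq_fderiv_chart hm]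
    have he : ((fun y => G (y, k)) ∘ φ.symm) = G' ∘ (fun b => (b, ψ k)) := by
      ext b; simp only [Function.comp, hG'def, ψ.left_inv hks]
    have hd : HasFDerivAt (fun b : E => (b, ψ k)) (ContinuousLinearMap.inl ℝ E E') (φ p) :=
      hasFDerivAt_prodMk_left _ _
    rw [← hφ, he, (hk.hasFDerivAt.comp (φ p) hd).fderiv]
    rfl
  have hφ1 : tder E E φ p = ContinuousLinearMap.id ℝ E := mfderiv_extChartAt_self
  have hψ1 : tder E' E' ψ q = ContinuousLinearMap.id ℝ E' := mfderiv_extChartAt_self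
  have d1 : HasFDerivAt (fun e => fderiv ℝ G' (e, ψ q) (0, Y))
      (((fderiv ℝ (fderiv ℝ G') (φ p, ψ q)).comp (ContinuousLinearMap.inl ℝ E E')).flip (0, Y))
      (φ p) :=
    (ContinuousLinearMap.apply ℝ W ((0, Y) : E × E')).hasFDerivAt.comp (φ p)
      (HasFDerivAt.comp (φ p) (f := fun e => (e, ψ q)) hdf.hasFDerivAt
        (hasFDerivAt_prodMk_left (φ p) (ψ q)))
  have d2 : HasFDerivAt (fun e => fderiv ℝ G' (φ p, e) (X, 0))
      (((fderiv ℝ (fderiv ℝ G') (φ p, ψ q)).comp (ContinuousLinearMap.inr ℝ E E')).flip (X, 0))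
      (ψ q) :=
    (ContinuousLinearMap.apply ℝ W ((X, 0) : E × E')).hasFDerivAt.comp (ψ q)
      (HasFDerivAt.comp (ψ q) (f := fun e => (φ p, e)) hdf.hasFDerivAt
        (hasFDerivAt_prodMk_right (φ p) (ψ q)))
  rw [tder_congr h1, tder_congr h2,
    tder_comp d1.differentiableAt.mdifferentiableAt (mdiffAt_chart hps),
    tder_comp d2.differentiableAt.mdifferentiableAt (mdiffAt_chart hqs), hφ1, hψ1,
    tder_eq_fderiv, tder_eq_fderiv, d1.fderiv, d2.fderiv]
  have hsymm : IsSymmSndFDerivAt ℝ G' (φ p, ψ q) := hG'.isSymmSndFDerivAt (by simp)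
  exact hsymm.eq (X, 0) (0, Y)

/-- The differential at a point that is mapped to a fixed point depends smoothly on parameters. -/
lemma contMDiffAt_tder_of_fixed {f : N' → M → N} {x₀ : N'} {p : M} {q : N} (hq : ∀ x, f x p = q)
    (hf : ContMDiffAt (𝓘(ℝ, E'').prod 𝓘(ℝ, E)) 𝓘(ℝ, E') ∞ (Function.uncurry f) (x₀, p)) :
    ContMDiffAt 𝓘(ℝ, E'') 𝓘(ℝ, E →L[ℝ] E') ∞ (fun x => tder E E' (f x) p) x₀ := by
  have h := ContMDiffAt.mfderiv (m := ∞) (n := ∞) f (fun _ => p) hf contMDiffAt_const le_rfl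
  refine h.congr_of_eventuallyEq (Filter.Eventually.of_forall fun x => ?_)
  have h2 := inTangentCoordinates_eq (I := 𝓘(ℝ, E)) (I' := 𝓘(ℝ, E')) (fun _ => p) (fun x => f x p)
    (fun x => tder E E' (f x) p) (x₀ := x₀) (x := x) (mem_chart_source _ _)
    (by simp only [hq]; exact mem_chart_source _ _)
  refine Eq.trans ?_ h2.symm
  ext v
  simp only [hq]
  rw [ContinuousLinearMap.comp_apply, ContinuousLinearMap.comp_apply,
    (tangentBundleCore 𝓘(ℝ, E) M).coordChange_self _ _ (mem_chart_source E p),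
    (tangentBundleCore 𝓘(ℝ, E') N).coordChange_self _ _ (mem_chart_source E' q)]

/-- The partial differential of a vector-valued function depends smoothly on parameters. -/
lemma contMDiffAt_tder_of_fixed' {f : N' → M → W} {x₀ : N'} {p : M}
    (hf : ContMDiffAt (𝓘(ℝ, E'').prod 𝓘(ℝ, E)) 𝓘(ℝ, W) ∞ (Function.uncurry f) (x₀, p)) :
    ContMDiffAt 𝓘(ℝ, E'') 𝓘(ℝ, E →L[ℝ] W) ∞ (fun x => tder E W (f x) p) x₀ := by
  have h := ContMDiffAt.mfderiv (m := ∞) (n := ∞) f (fun _ => p) hf contMDiffAt_const le_rfl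
  refine h.congr_of_eventuallyEq (Filter.Eventually.of_forall fun x => ?_)
  have h2 := inTangentCoordinates_eq (I := 𝓘(ℝ, E)) (I' := 𝓘(ℝ, W)) (fun _ => p) (fun x => f x p)
    (fun x => tder E W (f x) p) (x₀ := x₀) (x := x) (mem_chart_source _ _)
    (by rw [chartAt_self_eq]; trivial)
  refine Eq.trans ?_ h2.symm
  ext v
  rw [ContinuousLinearMap.comp_apply, ContinuousLinearMap.comp_apply,
    (tangentBundleCore 𝓘(ℝ, E) M).coordChange_self _ _ (mem_chart_source E p)]
  rw [TangentBundle.coordChange_model_space]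
  rfl

end Calc

section Calc
variable {E : Type*} [NormedAddCommGroup E] [NormedSpace ℝ E]
  {M : Type*} [TopologicalSpace M] [ChartedSpace E M] [IsManifold 𝓘(ℝ, E) ∞ M]
  {W : Type*} [NormedAddCommGroup W] [NormedSpace ℝ W]
  {W' : Type*} [NormedAddCommGroup W'] [NormedSpace ℝ W']
  {W'' : Type*} [NormedAddCommGroup W''] [NormedSpace ℝ W'']

lemma hasFDerivAt_chart {p : M} {f : M → W} (hf : MDifferentiableAt 𝓘(ℝ, E) 𝓘(ℝ, W) f p) :
    HasFDerivAt (f ∘ (extChartAt 𝓘(ℝ, E) p).symm) (tder E W f p) (extChartAt 𝓘(ℝ, E) p p) := by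
  rw [tder_eq_fderiv_chart hf]
  refine DifferentiableAt.hasFDerivAt (MDifferentiableAt.differentiableAt ?_)
  refine MDifferentiableAt.comp _ (I' := 𝓘(ℝ, E)) ?_ (mdiffAt_chart_symm (mem_extChartAt_target p))
  rwa [(extChartAt 𝓘(ℝ, E) p).left_inv (mem_extChartAt_source p)]

lemma tder_clm_apply {p : M} {g : M → W →L[ℝ] W'} {h : M → W}
    (hg : MDifferentiableAt 𝓘(ℝ, E) 𝓘(ℝ, W →L[ℝ] W') g p)
    (hh : MDifferentiableAt 𝓘(ℝ, E) 𝓘(ℝ, W) h p) (v : E) :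
    tder E W' (fun x => g x (h x)) p v = tder E (W →L[ℝ] W') g p v (h p) + g p (tder E W h p v) := by
  have h1 := hasFDerivAt_chart (hg.clm_apply hh)
  have h2 := (hasFDerivAt_chart hg).clm_apply (hasFDerivAt_chart hh)
  rw [h1.unique h2]
  simp only [Function.comp, (extChartAt 𝓘(ℝ, E) p).left_inv (mem_extChartAt_source p)]
  rw [add_comm]
  rfl

lemma mdifferentiableAt_clm (L : W →L[ℝ] W') {p : M} {f : M → W}
    (hf : MDifferentiableAt 𝓘(ℝ, E) 𝓘(ℝ, W) f p) :
    MDifferentiableAt 𝓘(ℝ, E) 𝓘(ℝ, W') (fun x => L (f x)) p :=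
  MDifferentiableAt.comp p (I' := 𝓘(ℝ, W)) L.differentiableAt.mdifferentiableAt hf

lemma tder_clm (L : W →L[ℝ] W') {p : M} {f : M → W}
    (hf : MDifferentiableAt 𝓘(ℝ, E) 𝓘(ℝ, W) f p) (v : E) :
    tder E W' (fun x => L (f x)) p v = L (tder E W f p v) := by
  rw [tder_comp_apply (E' := W) L.differentiableAt.mdifferentiableAt hf, tder_eq_fderiv, L.fderiv]

lemma tder_bilin (B : W →L[ℝ] W' →L[ℝ] W'') {p : M} {f : M → W} {g : M → W'}
    (hf : MDifferentiableAt 𝓘(ℝ, E) 𝓘(ℝ, W) f p)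
    (hg : MDifferentiableAt 𝓘(ℝ, E) 𝓘(ℝ, W') g p) (v : E) :
    tder E W'' (fun x => B (f x) (g x)) p v = B (tder E W f p v) (g p) + B (f p) (tder E W' g p v) := by
  rw [tder_clm_apply (mdifferentiableAt_clm B hf) hg, tder_clm B hf]

lemma tder_sub {p : M} {f g : M → W}
    (hf : MDifferentiableAt 𝓘(ℝ, E) 𝓘(ℝ, W) f p)
    (hg : MDifferentiableAt 𝓘(ℝ, E) 𝓘(ℝ, W) g p) :
    tder E W (fun x => f x - g x) p = tder E W f p - tder E W g p :=
  (hasFDerivAt_chart (hf.sub hg)).unique ((hasFDerivAt_chart hf).sub (hasFDerivAt_chart hg))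

lemma tder_add {p : M} {f g : M → W}
    (hf : MDifferentiableAt 𝓘(ℝ, E) 𝓘(ℝ, W) f p)
    (hg : MDifferentiableAt 𝓘(ℝ, E) 𝓘(ℝ, W) g p) :
    tder E W (fun x => f x + g x) p = tder E W f p + tder E W g p :=
  (hasFDerivAt_chart (hf.add hg)).unique ((hasFDerivAt_chart hf).add (hasFDerivAt_chart hg))

lemma tder_neg {p : M} {f : M → W} (hf : MDifferentiableAt 𝓘(ℝ, E) 𝓘(ℝ, W) f p) :
    tder E W (fun x => - f x) p = - tder E W f p :=
  (hasFDerivAt_chart hf.neg).unique (hasFDerivAt_chart hf).neg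

end Calc

section LieGroup

variable {E : Type*} [NormedAddCommGroup E] [NormedSpace ℝ E]
  {K : Type*} [Group K] [TopologicalSpace K] [ChartedSpace E K] [LieGroup 𝓘(ℝ, E) ∞ K]

variable (E) in
/-- The adjoint representation of a Lie group, on the model space of the group. -/
def adj (k : K) : E →L[ℝ] E := tder E E (fun y => k * y * k⁻¹) (1 : K)

/-- The left invariant vector field, as a map to the model space. -/
def leftField (X : E) (k : K) : E := tder E E (fun y => k * y) (1 : K) X

lemma contMDiff_conj (k : K) : ContMDiff 𝓘(ℝ, E) 𝓘(ℝ, E) ∞ (fun y : K => k * y * k⁻¹) :=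
  (contMDiff_const.mul contMDiff_id).mul contMDiff_const

lemma mdiff_conj (k x : K) : MDifferentiableAt 𝓘(ℝ, E) 𝓘(ℝ, E) (fun y : K => k * y * k⁻¹) x :=
  (contMDiff_conj k).mdifferentiable (by simp) x

lemma mdiff_mul_left (k x : K) : MDifferentiableAt 𝓘(ℝ, E) 𝓘(ℝ, E) (fun y : K => k * y) x :=
  (contMDiff_const.mul contMDiff_id : ContMDiff 𝓘(ℝ, E) 𝓘(ℝ, E) ∞ _).mdifferentiable (by simp) x

lemma mdiff_mul_right (k x : K) : MDifferentiableAt 𝓘(ℝ, E) 𝓘(ℝ, E) (fun y : K => y * k) x :=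
  (contMDiff_id.mul contMDiff_const : ContMDiff 𝓘(ℝ, E) 𝓘(ℝ, E) ∞ _).mdifferentiable (by simp) x

lemma adj_one : adj E (1 : K) = ContinuousLinearMap.id ℝ E := by
  have : (fun y : K => 1 * y * 1⁻¹) = id := by ext; simp
  rw [adj, this, tder_id]

lemma adj_mul (k l : K) : adj E (k * l) = (adj E k).comp (adj E l) := by
  have : (fun y : K => k * l * y * (k * l)⁻¹) = (fun y => k * y * k⁻¹) ∘ (fun y => l * y * l⁻¹) := by
    ext; simp [mul_assoc]
  rw [adj, this, tder_comp (mdiff_conj _ _) (mdiff_conj _ _)]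
  simp [adj]

lemma adj_mul_apply (k l : K) (X : E) : adj E (k * l) X = adj E k (adj E l X) := by
  rw [adj_mul]; rfl

lemma adj_inv_apply (k : K) (X : E) : adj E k⁻¹ (adj E k X) = X := by
  rw [← adj_mul_apply, inv_mul_cancel, adj_one]; rfl

lemma adj_apply_inv (k : K) (X : E) : adj E k (adj E k⁻¹ X) = X := by
  rw [← adj_mul_apply, mul_inv_cancel, adj_one]; rfl

lemma contMDiff_adj : ContMDiff 𝓘(ℝ, E) 𝓘(ℝ, E →L[ℝ] E) ∞ (fun k : K => adj E k) := by
  intro k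
  refine contMDiffAt_tder_of_fixed (f := fun k y : K => k * y * k⁻¹) (q := 1) (by simp) ?_
  exact ((contMDiff_fst.mul contMDiff_snd).mul contMDiff_fst.inv).contMDiffAt

variable [CompleteSpace E]

/-- The Lie bracket of the Lie algebra of a Lie group, on the model space. -/
def bracketE (K : Type*) [Group K] [TopologicalSpace K] [ChartedSpace E K] [LieGroup 𝓘(ℝ, E) ∞ K]
    (X Y : E) : E :=
  Bracket.bracket (L := GroupLieAlgebra 𝓘(ℝ, E) K) (M := GroupLieAlgebra 𝓘(ℝ, E) K) X Y

lemma isDiffFieldAt_leftField (X : E) (k : K) : IsDiffFieldAt (leftField X : K → E) k :=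
  mdifferentiableAt_mulInvariantVectorField (I := 𝓘(ℝ, E)) (G := K) X

lemma leftField_one (X : E) : leftField X (1 : K) = X := by
  have : (fun y : K => 1 * y) = id := by ext; simp
  rw [leftField, this, tder_id]; rfl

/-- The differential of the adjoint representation is given by the Lie bracket. -/
theorem tder_adj (V X : E) :
    tder E E (fun k : K => adj E k X) 1 V = bracketE K V X := by
  set f := extChartAt 𝓘(ℝ, E) (1 : K) with hfdef
  have hf : ContMDiffAt 𝓘(ℝ, E) 𝓘(ℝ, E) ∞ f 1 := contMDiffAt_extChartAt
  have hf1 : tder E E f 1 = ContinuousLinearMap.id ℝ E := mfderiv_extChartAt_self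
  have hev : ∀ᶠ k : K in 𝓝 1, MDifferentiableAt 𝓘(ℝ, E) 𝓘(ℝ, E) f k := by
    filter_upwards [extChartAt_source_mem_nhds (I := 𝓘(ℝ, E)) (1 : K)] with k hk
    exact mdiffAt_chart hk
  have hbr := tder_mlieBracket (hf.of_le two_le_smooth) (isDiffFieldAt_leftField V (1 : K))
    (isDiffFieldAt_leftField X (1 : K))
  have hbr' := hbr
  change tder E E f 1 (bracketE K V X) = _ at hbr'
  rw [leftField_one, leftField_one] at hbr'
  have hL : ∀ Z : E, (fun k => tder E E f k (leftField Z k)) =ᶠ[𝓝 (1 : K)]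
      fun k => tder E E (fun y => f (k * y)) 1 Z := by
    intro Z
    filter_upwards [hev] with k hk
    rw [tder_comp_apply (E' := E) (g := f) (by rwa [mul_one]) (mdiff_mul_left k 1), mul_one]
    rfl
  have hG : ContMDiffAt (𝓘(ℝ, E).prod 𝓘(ℝ, E)) 𝓘(ℝ, E) ∞ (fun z : K × K => f (z.1 * z.2)) (1, 1) :=
    ContMDiffAt.comp_of_eq (I' := 𝓘(ℝ, E)) (y := 1) hf
      (contMDiffAt_fst.mul contMDiffAt_snd) (by simp)
  have hG' : ContMDiffAt (𝓘(ℝ, E).prod 𝓘(ℝ, E)) 𝓘(ℝ, E) ∞ (fun z : K × K => f (z.2 * z.1)) (1, 1) :=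
    ContMDiffAt.comp_of_eq (I' := 𝓘(ℝ, E)) (y := 1) hf
      (contMDiffAt_snd.mul contMDiffAt_fst) (by simp)
  set g : K → E →L[ℝ] E := fun k => tder E E (fun z => f (z * k)) 1 with hgdef
  have hg : ContMDiffAt 𝓘(ℝ, E) 𝓘(ℝ, E →L[ℝ] E) ∞ g 1 :=
    contMDiffAt_tder_of_fixed' (f := fun k z : K => f (z * k)) hG'
  have hX : (fun k => tder E E f k (leftField X k)) =ᶠ[𝓝 (1 : K)] fun k => g k (adj E k X) := by
    filter_upwards [hL X, hev] with k hk hk2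
    rw [hk]
    have : (fun y => f (k * y)) = fun y => (fun z => f (z * k)) (k * y * k⁻¹) := by
      ext y; simp
    rw [this, tder_comp_apply (E' := E) (g := fun z => f (z * k)) _ (mdiff_conj k 1)]
    · simp [g, adj]
    · refine MDifferentiableAt.comp _ (I' := 𝓘(ℝ, E)) ?_ (mdiff_mul_right k _)
      simpa using hk2
  have hadj : MDifferentiableAt 𝓘(ℝ, E) 𝓘(ℝ, E) (fun k : K => adj E k X) 1 :=
    (contMDiff_adj.mdifferentiable (by simp) (1 : K)).clm_apply mdifferentiableAt_const
  have hg1 : MDifferentiableAt 𝓘(ℝ, E) 𝓘(ℝ, E →L[ℝ] E) g 1 := hg.mdifferentiableAt (by simp)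
  rw [tder_congr hX, tder_congr (hL V), tder_clm_apply hg1 hadj, adj_one] at hbr'
  have h5 : tder E (E →L[ℝ] E) g 1 V X = tder E E (fun k => g k X) 1 V := by
    rw [tder_clm_apply hg1 mdifferentiableAt_const, tder_const]
    simp
  have h6 := tder_tder_comm (hG'.of_le two_le_smooth) V X
  have h7 : g 1 = ContinuousLinearMap.id ℝ E := by
    simp only [g, mul_one]
    exact hf1
  rw [ContinuousLinearMap.id_apply, h5, h6, h7, hf1, add_sub_cancel_left] at hbr'
  exact hbr'.symm

end LieGroup

section LieAlgebra

variable {L : Type*} [LieRing L] [LieAlgebra ℝ L] (κ : L →ₗ[ℝ] L →ₗ[ℝ] ℝ)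

/-- Root spaces of a self-centralizing abelian subspace have complex dimension one. A complex root
vector is given by its real and imaginary parts. -/
theorem root_space_unique (hpos : ∀ x, x ≠ 0 → 0 < κ x x)
    (hinv : ∀ x y z, κ ⁅x, y⁆ z = κ x ⁅y, z⁆) (t : Submodule ℝ L)
    (ht : ∀ x, (∀ s ∈ t, ⁅s, x⁆ = 0) → x ∈ t)
    (α : L → ℝ) {U V U' V' : L}
    (hU : ∀ s ∈ t, ⁅s, U⁆ = -(α s) • V) (hV : ∀ s ∈ t, ⁅s, V⁆ = (α s) • U)
    (hU' : ∀ s ∈ t, ⁅s, U'⁆ = -(α s) • V') (hV' : ∀ s ∈ t, ⁅s, V'⁆ = (α s) • U')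
    {s₀ : L} (hs₀ : s₀ ∈ t) (hα : α s₀ ≠ 0) (hU0 : U ≠ 0)
    (h1 : κ U U' + κ V V' = 0) (h2 : κ U V' - κ V U' = 0) : U' = 0 := by
  have hdef : ∀ x, κ x x = 0 → x = 0 := fun x hx => by
    by_contra h
    exact absurd hx (hpos x h).ne'
  have hnn : ∀ x, 0 ≤ κ x x := fun x => by
    by_cases h : x = 0
    · simp [h]
    · exact (hpos x h).le
  have sw : ∀ x s : L, ⁅x, s⁆ = -⁅s, x⁆ := fun x s => (lie_skew x s).symm
  have hA : ⁅U, U'⁆ + ⁅V, V'⁆ = 0 := by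
    have hm : ⁅U, U'⁆ + ⁅V, V'⁆ ∈ t := by
      refine ht _ fun s hs => ?_
      rw [lie_add, leibniz_lie s U U', leibniz_lie s V V', hU s hs, hU' s hs, hV s hs, hV' s hs]
      simp only [neg_smul, neg_lie, smul_lie, lie_neg, lie_smul]
      abel
    refine hdef _ ?_
    set s := ⁅U, U'⁆ + ⁅V, V'⁆ with hs
    have e : κ s s = κ ⁅U, U'⁆ s + κ ⁅V, V'⁆ s := by
      have : ∀ z, κ s z = κ ⁅U, U'⁆ z + κ ⁅V, V'⁆ z := fun z => by rw [hs, map_add]; rfl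
      exact this s
    rw [e, hinv, hinv, sw U' s, sw V' s, hU' s hm, hV' s hm]
    simp only [map_neg, map_smul, neg_smul, smul_eq_mul, neg_neg]
    linear_combination (α s) * h2
  have hB : ⁅U, V'⁆ - ⁅V, U'⁆ = 0 := by
    have hm : ⁅U, V'⁆ - ⁅V, U'⁆ ∈ t := by
      refine ht _ fun s hs => ?_
      rw [lie_sub, leibniz_lie s U V', leibniz_lie s V U', hU s hs, hU' s hs, hV s hs, hV' s hs]
      simp only [neg_smul, neg_lie, smul_lie, lie_neg, lie_smul]
      abel
    refine hdef _ ?_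
    set s := ⁅U, V'⁆ - ⁅V, U'⁆ with hs
    have e : κ s s = κ ⁅U, V'⁆ s - κ ⁅V, U'⁆ s := by
      have : ∀ z, κ s z = κ ⁅U, V'⁆ z - κ ⁅V, U'⁆ z := fun z => by rw [hs, map_sub]; rfl
      exact this s
    rw [e, hinv, hinv, sw U' s, sw V' s, hU' s hm, hV' s hm]
    simp only [map_neg, map_smul, neg_smul, smul_eq_mul, neg_neg]
    linear_combination -(α s) * h1
  set H := ⁅U, V⁆ with hH
  have hHt : H ∈ t := by
    refine ht _ fun s hs => ?_
    rw [hH, leibniz_lie s U V, hU s hs, hV s hs]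
    simp
  have hHs : ∀ s ∈ t, κ H s = -(α s) * κ U U := by
    intro s hs
    rw [hH, hinv, sw V s, hV s hs]
    simp
  have hH0 : H ≠ 0 := by
    intro h
    have := hHs s₀ hs₀
    rw [h] at this
    simp only [map_zero, LinearMap.zero_apply] at this
    exact mul_ne_zero (neg_ne_zero.2 hα) (hpos U hU0).ne' this.symm
  have hαH : α H < 0 := by
    have e := hHs H hHt
    have p1 := hpos H hH0
    have p2 := hpos U hU0
    by_contra hcon
    push Not at hcon
    nlinarith [mul_nonneg hcon p2.le]
  have e1 : ⁅H, U'⁆ = ⁅U, ⁅U, V'⁆⁆ + ⁅V, ⁅V, V'⁆⁆ := by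
    have a1 : ⁅V, U'⁆ = ⁅U, V'⁆ := (sub_eq_zero.1 hB).symm
    have a2 : ⁅U, U'⁆ = -⁅V, V'⁆ := eq_neg_of_add_eq_zero_left hA
    rw [hH, lie_lie, a1, a2, lie_neg, sub_neg_eq_add]
  have e2 : κ ⁅H, U'⁆ V' = -(κ ⁅U, V'⁆ ⁅U, V'⁆ + κ ⁅V, V'⁆ ⁅V, V'⁆) := by
    rw [e1, map_add, LinearMap.add_apply, sw U ⁅U, V'⁆, sw V ⁅V, V'⁆]
    simp only [map_neg, LinearMap.neg_apply]
    rw [hinv ⁅U, V'⁆ U V', hinv ⁅V, V'⁆ V V']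
    ring
  rw [hU' H hHt] at e2
  simp only [map_smul, LinearMap.smul_apply, smul_eq_mul] at e2
  have hV'0 : V' = 0 := by
    refine hdef _ (le_antisymm ?_ (hnn _))
    have p1 := hnn ⁅U, V'⁆
    have p2 := hnn ⁅V, V'⁆
    by_contra hcon
    push Not at hcon
    nlinarith [mul_pos (neg_pos.2 hαH) hcon]
  have := hV' s₀ hs₀
  rw [hV'0, lie_zero] at this
  exact (smul_eq_zero.1 this.symm).resolve_left hα

end LieAlgebra

section LieAlgebra

variable {L : Type*} [LieRing L] [LieAlgebra ℝ L] (κ : L →ₗ[ℝ] L →ₗ[ℝ] ℝ)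

/-- A complex structure that commutes with a self-centralizing abelian subspace is isometric on
joint eigenvectors. -/
theorem isometric_on_joint_eigenvector (hsymm : ∀ x y, κ x y = κ y x)
    (hpos : ∀ x, x ≠ 0 → 0 < κ x x)
    (hinv : ∀ x y z, κ ⁅x, y⁆ z = κ x ⁅y, z⁆) (t : Submodule ℝ L)
    (habel : ∀ s ∈ t, ∀ s' ∈ t, ⁅s, s'⁆ = 0)
    (ht : ∀ x, (∀ s ∈ t, ⁅s, x⁆ = 0) → x ∈ t) (J : L →ₗ[ℝ] L) {x : L}
    (hxt : ∀ s ∈ t, κ x s = 0)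
    (hJJ : J (J x) = -x) (hJs : ∀ s ∈ t, J ⁅s, x⁆ = ⁅s, J x⁆) (χ : L → L → ℝ)
    (hx : ∀ s ∈ t, ∀ s' ∈ t, ⁅s, ⁅s', x⁆⁆ = χ s s' • x)
    (hJx : ∀ s ∈ t, ∀ s' ∈ t, ⁅s, ⁅s', J x⁆⁆ = χ s s' • J x) :
    κ (J x) (J x) = κ x x := by
  by_cases hx0 : x = 0
  · simp [hx0]
  have hxx := hpos x hx0
  obtain ⟨s₀, hs₀, hs₀x⟩ : ∃ s ∈ t, ⁅s, x⁆ ≠ 0 := by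
    by_contra! hcon
    exact hxx.ne' (hxt x (ht x hcon))
  have hskew : ∀ s y z, κ ⁅s, y⁆ z = -κ y ⁅s, z⁆ := fun s y z => by
    rw [← lie_skew, map_neg, LinearMap.neg_apply, hinv]
  have hcomm : ∀ s ∈ t, ∀ s' ∈ t, ∀ z : L, ⁅s, ⁅s', z⁆⁆ = ⁅s', ⁅s, z⁆⁆ := fun s hs s' hs' z => by
    rw [leibniz_lie s s' z, habel s hs s' hs', zero_lie, zero_add]
  have hneg : χ s₀ s₀ < 0 := by
    have h1 := hskew s₀ x ⁅s₀, x⁆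
    rw [hx s₀ hs₀ s₀ hs₀, map_smul, smul_eq_mul] at h1
    have := hpos _ hs₀x
    by_contra hcon
    push Not at hcon
    nlinarith [mul_nonneg hcon hxx.le]
  set c := √(-χ s₀ s₀) with hc
  have hcpos : 0 < c := Real.sqrt_pos.2 (by linarith)
  have hcc : c * c = -χ s₀ s₀ := Real.mul_self_sqrt (by linarith)
  set R : L →ₗ[ℝ] L := c⁻¹ • (LieAlgebra.ad ℝ L s₀) with hR
  have hRa : ∀ z, R z = c⁻¹ • ⁅s₀, z⁆ := fun z => rfl
  have hs₀R : ∀ z, ⁅s₀, z⁆ = c • R z := fun z => by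
    rw [hRa, smul_smul, mul_inv_cancel₀ hcpos.ne', one_smul]
  have hRskew : ∀ y z, κ (R y) z = -κ y (R z) := fun y z => by
    rw [hRa, hRa, map_smul, LinearMap.smul_apply, hskew, map_smul]
    simp
  have hRs : ∀ s ∈ t, ∀ z, ⁅s, R z⁆ = R ⁅s, z⁆ := fun s hs z => by
    rw [hRa, hRa, lie_smul, hcomm s hs s₀ hs₀]
  set α : L → ℝ := fun s => c * χ s₀ s / χ s₀ s₀ with hαdef
  have hRR : ∀ z, (∀ s ∈ t, ∀ s' ∈ t, ⁅s, ⁅s', z⁆⁆ = χ s s' • z) → R (R z) = -z := fun z hz => by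
    rw [hRa, hRa, lie_smul, hz s₀ hs₀ s₀ hs₀, smul_smul, smul_smul]
    have : c⁻¹ * c⁻¹ * χ s₀ s₀ = -1 := by
      field_simp
      nlinarith
    rw [this, neg_one_smul]
  have hα : ∀ z, (∀ s ∈ t, ∀ s' ∈ t, ⁅s, ⁅s', z⁆⁆ = χ s s' • z) →
      ∀ s ∈ t, ⁅s, z⁆ = α s • R z := fun z hz s hs => by
    have h1 : ⁅s₀, ⁅s₀, ⁅s, z⁆⁆⁆ = χ s₀ s₀ • ⁅s, z⁆ := by
      rw [hcomm s₀ hs₀ s hs, hcomm s₀ hs₀ s hs, hz s₀ hs₀ s₀ hs₀, lie_smul]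
    rw [hz s₀ hs₀ s hs, lie_smul, hs₀R, smul_smul] at h1
    rw [hαdef]
    simp only
    rw [div_eq_inv_mul, mul_smul, mul_comm c, h1, smul_smul, inv_mul_cancel₀ hneg.ne, one_smul]
  have hα₀ : α s₀ ≠ 0 := by
    simp only [hαdef]
    rw [mul_div_assoc, div_self hneg.ne, mul_one]
    exact hcpos.ne'
  have hRx := hRR x hx
  have hRJx := hRR _ hJx
  have hRRxx : κ (R x) (R x) = κ x x := by rw [hRskew, hRx]; simp
  have hxRx : κ x (R x) = 0 := by
    have := hRskew x x
    rw [hsymm] at this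
    linarith
  set a := κ x (J x) / κ x x with ha
  set b := κ (R x) (J x) / κ x x with hb
  set y := J x - a • x - b • R x with hy
  have hRy : R y = R (J x) - a • R x + b • x := by
    rw [hy, map_sub, map_sub, map_smul, map_smul, hRx]
    simp
  have hRRy : R (R y) = -y := by
    rw [hRy, map_add, map_sub, map_smul, map_smul, hRx, hRJx, hy]
    module
  have hsy : ∀ s ∈ t, ⁅s, y⁆ = α s • R y := fun s hs => by
    rw [hRy, hy, lie_sub, lie_sub, lie_smul, lie_smul, hα x hx s hs, hα _ hJx s hs, hRs s hs,
      hα x hx s hs, map_smul, hRx]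
    module
  have hxy : κ x y = 0 := by
    rw [hy]
    simp only [map_sub, map_smul, smul_eq_mul, hxRx, ha]
    field_simp
    ring
  have hRxy : κ (R x) y = 0 := by
    rw [hy]
    simp only [map_sub, map_smul, smul_eq_mul, hRRxx, hb, hsymm (R x) x, hxRx]
    field_simp
    ring
  have hy0 : y = 0 := by
    refine root_space_unique κ hpos hinv t ht α (U := x) (V := -R x) (U' := y) (V' := -R y)
      ?_ ?_ ?_ ?_ hs₀ hα₀ hx0 ?_ ?_
    · intro s hs
      rw [hα x hx s hs]
      module
    · intro s hs
      rw [lie_neg, hRs s hs, hα x hx s hs, map_smul, hRx]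
      module
    · intro s hs
      rw [hsy s hs]
      module
    · intro s hs
      rw [lie_neg, hRs s hs, hsy s hs, map_smul, hRRy]
      module
    · simp only [map_neg, LinearMap.neg_apply, neg_neg]
      rw [hRskew, hRRy, hxy]
      simp [hxy]
    · simp only [map_neg, LinearMap.neg_apply]
      have := hRskew x y
      rw [hRxy] at this ⊢
      linarith
  have hJ : J x = a • x + b • R x := by
    rw [hy] at hy0
    rw [← sub_eq_zero, ← hy0]
    module
  have hJR : J (R x) = R (J x) := by
    rw [hRa, map_smul, hJs s₀ hs₀, hRa]
  have h1 : (a * a - b * b + 1) • x + (2 * a * b) • R x = 0 := by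
    have := hJJ
    rw [hJ, map_add, map_smul, map_smul, hJR, hJ, map_add, map_smul, map_smul, hRx] at this
    rw [← sub_eq_zero] at this
    rw [← this]
    module
  have h2 : a * a - b * b + 1 = 0 := by
    have := congrArg (κ x) h1
    simp only [map_add, map_smul, smul_eq_mul, hxRx, map_zero, mul_zero, add_zero] at this
    exact (mul_eq_zero.1 this).resolve_right hxx.ne'
  have h3 : a * b = 0 := by
    have := congrArg (κ (R x)) h1
    simp only [map_add, map_smul, smul_eq_mul, hRRxx, hsymm (R x) x, hxRx, map_zero, mul_zero,
      zero_add] at this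
    have := (mul_eq_zero.1 this).resolve_right hxx.ne'
    linarith
  have h4 : a = 0 := by
    rcases mul_eq_zero.1 h3 with h | h
    · exact h
    · rw [h] at h2
      nlinarith [mul_self_nonneg a]
  rw [hJ, h4, zero_smul, zero_add]
  simp only [map_smul, LinearMap.smul_apply, smul_eq_mul, hRRxx]
  rw [h4] at h2
  linear_combination (-κ x x) * h2

/-- Commuting operators that are symmetric for an inner product have a basis of joint
eigenvectors. -/
theorem iSup_joint_eigenspaces_eq_top {V : Type*} [AddCommGroup V] [Module ℝ V]
    [FiniteDimensional ℝ V] (B : V →ₗ[ℝ] V →ₗ[ℝ] ℝ) (hsymm : ∀ x y, B x y = B y x)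
    (hpos : ∀ x, x ≠ 0 → 0 < B x x) {ι : Type*} {T : ι → V →ₗ[ℝ] V}
    (hT : ∀ i x y, B (T i x) y = B x (T i y)) (h : ∀ i j x, T i (T j x) = T j (T i x)) :
    ⨆ χ : ι → ℝ, ⨅ i, Module.End.eigenspace (T i) (χ i) = ⊤ := by
  let core : InnerProductSpace.Core ℝ V :=
    { inner := fun x y => B x y
      conj_inner_symm := fun x y => hsymm y x
      re_inner_nonneg := fun x => by
        by_cases hx : x = 0
        · simp [hx]
        · exact (hpos x hx).le
      add_left := fun x y z => by simp
      smul_left := fun x y r => by simp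
      definite := fun x hx => by
        by_contra h
        exact absurd hx (hpos x h).ne' }
  let _ : NormedAddCommGroup V := core.toNormedAddCommGroup
  let _ : InnerProductSpace ℝ V := InnerProductSpace.ofCore core.toCore
  exact LinearMap.IsSymmetric.iSup_iInf_eq_top_of_commute (fun i x y => hT i x y)
    fun i j _ => LinearMap.ext fun x => h i j x

/-- An invariant almost complex structure on the complement of a self-centralizing abelian subspace
is isometric for every invariant inner product. -/
theorem isometric_of_commute_abelian [FiniteDimensional ℝ L] (hsymm : ∀ x y, κ x y = κ y x)
    (hpos : ∀ x, x ≠ 0 → 0 < κ x x)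
    (hinv : ∀ x y z, κ ⁅x, y⁆ z = κ x ⁅y, z⁆) (t : Submodule ℝ L)
    (habel : ∀ s ∈ t, ∀ s' ∈ t, ⁅s, s'⁆ = 0)
    (ht : ∀ x, (∀ s ∈ t, ⁅s, x⁆ = 0) → x ∈ t) (m : Submodule ℝ L)
    (hm : ∀ s ∈ t, ∀ x ∈ m, ⁅s, x⁆ ∈ m) (hmt : ∀ s ∈ t, ∀ x ∈ m, κ x s = 0)
    (J : L →ₗ[ℝ] L) (hJm : ∀ x ∈ m, J x ∈ m)
    (hJJ : ∀ x ∈ m, J (J x) = -x) (hJs : ∀ s ∈ t, ∀ x ∈ m, J ⁅s, x⁆ = ⁅s, J x⁆)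
    {x y : L} (hx : x ∈ m) (hy : y ∈ m) : κ (J x) (J y) = κ x y := by
  have hskew : ∀ s y z, κ ⁅s, y⁆ z = -κ y ⁅s, z⁆ := fun s y z => by
    rw [← lie_skew, map_neg, LinearMap.neg_apply, hinv]
  have hcomm : ∀ s ∈ t, ∀ s' ∈ t, ∀ z : L, ⁅s, ⁅s', z⁆⁆ = ⁅s', ⁅s, z⁆⁆ := fun s hs s' hs' z => by
    rw [leibniz_lie s s' z, habel s hs s' hs', zero_lie, zero_add]
  let A : t → m →ₗ[ℝ] m := fun s => LinearMap.restrict (LieAlgebra.ad ℝ L s) fun x hx => hm s s.2 x hx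
  have hA : ∀ s z, ((A s z : m) : L) = ⁅(s : L), (z : L)⁆ := fun s z => rfl
  let T : t × t → m →ₗ[ℝ] m := fun i => A i.1 ∘ₗ A i.2
  have hTa : ∀ i z, ((T i z : m) : L) = ⁅(i.1 : L), ⁅(i.2 : L), (z : L)⁆⁆ := fun i z => rfl
  let B : m →ₗ[ℝ] m →ₗ[ℝ] ℝ := κ.domRestrict₁₂ m m
  have hB : ∀ x y, B x y = κ x y := fun x y => rfl
  have hTB : ∀ i x y, B (T i x) y = B x (T i y) := fun i x y => by
    rw [hB, hB, hTa, hTa, hskew, hskew, neg_neg, hcomm _ i.1.2 _ i.2.2]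
  have htop := iSup_joint_eigenspaces_eq_top B (fun x y => hsymm x y)
    (fun x hx => hpos x fun h => hx (Subtype.ext h)) (T := T) hTB
    (fun i j x => Subtype.ext (by
      simp only [hTa]
      rw [hcomm _ i.2.2 _ j.1.2, hcomm _ i.1.2 _ j.1.2, hcomm _ i.2.2 _ j.2.2,
        hcomm _ i.1.2 _ j.2.2]))
  let JJ : m →ₗ[ℝ] m := J.restrict hJm
  have hJJa : ∀ z, ((JJ z : m) : L) = J z := fun z => rfl
  have hJT : ∀ i z, JJ (T i z) = T i (JJ z) := fun i z => Subtype.ext (by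
    rw [hJJa, hTa, hTa, hJs _ i.1.2 _ (hm _ i.2.2 _ z.2), hJs _ i.2.2 _ z.2]; rfl)
  have heig : ∀ χ : t × t → ℝ, ∀ z ∈ ⨅ i, Module.End.eigenspace (T i) (χ i), ∀ i, T i z = χ i • z :=
    fun χ z hz i => Module.End.mem_eigenspace_iff.1 ((Submodule.mem_iInf _).1 hz i)
  have hdiag : ∀ χ : t × t → ℝ, ∀ z : m, (∀ i, T i z = χ i • z) → B (JJ z) (JJ z) = B z z := by
    intro χ z hz
    classical
    refine isometric_on_joint_eigenvector κ hsymm hpos hinv t habel ht J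
      (fun s hs => hmt s hs z z.2) (hJJ z z.2) (fun s hs => hJs s hs z z.2)
      (fun s s' => if h : s ∈ t ∧ s' ∈ t then χ (⟨s, h.1⟩, ⟨s', h.2⟩) else 0) ?_ ?_
    · intro s hs s' hs'
      rw [dif_pos ⟨hs, hs'⟩]
      exact congrArg Subtype.val (hz (⟨s, hs⟩, ⟨s', hs'⟩))
    · intro s hs s' hs'
      rw [dif_pos ⟨hs, hs'⟩]
      have := hJT (⟨s, hs⟩, ⟨s', hs'⟩) z
      rw [hz, map_smul] at this
      exact congrArg Subtype.val this.symm
  have hJeig : ∀ χ : t × t → ℝ, ∀ z : m, (∀ i, T i z = χ i • z) →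
      ∀ i, T i (JJ z) = χ i • JJ z := fun χ z hz i => by
    rw [← hJT, hz, map_smul]
  have horth : ∀ χ χ' : t × t → ℝ, χ ≠ χ' → ∀ z z' : m, (∀ i, T i z = χ i • z) →
      (∀ i, T i z' = χ' i • z') → B z z' = 0 := by
    intro χ χ' hne z z' hz hz'
    obtain ⟨i, hi⟩ := Function.ne_iff.1 hne
    have := hTB i z z'
    rw [hz, hz', map_smul, map_smul, LinearMap.smul_apply, smul_eq_mul, smul_eq_mul] at this
    have h2 : (χ i - χ' i) * B z z' = 0 := by linarith
    exact (mul_eq_zero.1 h2).resolve_left (sub_ne_zero.2 hi)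
  have key : ∀ z z' : m, B (JJ z) (JJ z') = B z z' := by
    intro z z'
    have hz : z ∈ ⨆ χ : t × t → ℝ, ⨅ i, Module.End.eigenspace (T i) (χ i) := by rw [htop]; trivial
    have hz' : z' ∈ ⨆ χ : t × t → ℝ, ⨅ i, Module.End.eigenspace (T i) (χ i) := by rw [htop]; trivial
    induction hz using Submodule.iSup_induction' with
    | zero => simp
    | add u v _ _ hu hv => simp only [map_add, LinearMap.add_apply, hu, hv]
    | mem χ u hu =>
      induction hz' using Submodule.iSup_induction' with
      | zero => simp
      | add v w _ _ hv hw => simp only [map_add, hv, hw]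
      | mem χ' v hv =>
        have hu' := heig χ u hu
        have hv' := heig χ' v hv
        by_cases hne : χ = χ'
        · subst hne
          have h1 := hdiag χ _ hu'
          have h2 := hdiag χ _ hv'
          have h3 := hdiag χ (u + v) fun i => by rw [map_add, hu', hv', smul_add]
          simp only [map_add, LinearMap.add_apply] at h3
          have h4 : B (JJ v) (JJ u) = B (JJ u) (JJ v) := hsymm _ _
          have h5 : B v u = B u v := hsymm _ _
          linarith
        · rw [horth χ χ' hne u v hu' hv', horth χ χ' hne _ _ (hJeig χ u hu') (hJeig χ' v hv')]
  exact key ⟨x, hx⟩ ⟨y, hy⟩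

/-- The square of a skew operator has nonpositive trace, and trace zero only if the operator
vanishes. -/
theorem trace_sq_neg_of_skew {V : Type*} [AddCommGroup V] [Module ℝ V]
    [FiniteDimensional ℝ V] (B : V →ₗ[ℝ] V →ₗ[ℝ] ℝ) (hsymm : ∀ x y, B x y = B y x)
    (hpos : ∀ x, x ≠ 0 → 0 < B x x) {A : V →ₗ[ℝ] V} (hA : ∀ x y, B (A x) y = -B x (A y))
    (hA0 : A ≠ 0) : LinearMap.trace ℝ V (A ∘ₗ A) < 0 := by
  let core : InnerProductSpace.Core ℝ V :=
    { inner := fun x y => B x y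
      conj_inner_symm := fun x y => hsymm y x
      re_inner_nonneg := fun x => by
        by_cases hx : x = 0
        · simp [hx]
        · exact (hpos x hx).le
      add_left := fun x y z => by simp
      smul_left := fun x y r => by simp
      definite := fun x hx => by
        by_contra h
        exact absurd hx (hpos x h).ne' }
  let _ : NormedAddCommGroup V := core.toNormedAddCommGroup
  let _ : InnerProductSpace ℝ V := InnerProductSpace.ofCore core.toCore
  let b := stdOrthonormalBasis ℝ V
  have hnn : ∀ x, 0 ≤ B x x := fun x => by
    by_cases hx : x = 0
    · simp [hx]
    · exact (hpos x hx).le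
  rw [LinearMap.trace_eq_sum_inner _ b]
  have h1 : ∀ i, inner ℝ (b i) ((A ∘ₗ A) (b i)) = -B (A (b i)) (A (b i)) := fun i => by
    rw [hA, neg_neg]; rfl
  simp only [h1, Finset.sum_neg_distrib, Left.neg_neg_iff]
  refine Finset.sum_pos' (fun i _ => hnn _) ?_
  by_contra! hcon
  refine hA0 (b.toBasis.ext fun i => ?_)
  by_contra h
  have := hcon i (Finset.mem_univ _)
  exact absurd (hpos _ h) (not_lt.2 (by simpa using this))

end LieAlgebra

section LieAlgebra

variable {L : Type*} [LieRing L] [LieAlgebra ℝ L]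

/-- The Killing form of a semisimple Lie algebra with an invariant inner product is negative
definite. -/
theorem killingForm_neg_of_invariant_inner [FiniteDimensional ℝ L] [LieAlgebra.IsSemisimple ℝ L] (B : L →ₗ[ℝ] L →ₗ[ℝ] ℝ)
    (hsymm : ∀ x y, B x y = B y x)
    (hpos : ∀ x, x ≠ 0 → 0 < B x x) (hB : ∀ v x y : L, B ⁅v, x⁆ y = -B x ⁅v, y⁆) {x : L} (hx : x ≠ 0) :
    killingForm ℝ L x x < 0 := by
  rw [killingForm_apply_apply]
  refine trace_sq_neg_of_skew B hsymm hpos (fun y z => hB x y z) fun h => hx ?_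
  have h1 : x ∈ LieAlgebra.center ℝ L := by
    rw [LieModule.mem_maxTrivSubmodule]
    intro y
    have h2 : LieAlgebra.ad ℝ L x y = 0 := by rw [h]; rfl
    rw [LieAlgebra.ad_apply] at h2
    rw [← lie_skew, h2, neg_zero]
  rwa [LieAlgebra.center_eq_bot, LieSubmodule.mem_bot] at h1

lemma isKilling_of_killingForm_neg (h : ∀ x : L, x ≠ 0 → killingForm ℝ L x x < 0) :
    LieAlgebra.IsKilling ℝ L where
  killingCompl_top_eq_bot := by
    rw [LieSubmodule.eq_bot_iff]
    intro x hx
    by_contra hx0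
    have := h x hx0
    rw [LieIdeal.mem_killingCompl] at hx
    exact this.ne (hx x trivial)

lemma killingForm_lie_left (x y z : L) :
    killingForm ℝ L ⁅x, y⁆ z = killingForm ℝ L x ⁅y, z⁆ :=
  LieModule.traceForm_apply_lie_apply ℝ L L x y z

end LieAlgebra

section LieGroup

variable {E : Type*} [NormedAddCommGroup E] [NormedSpace ℝ E] [FiniteDimensional ℝ E]
  {K : Type*} [Group K] [TopologicalSpace K] [ChartedSpace E K] [LieGroup 𝓘(ℝ, E) ∞ K]

/-- A compact Lie group has an `Ad`-invariant inner product on its Lie algebra. -/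
theorem exists_adj_invariant_inner [T2Space K] [CompactSpace K] :
    ∃ B : E →ₗ[ℝ] E →ₗ[ℝ] ℝ, (∀ x y, B x y = B y x) ∧ (∀ x, x ≠ 0 → 0 < B x x) ∧
      ∀ (k : K) x y, B (adj E k x) (adj E k y) = B x y := by
  have : IsTopologicalGroup K := topologicalGroup_of_lieGroup 𝓘(ℝ, E) ∞
  let _ : MeasurableSpace K := borel K
  have : BorelSpace K := ⟨rfl⟩
  let μ : MeasureTheory.Measure K := MeasureTheory.Measure.haar
  let φ : E ≃L[ℝ] EuclideanSpace ℝ (Fin (Module.finrank ℝ E)) := toEuclidean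
  let f : E → E → K → ℝ := fun x y k => inner ℝ (φ (adj E k⁻¹ x)) (φ (adj E k⁻¹ y))
  have hadj : ∀ x, Continuous fun k : K => φ (adj E k⁻¹ x) := fun x =>
    φ.continuous.comp (((contMDiff_adj (E := E) (K := K)).continuous.comp continuous_inv).clm_apply
      continuous_const)
  have hf : ∀ x y, Continuous (f x y) := fun x y => (hadj x).inner (hadj y)
  have hcs : ∀ g : K → ℝ, HasCompactSupport g := fun g => HasCompactSupport.of_compactSpace g
  have hint : ∀ x y, MeasureTheory.Integrable (f x y) μ := fun x y =>
    (hf x y).integrable_of_hasCompactSupport (hcs _)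
  have hsymm : ∀ x y, f x y = f y x := fun x y => funext fun k => real_inner_comm _ _
  have hadd : ∀ x x' y, f (x + x') y = f x y + f x' y := fun x x' y => funext fun k => by
    simp only [f, map_add, inner_add_left, Pi.add_apply]
  have hsmul : ∀ (c : ℝ) x y, f (c • x) y = c • f x y := fun c x y => funext fun k => by
    simp only [f, map_smul, real_inner_smul_left, Pi.smul_apply, smul_eq_mul]
  have h1 : ∀ x x' y, ∫ k, f (x + x') y k ∂μ = ∫ k, f x y k ∂μ + ∫ k, f x' y k ∂μ :=
    fun x x' y => by
      rw [hadd, ← MeasureTheory.integral_add (hint x y) (hint x' y)]; rfl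
  have h2 : ∀ (c : ℝ) x y, ∫ k, f (c • x) y k ∂μ = c • ∫ k, f x y k ∂μ :=
    fun c x y => by
      rw [hsmul, ← MeasureTheory.integral_smul]; rfl
  refine ⟨LinearMap.mk₂ ℝ (fun x y => ∫ k, f x y k ∂μ) h1 h2
    (fun x y y' => by rw [hsymm, h1, hsymm y, hsymm y'])
    (fun c x y => by rw [hsymm, h2, hsymm y]), fun x y => ?_, fun x hx => ?_, fun l x y => ?_⟩
  · rw [LinearMap.mk₂_apply, LinearMap.mk₂_apply, hsymm]
  · rw [LinearMap.mk₂_apply]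
    refine (hf x x).integral_pos_of_hasCompactSupport_nonneg_nonzero (x := 1) (hcs _)
      (fun k => real_inner_self_nonneg) ?_
    simpa [f, adj_one] using hx
  · rw [LinearMap.mk₂_apply, LinearMap.mk₂_apply,
      ← MeasureTheory.integral_mul_left_eq_self (μ := μ) (f x y) l⁻¹]
    congr 1
    ext k
    simp only [f, ← adj_mul_apply, mul_inv_rev, inv_inv]

variable [CompleteSpace E]

instance : FiniteDimensional ℝ (GroupLieAlgebra 𝓘(ℝ, E) K) :=
  inferInstanceAs (FiniteDimensional ℝ E)

variable (K) in
/-- The Lie bracket as a continuous bilinear map on the model space. -/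
def brk : E →L[ℝ] E →L[ℝ] E :=
  LinearMap.toContinuousBilinearMap (LinearMap.mk₂ ℝ (bracketE K)
    (fun x y z => add_lie (L := GroupLieAlgebra 𝓘(ℝ, E) K) (M := GroupLieAlgebra 𝓘(ℝ, E) K) x y z)
    (fun c x y => smul_lie (R := ℝ) (L := GroupLieAlgebra 𝓘(ℝ, E) K)
      (M := GroupLieAlgebra 𝓘(ℝ, E) K) c x y)
    (fun x y z => lie_add (L := GroupLieAlgebra 𝓘(ℝ, E) K) (M := GroupLieAlgebra 𝓘(ℝ, E) K) x y z)
    (fun c x y => lie_smul (R := ℝ) (L := GroupLieAlgebra 𝓘(ℝ, E) K)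
      (M := GroupLieAlgebra 𝓘(ℝ, E) K) c x y))

lemma brk_apply (x y : E) : brk K x y = bracketE K x y := rfl

lemma brk_skew (x y : E) : brk K x y = -brk K y x :=
  (lie_skew (L := GroupLieAlgebra 𝓘(ℝ, E) K) x y).symm

lemma brk_brk (x y z : E) : brk K x (brk K y z) = brk K (brk K x y) z + brk K y (brk K x z) :=
  leibniz_lie (L₁ := GroupLieAlgebra 𝓘(ℝ, E) K) (L₂ := GroupLieAlgebra 𝓘(ℝ, E) K)
    (M := GroupLieAlgebra 𝓘(ℝ, E) K) x y z

lemma mdifferentiableAt_adj_apply (k : K) (x : E) :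
    MDifferentiableAt 𝓘(ℝ, E) 𝓘(ℝ, E) (fun k : K => adj E k x) k :=
  (contMDiff_adj.mdifferentiable (by simp) k).clm_apply mdifferentiableAt_const

lemma adj_brk (k : K) (x y : E) : adj E k (brk K x y) = brk K (adj E k x) (adj E k y) := by
  have h1 := tder_adj (K := K) (adj E k x) (adj E k y)
  rw [← brk_apply] at h1
  have h2 : (fun l : K => adj E (k * l * k⁻¹) (adj E k y)) = fun l : K => adj E k (adj E l y) := by
    ext l
    rw [adj_mul_apply, adj_inv_apply, adj_mul_apply]
  have h3 := congrArg (fun F => tder E E F (1 : K) x) h2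
  rw [tder_clm _ (mdifferentiableAt_adj_apply 1 y), tder_adj, ← brk_apply] at h3
  rw [← h3, ← h1]
  have h4 := tder_comp_apply (E' := E) (g := fun l : K => adj E l (adj E k y))
    (f := fun l : K => k * l * k⁻¹) (p := 1)
    (mdifferentiableAt_adj_apply _ (adj E k y)) (mdiff_conj k 1) x
  rw [h4]
  simp [adj]

variable (K) in
/-- The negative of the Cartan-Killing form, on the model space. -/
def nkill : E →L[ℝ] E →L[ℝ] ℝ :=
  LinearMap.toContinuousBilinearMap (-killingForm ℝ (GroupLieAlgebra 𝓘(ℝ, E) K) : E →ₗ[ℝ] E →ₗ[ℝ] ℝ)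

lemma nkill_apply (x y : E) :
    nkill K x y = -killingForm ℝ (GroupLieAlgebra 𝓘(ℝ, E) K) x y := rfl

lemma nkill_symm (x y : E) : nkill K x y = nkill K y x :=
  congrArg Neg.neg (LieModule.traceForm_comm ℝ (GroupLieAlgebra 𝓘(ℝ, E) K)
    (GroupLieAlgebra 𝓘(ℝ, E) K) x y)

lemma nkill_brk (x y z : E) : nkill K (brk K x y) z = nkill K x (brk K y z) :=
  congrArg Neg.neg (killingForm_lie_left (L := GroupLieAlgebra 𝓘(ℝ, E) K) x y z)

lemma nkill_brk_left (x y z : E) : nkill K (brk K x y) z = -nkill K y (brk K x z) := by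
  rw [brk_skew, map_neg, neg_apply, nkill_brk]

/-- The adjoint representation acts by automorphisms of the Lie algebra. -/
def adjEquiv (k : K) : GroupLieAlgebra 𝓘(ℝ, E) K ≃ₗ⁅ℝ⁆ GroupLieAlgebra 𝓘(ℝ, E) K where
  toFun := fun x : E => adj E k x
  map_add' x y := (adj E k).map_add x y
  map_smul' c x := (adj E k).map_smul c x
  map_lie' {x y} := adj_brk (E := E) k x y
  invFun := fun x : E => adj E k⁻¹ x
  left_inv := fun x : E => adj_inv_apply (E := E) k x
  right_inv := fun x : E => adj_apply_inv (E := E) k x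

lemma nkill_adj (k : K) (x y : E) : nkill K (adj E k x) (adj E k y) = nkill K x y :=
  congrArg Neg.neg (LieAlgebra.killingForm_of_equiv_apply (adjEquiv (E := E) k) x y)

theorem nkill_pos [T2Space K] [CompactSpace K]
    (hK : LieAlgebra.IsSemisimple ℝ (GroupLieAlgebra 𝓘(ℝ, E) K)) {x : E} (hx : x ≠ 0) :
    0 < nkill K x x := by
  obtain ⟨B, hsymm, hpos, hB⟩ := exists_adj_invariant_inner (E := E) (K := K)
  have hskew : ∀ v x y : E, B (brk K v x) y = -B x (brk K v y) := by
    intro v x y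
    have h1 := tder_bilin (E := E) (M := K) (p := 1) B.toContinuousBilinearMap
      (mdifferentiableAt_adj_apply 1 x) (mdifferentiableAt_adj_apply 1 y) v
    have h2 : (fun k : K => B.toContinuousBilinearMap (adj E k x) (adj E k y)) = fun _ => B x y := by
      ext k
      exact hB k x y
    rw [h2, tder_const, tder_adj, tder_adj, adj_one] at h1
    have h3 : (0 : ℝ) = B (brk K v x) y + B x (brk K v y) := h1
    linarith
  have := killingForm_neg_of_invariant_inner (L := GroupLieAlgebra 𝓘(ℝ, E) K) B hsymm hpos hskew hx
  rw [nkill_apply]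
  exact neg_pos.2 this

end LieGroup

/-- A continuous one-parameter group in a Banach algebra is differentiable. -/
theorem differentiable_of_continuous_hom {A : Type*} [NormedRing A] [NormedAlgebra ℝ A]
    [CompleteSpace A] {g : ℝ → A} (hg : Continuous g) (h0 : g 0 = 1)
    (hadd : ∀ s t, g (s + t) = g s * g t) : Differentiable ℝ g := by
  let G : ℝ → A := fun u => ∫ s in (0 : ℝ)..u, g s
  have hint : ∀ a b, IntervalIntegrable g MeasureTheory.volume a b := fun a b =>
    hg.intervalIntegrable a b
  have hG : Differentiable ℝ G := fun u =>
    (intervalIntegral.integral_hasDerivAt_right (hint 0 u)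
      (hg.stronglyMeasurableAtFilter _ _) hg.continuousAt).differentiableAt
  have hG0 : HasDerivAt G 1 0 := by
    have := intervalIntegral.integral_hasDerivAt_right (hint 0 0)
      (hg.stronglyMeasurableAtFilter _ _) hg.continuousAt
    rwa [h0] at this
  have hlim : Filter.Tendsto (fun t => t⁻¹ • G t) (𝓝[≠] 0) (𝓝 1) := by
    have := hasDerivAt_iff_tendsto_slope_zero.1 hG0
    simpa [G] using this
  have hunit : ∀ᶠ t in 𝓝[≠] (0 : ℝ), IsUnit (t⁻¹ • G t) :=
    hlim.eventually (Units.isOpen.mem_nhds isUnit_one)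
  obtain ⟨δ, hδ, -⟩ := (hunit.and self_mem_nhdsWithin).exists
  obtain ⟨u, hu⟩ := hδ
  have key : ∀ s, g s = δ⁻¹ • ((G (s + δ) - G s) * (↑u⁻¹ : A)) := by
    intro s
    have h1 : g s * G δ = G (s + δ) - G s := by
      have e1 : g s * G δ = ∫ t in (0 : ℝ)..δ, g s * g t :=
        (((ContinuousLinearMap.mul ℝ A (g s))).intervalIntegral_comp_comm (hint 0 δ)).symm
      rw [e1, intervalIntegral.integral_interval_sub_left (hint _ _) (hint _ _)]
      simp only [← hadd]
      rw [intervalIntegral.integral_comp_add_left (fun t => g t) s, add_zero]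
    rw [← h1, ← smul_mul_assoc, ← mul_smul_comm, ← hu, mul_assoc, Units.mul_inv, mul_one]
  have : g = fun s => δ⁻¹ • ((G (s + δ) - G s) * (↑u⁻¹ : A)) := funext key
  rw [this]
  have h1 : Differentiable ℝ fun s => G (s + δ) := hG.comp (differentiable_id.add_const δ)
  exact ((h1.sub hG).mul_const (↑u⁻¹ : A)).const_smul δ⁻¹

lemma hasDerivAt_bilin {W W' W'' : Type*} [NormedAddCommGroup W] [NormedSpace ℝ W]
    [NormedAddCommGroup W'] [NormedSpace ℝ W'] [NormedAddCommGroup W''] [NormedSpace ℝ W'']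
    (B : W →L[ℝ] W' →L[ℝ] W'') {f : ℝ → W} {g : ℝ → W'} {f' : W} {g' : W'} {s : ℝ}
    (hf : HasDerivAt f f' s) (hg : HasDerivAt g g' s) :
    HasDerivAt (fun s => B (f s) (g s)) (B f' (g s) + B (f s) g') s :=
  HasDerivAt.clm_apply (B.hasFDerivAt.comp_hasDerivAt s hf) hg

/-- Every element of a torus lies on a continuous one-parameter subgroup of the torus. -/
theorem IsTorus.exists_one_parameter {K : Type*} [Group K] [TopologicalSpace K] {Z : Subgroup K}
    (hZ : IsTorus Z) {z : K} (hz : z ∈ Z) :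
    ∃ φ : ℝ → K, Continuous φ ∧ φ 0 = 1 ∧ (∀ s t, φ (s + t) = φ s * φ t) ∧ (∀ s, φ s ∈ Z) ∧
      φ 1 = z := by
  obtain ⟨n, ⟨e⟩⟩ := hZ
  let θ : Fin n → ℝ := fun i => Complex.arg (e ⟨z, hz⟩ i)
  refine ⟨fun s => e.symm fun i => Circle.exp (s * θ i), ?_, ?_, fun s t => ?_,
    fun s => (e.symm _).2, ?_⟩
  · refine continuous_subtype_val.comp (e.symm.continuous.comp (continuous_pi fun i => ?_))
    exact Circle.exp.continuous.comp (continuous_id.mul continuous_const)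
  · have : (fun i => Circle.exp (0 * θ i)) = (1 : Fin n → Circle) := by ext i; simp
    simp only [this, map_one, OneMemClass.coe_one]
  · have : (fun i => Circle.exp ((s + t) * θ i)) =
        (fun i => Circle.exp (s * θ i)) * fun i => Circle.exp (t * θ i) := by
      funext i
      rw [Pi.mul_apply, add_mul, Circle.exp_add]
    simp only [this, map_mul, Subgroup.coe_mul]
  · have : (fun i => Circle.exp (1 * θ i)) = e ⟨z, hz⟩ := by
      funext i
      rw [one_mul, Circle.exp_arg]
    simp only [this, ContinuousMulEquiv.symm_apply_apply]

/-- A subspace has a maximal abelian subspace. -/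
theorem exists_maximal_abelian {L : Type*} [LieRing L] [LieAlgebra ℝ L] [FiniteDimensional ℝ L]
    (h : Submodule ℝ L) : ∃ t : Submodule ℝ L, t ≤ h ∧ (∀ s ∈ t, ∀ s' ∈ t, ⁅s, s'⁆ = 0) ∧
      ∀ x ∈ h, (∀ s ∈ t, ⁅s, x⁆ = 0) → x ∈ t := by
  let S : Set (Submodule ℝ L) := {t | t ≤ h ∧ ∀ s ∈ t, ∀ s' ∈ t, ⁅s, s'⁆ = 0}
  have hne : S.Nonempty := ⟨⊥, bot_le, fun s hs s' _ => by
    rw [(Submodule.mem_bot ℝ).1 hs, zero_lie]⟩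
  obtain ⟨t, ht, hmax⟩ := WellFounded.has_min (wellFounded_gt (α := Submodule ℝ L)) S hne
  refine ⟨t, ht.1, ht.2, fun x hx hxt => ?_⟩
  have hxt' : ∀ s ∈ t, ⁅x, s⁆ = 0 := fun s hs => by rw [← lie_skew, hxt s hs, neg_zero]
  have hS : t ⊔ Submodule.span ℝ {x} ∈ S := by
    refine ⟨sup_le ht.1 (by simpa [Submodule.span_singleton_le_iff_mem] using hx), ?_⟩
    intro a ha b hb
    obtain ⟨s, hs, y, hy, rfl⟩ := Submodule.mem_sup.1 ha
    obtain ⟨s', hs', y', hy', rfl⟩ := Submodule.mem_sup.1 hb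
    obtain ⟨c, rfl⟩ := Submodule.mem_span_singleton.1 hy
    obtain ⟨c', rfl⟩ := Submodule.mem_span_singleton.1 hy'
    simp [ht.2 s hs s' hs', hxt s hs, hxt' s' hs']
  have h1 := hmax _ hS
  have h2 : t = t ⊔ Submodule.span ℝ {x} := by
    by_contra hcon
    exact h1 (lt_of_le_of_ne le_sup_left hcon)
  rw [h2]
  exact Submodule.mem_sup_right (Submodule.mem_span_singleton_self x)

lemma killingForm_self_of_central {L : Type*} [LieRing L] [LieAlgebra ℝ L] {x : L}
    (hx : ∀ y : L, ⁅x, y⁆ = 0) : killingForm ℝ L x x = 0 := by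
  have : LieAlgebra.ad ℝ L x = 0 := LinearMap.ext hx
  rw [killingForm_apply_apply, this]
  simp

section LieGroup

variable {E : Type*} [NormedAddCommGroup E] [NormedSpace ℝ E] [FiniteDimensional ℝ E]
  {K : Type*} [Group K] [TopologicalSpace K] [ChartedSpace E K] [LieGroup 𝓘(ℝ, E) ∞ K]
  [CompleteSpace E]

/-- If the Killing form is definite, the adjoint action along a one-parameter subgroup is generated
by an element of the Lie algebra. -/
theorem exists_generator (hpos : ∀ x : E, x ≠ 0 → 0 < nkill K x x) {φ : ℝ → K}
    (hφ : Continuous φ) (h0 : φ 0 = 1) (hadd : ∀ s t, φ (s + t) = φ s * φ t) :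
    ∃ W : E, ∀ s x, HasDerivAt (fun s => adj E (φ s) x) (adj E (φ s) (brk K W x)) s := by
  let g : ℝ → E →L[ℝ] E := fun s => adj E (φ s)
  have hg : Differentiable ℝ g := by
    refine differentiable_of_continuous_hom (contMDiff_adj.continuous.comp hφ) ?_ fun s t => ?_
    · simp only [h0, adj_one, g]; rfl
    · simp only [hadd, adj_mul, g]; rfl
  let A : E →L[ℝ] E := deriv g 0
  have hd0 : ∀ x, HasDerivAt (fun s => g s x) (A x) 0 := fun x =>
    (hg 0).hasDerivAt.clm_apply (hasDerivAt_const _ _) |>.congr_deriv (by simp [A])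
  have hd : ∀ s x, HasDerivAt (fun s => g s x) (g s (A x)) s := fun s x => by
    have h1 : (fun r => g r x) = fun r => g s (g (r - s) x) := by
      ext r
      simp only [g]
      rw [← adj_mul_apply, ← hadd, add_sub_cancel]
    rw [h1]
    have h2 : HasDerivAt (fun r => g (r - s) x) (A x) s :=
      HasDerivAt.comp_sub_const s s (by simpa using hd0 x)
    exact (g s).hasFDerivAt.comp_hasDerivAt s h2
  have hder : ∀ x y, A (brk K x y) = brk K (A x) y + brk K x (A y) := by
    intro x y
    have h1 := hd0 (brk K x y)
    have h2 : HasDerivAt (fun s => brk K (g s x) (g s y)) (brk K (A x) (g 0 y) + brk K (g 0 x) (A y))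
        0 := hasDerivAt_bilin (brk K) (hd0 x) (hd0 y)
    have h3 : (fun s => g s (brk K x y)) = fun s => brk K (g s x) (g s y) :=
      funext fun s => adj_brk _ _ _
    rw [h3] at h1
    rw [h1.unique h2]
    simp [g, h0, adj_one]
  have hder' : ∀ x y : E, A (brk K x y) = brk K x (A y) - brk K y (A x) := fun x y => by
    rw [hder, brk_skew (A x) y, add_comm, sub_eq_add_neg]
  have : LieAlgebra.IsKilling ℝ (GroupLieAlgebra 𝓘(ℝ, E) K) :=
    isKilling_of_killingForm_neg fun x hx => neg_pos.1 (hpos x hx)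
  let D : LieDerivation ℝ (GroupLieAlgebra 𝓘(ℝ, E) K) (GroupLieAlgebra 𝓘(ℝ, E) K) :=
    { toLinearMap := (A : E →ₗ[ℝ] E)
      leibniz' := hder' }
  obtain ⟨(W : E), hW⟩ := LieDerivation.IsKilling.exists_eq_ad D
  refine ⟨W, fun s x => ?_⟩
  have e1 := congrArg (fun T => T x) (LieDerivation.coe_ad_apply_eq_ad_apply (R := ℝ)
    (L := GroupLieAlgebra 𝓘(ℝ, E) K) W)
  have e2 := congrArg (fun D => D x) hW
  have : A x = brk K W x := e2.symm.trans e1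
  rw [← this]
  exact hd s x

/-- The centralizer of a torus contains a self-centralizing abelian subspace of the Lie algebra. -/
theorem exists_selfcentralizing (hpos : ∀ x : E, x ≠ 0 → 0 < nkill K x x) {Z : Subgroup K}
    (hZ : IsTorus Z) (h : Submodule ℝ E) (hh : ∀ x, x ∈ h ↔ ∀ z ∈ Z, adj E z x = x) :
    ∃ t : Submodule ℝ E, t ≤ h ∧ (∀ s ∈ t, ∀ s' ∈ t, brk K s s' = 0) ∧
      ∀ x, (∀ s ∈ t, brk K s x = 0) → x ∈ t := by
  obtain ⟨t, hth, habel, hmax⟩ := exists_maximal_abelian (L := GroupLieAlgebra 𝓘(ℝ, E) K) h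
  refine ⟨t, hth, habel, fun x hx => hmax x ?_ hx⟩
  refine (hh x).2 fun z hz => ?_
  obtain ⟨φ, hφ, h0, hadd, hφZ, rfl⟩ := hZ.exists_one_parameter hz
  obtain ⟨W, hW⟩ := exists_generator hpos hφ h0 hadd
  have hinj : ∀ U : E, (∀ x, brk K U x = 0) → U = 0 := fun U hU => by
    by_contra hcon
    have h1 : killingForm ℝ (GroupLieAlgebra 𝓘(ℝ, E) K) U U = 0 :=
      killingForm_self_of_central (L := GroupLieAlgebra 𝓘(ℝ, E) K) hU
    exact (neg_pos.1 (hpos U hcon)).ne h1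
  have hcommZ : ∀ z ∈ Z, ∀ z' ∈ Z, z * z' = z' * z := by
    obtain ⟨n, ⟨e⟩⟩ := hZ
    intro z hz z' hz'
    have : (⟨z, hz⟩ * ⟨z', hz'⟩ : Z) = ⟨z', hz'⟩ * ⟨z, hz⟩ := e.injective (by
      rw [map_mul, map_mul, mul_comm])
    exact congrArg Subtype.val this
  have hd0 : ∀ x, HasDerivAt (fun s => adj E (φ s) x) (brk K W x) 0 := fun x => by
    have := hW 0 x
    rwa [h0, adj_one] at this
  have hWh : W ∈ h := by
    refine (hh W).2 fun z hz => ?_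
    rw [← sub_eq_zero]
    refine hinj _ fun x => ?_
    rw [map_sub, sub_apply, sub_eq_zero]
    have h1 : HasDerivAt (fun s => adj E z (adj E (φ s) (adj E z⁻¹ x)))
        (adj E z (brk K W (adj E z⁻¹ x))) 0 :=
      (adj E z).hasFDerivAt.comp_hasDerivAt 0 (hd0 _)
    have h2 : (fun s => adj E z (adj E (φ s) (adj E z⁻¹ x))) = fun s => adj E (φ s) x := by
      ext s
      rw [← adj_mul_apply, hcommZ z hz _ (hφZ s), adj_mul_apply, adj_apply_inv]
    rw [h2, adj_brk, adj_apply_inv] at h1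
    exact h1.unique (hd0 x)
  have hWt : W ∈ t := by
    refine hmax W hWh fun (s : E) hs => ?_
    have h1 := hd0 s
    have h2 : (fun r => adj E (φ r) s) = fun _ => s := funext fun r => (hh s).1 (hth hs) _ (hφZ r)
    rw [h2] at h1
    have h3 : brk K W s = 0 := h1.unique (hasDerivAt_const _ _)
    have h4 : brk K s W = 0 := by rw [brk_skew, h3, neg_zero]
    exact h4
  have hconst : ∀ s, adj E (φ s) x = adj E (φ 0) x := by
    have hd : ∀ s, HasDerivAt (fun s => adj E (φ s) x) 0 s := fun s => by
      have := hW s x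
      rwa [hx W hWt, map_zero] at this
    exact fun s => is_const_of_deriv_eq_zero (fun s => (hd s).differentiableAt)
      (fun s => (hd s).deriv) s 0
  rw [hconst 1, h0, adj_one]
  rfl

end LieGroup

section Submersion

variable {E : Type*} [NormedAddCommGroup E] [NormedSpace ℝ E]
  {E' : Type*} [NormedAddCommGroup E'] [NormedSpace ℝ E']
  {M : Type*} [TopologicalSpace M] [ChartedSpace E M] [IsManifold 𝓘(ℝ, E) ∞ M]
  {N : Type*} [TopologicalSpace N] [ChartedSpace E' N] [IsManifold 𝓘(ℝ, E') ∞ N]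

/-- A submersion has local sections, and tangent vectors in the kernel of its differential are
tangent to curves in the fibres. -/
theorem submersion_slices {f : M → N} {x : M} (h : Manifold.IsSubmersionAt 𝓘(ℝ, E) 𝓘(ℝ, E') ∞ f x) :
    (∃ s : N → M, ContMDiffAt 𝓘(ℝ, E') 𝓘(ℝ, E) ∞ s (f x) ∧ s (f x) = x ∧
      ∀ᶠ q in 𝓝 (f x), f (s q) = q) ∧
    ∀ v, tder E E' f x v = 0 → ∃ γ : ℝ → M, ContMDiffAt 𝓘(ℝ, ℝ) 𝓘(ℝ, E) ∞ γ 0 ∧ γ 0 = x ∧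
      (∀ᶠ t in 𝓝 0, f (γ t) = f x) ∧ tder ℝ E γ 0 1 = v := by
  have hfs : MDifferentiableAt 𝓘(ℝ, E) 𝓘(ℝ, E') f x := h.contMDiffAt.mdifferentiableAt (by simp)
  set φ := h.domChart with hφ
  set ψ := h.codChart with hψ
  set e := h.equiv with he
  have hxφ : x ∈ φ.source := h.mem_domChart_source
  have hxψ : f x ∈ ψ.source := h.mem_codChart_source
  have hw : ∀ u ∈ φ.target, ψ (f (φ.symm u)) = (e u).1 := fun u hu => by
    have hu' : u ∈ (h.domChart.extend 𝓘(ℝ, E)).target := by simpa using hu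
    have := h.writtenInCharts hu'
    simpa using this
  have hmaps : ∀ u ∈ φ.target, f (φ.symm u) ∈ ψ.source := fun u hu =>
    h.source_subset_preimage_source (φ.map_target hu)
  have hφs : ContMDiffAt 𝓘(ℝ, E) 𝓘(ℝ, E) ∞ φ.symm (φ x) :=
    (contMDiffOn_symm_of_mem_maximalAtlas h.domChart_mem_maximalAtlas).contMDiffAt
      (φ.open_target.mem_nhds (φ.map_source hxφ))
  have hφc : ContMDiffAt 𝓘(ℝ, E) 𝓘(ℝ, E) ∞ φ x :=
    (contMDiffOn_of_mem_maximalAtlas h.domChart_mem_maximalAtlas).contMDiffAt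
      (φ.open_source.mem_nhds hxφ)
  have hψc : ContMDiffAt 𝓘(ℝ, E') 𝓘(ℝ, E') ∞ ψ (f x) :=
    (contMDiffOn_of_mem_maximalAtlas h.codChart_mem_maximalAtlas).contMDiffAt
      (ψ.open_source.mem_nhds hxψ)
  have hψx : ψ (f x) = (e (φ x)).1 := by
    have := hw (φ x) (φ.map_source hxφ)
    rwa [φ.left_inv hxφ] at this
  constructor
  · let c : E' → E := fun y => e.symm (y, (e (φ x)).2)
    have hc : ContDiff ℝ ∞ c := e.symm.contDiff.comp (contDiff_id.prodMk contDiff_const)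
    have hcx : c (ψ (f x)) = φ x := by
      simp only [c, hψx]
      exact e.symm_apply_apply _
    refine ⟨fun q => φ.symm (c (ψ q)), ?_, ?_, ?_⟩
    · refine ContMDiffAt.comp_of_eq (I' := 𝓘(ℝ, E)) (y := φ x) hφs ?_ hcx
      exact hc.contMDiff.contMDiffAt.comp _ hψc
    · simp only [hcx, φ.left_inv hxφ]
    · have hcont : ContinuousAt (fun q => c (ψ q)) (f x) :=
        hc.continuous.continuousAt.comp hψc.continuousAt
      have h1 : ∀ᶠ q in 𝓝 (f x), c (ψ q) ∈ φ.target :=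
        hcont.eventually (φ.open_target.mem_nhds (by change c (ψ (f x)) ∈ _; rw [hcx]; exact φ.map_source hxφ))
      filter_upwards [h1, ψ.open_source.mem_nhds hxψ] with q hq hqs
      refine ψ.injOn (hmaps _ hq) hqs ?_
      rw [hw _ hq]
      simp [c]
  · intro v hv
    set u := tder E E φ x v with hu
    have heu : (e u).1 = 0 := by
      have h1 : (fun y => ψ (f y)) =ᶠ[𝓝 x] fun y => (ContinuousLinearMap.fst ℝ E' _ ∘L
          (e : E →L[ℝ] E' × h.complement)) (φ y) := by
        filter_upwards [φ.open_source.mem_nhds hxφ] with y hy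
        have := hw (φ y) (φ.map_source hy)
        rwa [φ.left_inv hy] at this
      have h2 : tder E E' (fun y => ψ (f y)) x v = 0 := by
        rw [tder_comp_apply (E' := E') (hψc.mdifferentiableAt (by simp)) hfs, hv, map_zero]
      rw [tder_congr h1, tder_clm _ (hφc.mdifferentiableAt (by simp))] at h2
      exact h2
    let c : ℝ → E := fun t => φ x + t • u
    have hc : ContDiff ℝ ∞ c := contDiff_const.add (contDiff_id.smul contDiff_const)
    have hc0 : c 0 = φ x := by simp [c]
    have hφs' : ContMDiffAt 𝓘(ℝ, E) 𝓘(ℝ, E) ∞ φ.symm (c 0) := by rwa [hc0]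
    have hγ : ContMDiffAt 𝓘(ℝ, ℝ) 𝓘(ℝ, E) ∞ (fun t => φ.symm (c t)) 0 :=
      hφs'.comp 0 hc.contMDiff.contMDiffAt
    have hγ0 : φ.symm (c 0) = x := by rw [hc0, φ.left_inv hxφ]
    refine ⟨fun t => φ.symm (c t), hγ, hγ0, ?_, ?_⟩
    · have h1 : ∀ᶠ t in 𝓝 0, c t ∈ φ.target :=
        hc.continuous.continuousAt.eventually
          (φ.open_target.mem_nhds (by rw [hc0]; exact φ.map_source hxφ))
      filter_upwards [h1] with t ht
      refine ψ.injOn (hmaps _ ht) hxψ ?_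
      rw [hw _ ht, hψx]
      simp [c, heu]
    · rw [tder_comp_apply (E' := E) (g := φ.symm) (f := c) (hφs'.mdifferentiableAt (by simp))
        (hc.contMDiff.mdifferentiable (by simp) 0), tder_eq_fderiv]
      have h1 : HasFDerivAt c ((ContinuousLinearMap.toSpanSingleton ℝ u)) 0 :=
        ((ContinuousLinearMap.toSpanSingleton ℝ u).hasFDerivAt.const_add (φ x))
      rw [h1.fderiv, ContinuousLinearMap.toSpanSingleton_apply, one_smul, hu, hc0]
      have h2 : (fun y => φ.symm (φ y)) =ᶠ[𝓝 x] id := by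
        filter_upwards [φ.open_source.mem_nhds hxφ] with y hy
        exact φ.left_inv hy
      rw [← tder_comp_apply (E' := E) (g := φ.symm) (f := φ) (hφs.mdifferentiableAt (by simp))
        (hφc.mdifferentiableAt (by simp)), tder_congr h2, tder_id]
      rfl

end Submersion

section Fields

variable {E : Type*} [NormedAddCommGroup E] [NormedSpace ℝ E]
  {M : Type*} [TopologicalSpace M] [ChartedSpace E M] [IsManifold 𝓘(ℝ, E) ∞ M]

/-- A vector field is smooth at a point. -/
def IsSmoothFieldAt (Y : M → E) (p : M) : Prop :=
  ContMDiffAt 𝓘(ℝ, E) (𝓘(ℝ, E).prod 𝓘(ℝ, E)) ∞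
    (fun q => (⟨q, Y q⟩ : TangentBundle 𝓘(ℝ, E) M)) p

lemma trivializationAt_eq_tder {p q : M} (hq : q ∈ (extChartAt 𝓘(ℝ, E) p).source) (v : E) :
    (trivializationAt E (TangentSpace 𝓘(ℝ, E)) p (⟨q, v⟩ : TangentBundle 𝓘(ℝ, E) M)).2 =
      tder E E (extChartAt 𝓘(ℝ, E) p) q v := by
  have h1 : tder E E (extChartAt 𝓘(ℝ, E) p) q = fderivWithin ℝ
      (writtenInExtChartAt 𝓘(ℝ, E) 𝓘(ℝ, E) q (extChartAt 𝓘(ℝ, E) p)) (Set.range 𝓘(ℝ, E))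
      (extChartAt 𝓘(ℝ, E) q q) := (mdiffAt_chart hq).mfderiv
  rw [h1]
  rfl

lemma isSmoothFieldAt_iff {Y : M → E} {p : M} : IsSmoothFieldAt Y p ↔
    ContMDiffAt 𝓘(ℝ, E) 𝓘(ℝ, E) ∞ (fun q => tder E E (extChartAt 𝓘(ℝ, E) p) q (Y q)) p := by
  have h1 := contMDiffAt_section (IB := 𝓘(ℝ, E)) (F := E) (E := TangentSpace 𝓘(ℝ, E)) (n := ∞)
    (s := Y) p
  refine h1.trans (Filter.EventuallyEq.contMDiffAt_iff ?_)
  filter_upwards [extChartAt_source_mem_nhds (I := 𝓘(ℝ, E)) p] with q hq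
  exact trivializationAt_eq_tder hq _

lemma isDiffFieldAt_iff {Y : M → E} {p : M} : IsDiffFieldAt Y p ↔
    MDifferentiableAt 𝓘(ℝ, E) 𝓘(ℝ, E) (fun q => tder E E (extChartAt 𝓘(ℝ, E) p) q (Y q)) p := by
  have h1 := mdifferentiableAt_section (IB := 𝓘(ℝ, E)) (F := E) (E := TangentSpace 𝓘(ℝ, E))
    (s := Y) (b₀ := p)
  refine h1.trans (Filter.EventuallyEq.mdifferentiableAt_iff ?_)
  filter_upwards [extChartAt_source_mem_nhds (I := 𝓘(ℝ, E)) p] with q hq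
  exact trivializationAt_eq_tder hq _

lemma IsSmoothFieldAt.isDiffFieldAt {Y : M → E} {p : M} (h : IsSmoothFieldAt Y p) :
    IsDiffFieldAt Y p :=
  ContMDiffAt.mdifferentiableAt h (by simp)

lemma tder_chart_self (p : M) :
    tder E E (extChartAt 𝓘(ℝ, E) p) p = ContinuousLinearMap.id ℝ E :=
  mfderiv_extChartAt_self

end Fields

section Homogeneous

variable {E : Type*} [NormedAddCommGroup E] [NormedSpace ℝ E] [CompleteSpace E]
  {E' : Type*} [NormedAddCommGroup E'] [NormedSpace ℝ E'] [CompleteSpace E']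
  {K : Type*} [Group K] [TopologicalSpace K] [ChartedSpace E K] [LieGroup 𝓘(ℝ, E) ∞ K]
  {H : Subgroup K} [ChartedSpace E' (K ⧸ H)] [IsManifold 𝓘(ℝ, E') ∞ (K ⧸ H)]

/-- The differential of the translation by an element of the group. -/
def transl (E' : Type*) [NormedAddCommGroup E'] [NormedSpace ℝ E'] [ChartedSpace E' (K ⧸ H)]
    (k : K) (p : K ⧸ H) : E' →L[ℝ] E' := tder E' E' (fun q : K ⧸ H => k • q) p

/-- The infinitesimal action of the Lie algebra. -/
def infAct (E : Type*) [NormedAddCommGroup E] [NormedSpace ℝ E] (E' : Type*)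
    [NormedAddCommGroup E'] [NormedSpace ℝ E'] {K : Type*} [Group K] [TopologicalSpace K]
    [ChartedSpace E K] {H : Subgroup K} [ChartedSpace E' (K ⧸ H)] (p : K ⧸ H) : E →L[ℝ] E' :=
  tder E E' (fun k : K => k • p) 1

variable (E E' H) in
lemma contMDiff_proj [hF : Fact (IsHomogeneousManifold (E := E) E' H)]
    : ContMDiff 𝓘(ℝ, E) 𝓘(ℝ, E') ∞ (fun k : K => (k : K ⧸ H)) :=
  Manifold.IsSubmersion.contMDiff hF.out

variable (E E' H) in
lemma mdiffAt_proj [hF : Fact (IsHomogeneousManifold (E := E) E' H)]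
    (k : K) : MDifferentiableAt 𝓘(ℝ, E) 𝓘(ℝ, E') (fun k : K => (k : K ⧸ H)) k :=
  (contMDiff_proj E E' H).mdifferentiable (by simp) k

variable (E E') in
lemma exists_local_section [hF : Fact (IsHomogeneousManifold (E := E) E' H)]
    (k : K) : ∃ s : K ⧸ H → K,
    ContMDiffAt 𝓘(ℝ, E') 𝓘(ℝ, E) ∞ s (k : K ⧸ H) ∧ s (k : K ⧸ H) = k ∧
      ∀ᶠ q in 𝓝 (k : K ⧸ H), (s q : K ⧸ H) = q :=
  (submersion_slices (Manifold.IsSubmersion.isSubmersionAt hF.out k)).1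

variable (E E' K H) in
lemma contMDiff_smul [hF : Fact (IsHomogeneousManifold (E := E) E' H)]
    : ContMDiff (𝓘(ℝ, E).prod 𝓘(ℝ, E')) 𝓘(ℝ, E') ∞
    (fun x : K × (K ⧸ H) => x.1 • x.2) := by
  rintro ⟨k, p⟩
  obtain ⟨l, rfl⟩ := QuotientGroup.mk_surjective p
  obtain ⟨s, hs, hsl, hsq⟩ := exists_local_section E E' (H := H) l
  have h1 : (fun x : K × (K ⧸ H) => x.1 • x.2) =ᶠ[𝓝 (k, (l : K ⧸ H))]
      fun x => ((x.1 * s x.2 : K) : K ⧸ H) := by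
    have h2 : Filter.Tendsto (fun x : K × (K ⧸ H) => x.2) (𝓝 (k, (l : K ⧸ H))) (𝓝 (l : K ⧸ H)) :=
      continuousAt_snd
    filter_upwards [h2.eventually hsq] with x hx
    conv_lhs => rw [← hx]
    rfl
  refine ContMDiffAt.congr_of_eventuallyEq ?_ h1
  refine (contMDiff_proj E E' H).contMDiffAt.comp _ (contMDiffAt_fst.mul ?_)
  exact ContMDiffAt.comp_of_eq hs contMDiffAt_snd rfl

variable (E E') in
lemma contMDiff_translation [hF : Fact (IsHomogeneousManifold (E := E) E' H)]
    (k : K) :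
    ContMDiff 𝓘(ℝ, E') 𝓘(ℝ, E') ∞ (fun q : K ⧸ H => k • q) :=
  (contMDiff_smul E E' K H).comp (contMDiff_const.prodMk contMDiff_id)

variable (E E') in
lemma mdiffAt_translation [hF : Fact (IsHomogeneousManifold (E := E) E' H)]
    (k : K) (p : K ⧸ H) :
    MDifferentiableAt 𝓘(ℝ, E') 𝓘(ℝ, E') (fun q : K ⧸ H => k • q) p :=
  (contMDiff_translation E E' k).mdifferentiable (by simp) p

variable (E E') in
lemma contMDiff_orbit [hF : Fact (IsHomogeneousManifold (E := E) E' H)]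
    (p : K ⧸ H) :
    ContMDiff 𝓘(ℝ, E) 𝓘(ℝ, E') ∞ (fun k : K => k • p) :=
  (contMDiff_smul E E' K H).comp (contMDiff_id.prodMk contMDiff_const)

variable (E E') in
lemma mdiffAt_orbit [hF : Fact (IsHomogeneousManifold (E := E) E' H)]
    (p : K ⧸ H) (k : K) :
    MDifferentiableAt 𝓘(ℝ, E) 𝓘(ℝ, E') (fun k : K => k • p) k :=
  (contMDiff_orbit E E' p).mdifferentiable (by simp) k

lemma transl_one (p : K ⧸ H) : transl E' (1 : K) p = ContinuousLinearMap.id ℝ E' := by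
  have : (fun q : K ⧸ H => (1 : K) • q) = id := by ext; simp
  rw [transl, this, tder_id]

variable (E) in
lemma transl_mul_apply [hF : Fact (IsHomogeneousManifold (E := E) E' H)]
    (k l : K) (p : K ⧸ H) (v : E') :
    transl E' (k * l) p v = transl E' k (l • p) (transl E' l p v) := by
  have : (fun q : K ⧸ H => (k * l) • q) = fun q => k • l • q := by ext; rw [mul_smul]
  rw [transl, this, tder_comp_apply (E' := E') (g := fun q : K ⧸ H => k • q)
    (mdiffAt_translation E E' k _) (mdiffAt_translation E E' l p)]
  rfl

variable (E) in
lemma transl_inv_apply [hF : Fact (IsHomogeneousManifold (E := E) E' H)]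
    (k : K) (p : K ⧸ H) (v : E') :
    transl E' k⁻¹ (k • p) (transl E' k p v) = v := by
  rw [← transl_mul_apply E, inv_mul_cancel, transl_one]; rfl

variable [hF : Fact (IsHomogeneousManifold (E := E) E' H)]

lemma infAct_smul (k : K) (p : K ⧸ H) (X : E) :
    infAct E E' (k • p) (adj E k X) = transl E' k p (infAct E E' p X) := by
  have h1 : (fun l : K => (k * l * k⁻¹) • (k • p)) = fun l : K => k • (l • p) := by
    ext l
    rw [← mul_smul, ← mul_smul, inv_mul_cancel_right]
  have h2 := tder_comp_apply (E' := E) (g := fun l : K => l • (k • p))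
    (f := fun l : K => k * l * k⁻¹) (p := 1) (mdiffAt_orbit E E' _ _) (mdiff_conj k 1) X
  rw [h1, tder_comp_apply (E' := E') (g := fun q : K ⧸ H => k • q) (f := fun l : K => l • p)
    (mdiffAt_translation E E' k _) (mdiffAt_orbit E E' p 1)] at h2
  simp only [mul_one, mul_inv_cancel, one_smul] at h2
  exact h2.symm

lemma infAct_base_surjective : Function.Surjective (infAct E E' ((1 : K) : K ⧸ H)) := by
  intro v
  obtain ⟨s, hs, hsl, hsq⟩ := exists_local_section E E' (H := H) (1 : K)
  refine ⟨tder E' E s ((1 : K) : K ⧸ H) v, ?_⟩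
  have h1 : (fun k : K => k • ((1 : K) : K ⧸ H)) = fun k : K => (k : K ⧸ H) := by
    ext k
    change ((k * 1 : K) : K ⧸ H) = k
    rw [mul_one]
  have h2 := tder_comp_apply (E' := E) (g := fun k : K => (k : K ⧸ H)) (mdiffAt_proj E E' H _)
    (hs.mdifferentiableAt (by simp)) v
  have h3 : (fun q => (s q : K ⧸ H)) =ᶠ[𝓝 ((1 : K) : K ⧸ H)] id := hsq
  rw [tder_congr h3, tder_id, hsl] at h2
  rw [infAct, h1]
  exact h2.symm

lemma infAct_surjective (p : K ⧸ H) : Function.Surjective (infAct E E' p) := by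
  obtain ⟨k, rfl⟩ := QuotientGroup.mk_surjective p
  have h0 : ((k : K) : K ⧸ H) = k • ((1 : K) : K ⧸ H) := by
    change _ = ((k * 1 : K) : K ⧸ H)
    rw [mul_one]
  intro v
  change ∃ x, infAct E E' ((k : K) : K ⧸ H) x = v
  rw [h0]
  obtain ⟨X, hX⟩ := infAct_base_surjective (E := E) (E' := E') (H := H)
    (transl E' k⁻¹ (k • ((1 : K) : K ⧸ H)) v)
  refine ⟨adj E k X, ?_⟩
  rw [infAct_smul, hX]
  have := transl_inv_apply E (E' := E') k⁻¹ (k • ((1 : K) : K ⧸ H)) v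
  rwa [inv_inv, inv_smul_smul] at this

/-- Infinitesimal action on smooth functions to the Lie algebra gives smooth fields. -/
lemma contMDiffAt_tder_chart_infAct (p : K ⧸ H) :
    ContMDiffAt 𝓘(ℝ, E') 𝓘(ℝ, E →L[ℝ] E') ∞
      (fun q => tder E E' (fun k : K => extChartAt 𝓘(ℝ, E') p (k • q)) 1) p := by
  refine contMDiffAt_tder_of_fixed' (f := fun (q : K ⧸ H) (k : K) =>
    extChartAt 𝓘(ℝ, E') p (k • q)) ?_
  refine ContMDiffAt.comp_of_eq (I' := 𝓘(ℝ, E')) (y := p) (contMDiffAt_extChartAt) ?_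
    (one_smul K p)
  exact ((contMDiff_smul E E' K H).comp (contMDiff_snd.prodMk contMDiff_fst)).contMDiffAt

lemma tder_chart_infAct (p : K ⧸ H) : ∀ᶠ q in 𝓝 p, ∀ X : E,
    tder E' E' (extChartAt 𝓘(ℝ, E') p) q (infAct E E' q X) =
      tder E E' (fun k : K => extChartAt 𝓘(ℝ, E') p (k • q)) 1 X := by
  filter_upwards [extChartAt_source_mem_nhds (I := 𝓘(ℝ, E')) p] with q hq X
  rw [tder_comp_apply (E' := E') (f := fun k : K => k • q) (by
    rw [one_smul]; exact mdiffAt_chart hq) (mdiffAt_orbit E E' q 1), one_smul]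
  rfl

lemma isSmoothFieldAt_infAct {f : K ⧸ H → E} {p : K ⧸ H}
    (hf : ContMDiffAt 𝓘(ℝ, E') 𝓘(ℝ, E) ∞ f p) :
    IsSmoothFieldAt (fun q => infAct E E' q (f q)) p := by
  rw [isSmoothFieldAt_iff]
  refine ((contMDiffAt_tder_chart_infAct p).clm_apply hf).congr_of_eventuallyEq ?_
  filter_upwards [tder_chart_infAct (E := E) (E' := E') p] with q hq
  exact hq _

lemma isDiffFieldAt_infAct {f : K ⧸ H → E} {p : K ⧸ H}
    (hf : MDifferentiableAt 𝓘(ℝ, E') 𝓘(ℝ, E) f p) :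
    IsDiffFieldAt (fun q => infAct E E' q (f q)) p := by
  refine isDiffFieldAt_iff.2 ?_
  refine (((contMDiffAt_tder_chart_infAct p).mdifferentiableAt (by simp)).clm_apply
    hf).congr_of_eventuallyEq ?_
  filter_upwards [tder_chart_infAct (E := E) (E' := E') p] with q hq
  exact hq _

end Homogeneous

section LinearAlgebra

/-- A subspace is complemented by its orthogonal with respect to a definite form. -/
theorem isCompl_orthogonalBilin_of_definite {V : Type*} [AddCommGroup V] [Module ℝ V]
    [FiniteDimensional ℝ V] (B : V →ₗ[ℝ] V →ₗ[ℝ] ℝ) (hsymm : ∀ x y, B x y = B y x)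
    (hB : ∀ x, B x x = 0 → x = 0) (N : Submodule ℝ V) : IsCompl N (N.orthogonalBilin B) := by
  have h1 : B.IsSymm := ⟨fun x y => hsymm x y⟩
  refine (LinearMap.BilinForm.isCompl_orthogonal_iff_disjoint h1.isRefl).2 ?_
  rw [Submodule.disjoint_def]
  exact fun x hx hx' => hB x (hx' x hx)

/-- The right inverse of a surjective linear map with values in the orthogonal of its kernel. -/
def orthInv {W W' : Type*} [NormedAddCommGroup W] [NormedSpace ℝ W] [NormedAddCommGroup W']
    [NormedSpace ℝ W'] (B : W →L[ℝ] W →L[ℝ] ℝ) (a : W →L[ℝ] W') : W' →L[ℝ] W :=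
  Classical.epsilon fun σ => (∀ v, a (σ v) = v) ∧ ∀ v x, a x = 0 → B (σ v) x = 0

theorem orthInv_spec {W W' : Type*} [NormedAddCommGroup W] [NormedSpace ℝ W]
    [NormedAddCommGroup W'] [NormedSpace ℝ W'] [FiniteDimensional ℝ W] [FiniteDimensional ℝ W']
    (B : W →L[ℝ] W →L[ℝ] ℝ) (hsymm : ∀ x y, B x y = B y x) (hB : ∀ x, B x x = 0 → x = 0)
    (a : W →L[ℝ] W') (ha : Function.Surjective a) :
    (∀ v, a (orthInv B a v) = v) ∧ ∀ v x, a x = 0 → B (orthInv B a v) x = 0 := by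
  refine Classical.epsilon_spec (p := fun σ : W' →L[ℝ] W =>
    (∀ v, a (σ v) = v) ∧ ∀ v x, a x = 0 → B (σ v) x = 0) ?_
  obtain ⟨ρ, hρ⟩ := LinearMap.exists_rightInverse_of_surjective (a : W →ₗ[ℝ] W')
    (LinearMap.range_eq_top.2 ha)
  let N := LinearMap.ker (a : W →ₗ[ℝ] W')
  let B' : W →ₗ[ℝ] W →ₗ[ℝ] ℝ := ContinuousLinearMap.toLinearMap₁₂ B
  have hc : IsCompl N (N.orthogonalBilin B') :=
    isCompl_orthogonalBilin_of_definite B' hsymm hB N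
  let q : W →ₗ[ℝ] W := Submodule.projection _ _ hc.symm
  refine ⟨LinearMap.toContinuousLinearMap (q ∘ₗ ρ), fun v => ?_, fun v x hx => ?_⟩
  · have h1 := Submodule.projection_add_projection_eq_self hc (ρ v)
    have h2 : a (Submodule.projection _ _ hc (ρ v)) = 0 :=
      Submodule.projection_apply_mem hc (ρ v)
    have h3 : a (ρ v) = v := congrArg (fun L => L v) hρ
    rw [← h1, map_add, h2, zero_add] at h3
    exact h3
  · have h1 : q (ρ v) ∈ N.orthogonalBilin B' := Submodule.projection_apply_mem hc.symm (ρ v)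
    rw [hsymm]
    exact h1 x hx

end LinearAlgebra

section Homogeneous

variable {E : Type*} [NormedAddCommGroup E] [NormedSpace ℝ E] [CompleteSpace E]
  [FiniteDimensional ℝ E]
  {E' : Type*} [NormedAddCommGroup E'] [NormedSpace ℝ E'] [CompleteSpace E']
  [FiniteDimensional ℝ E']
  {K : Type*} [Group K] [TopologicalSpace K] [ChartedSpace E K] [LieGroup 𝓘(ℝ, E) ∞ K]
  {H : Subgroup K} [ChartedSpace E' (K ⧸ H)] [IsManifold 𝓘(ℝ, E') ∞ (K ⧸ H)]
  [hF : Fact (IsHomogeneousManifold (E := E) E' H)]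

/-- The Lie bracket of fundamental vector fields. -/
theorem mlieBracket_infAct (X Y : E) (p : K ⧸ H) :
    (mlieBracket 𝓘(ℝ, E') (fun q => infAct E E' q X) (fun q => infAct E E' q Y) p : E') =
      -infAct E E' p (brk K X Y) := by
  set f := extChartAt 𝓘(ℝ, E') p with hfdef
  have hf : ContMDiffAt 𝓘(ℝ, E') 𝓘(ℝ, E') ∞ f p := contMDiffAt_extChartAt
  set F : K → E' := fun k => f (k • p) with hFdef
  have hFs : ContMDiffAt 𝓘(ℝ, E) 𝓘(ℝ, E') ∞ F 1 :=
    ContMDiffAt.comp_of_eq hf (contMDiff_orbit E E' p).contMDiffAt (one_smul K p)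
  have hFev : ∀ᶠ k in 𝓝 (1 : K), MDifferentiableAt 𝓘(ℝ, E) 𝓘(ℝ, E') F k :=
    ((contMDiffAt_iff_contMDiffAt_nhds (by simp)).1 (hFs.of_le two_le_smooth)).mono
      fun q hq => hq.mdifferentiableAt two_ne_zero
  have key : ∀ Z V : E, tder E' E' (fun q => tder E' E' f q (infAct E E' q Z)) p (infAct E E' p V) =
      tder E E' (fun k => tder E E' F k (leftField V k)) 1 Z := by
    intro Z V
    have h1 : (fun q => tder E' E' f q (infAct E E' q Z)) =ᶠ[𝓝 p]
        fun q => tder E E' (fun k : K => f (k • q)) 1 Z := by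
      filter_upwards [tder_chart_infAct (E := E) (E' := E') p] with q hq
      exact hq Z
    have h2 : MDifferentiableAt 𝓘(ℝ, E') 𝓘(ℝ, E')
        (fun q => tder E E' (fun k : K => f (k • q)) 1 Z) p :=
      ((contMDiffAt_tder_chart_infAct p).mdifferentiableAt (by simp)).clm_apply
        mdifferentiableAt_const
    have h3 := tder_comp_apply (E' := E') (f := fun l : K => l • p) (p := 1)
      (g := fun q => tder E E' (fun k : K => f (k • q)) 1 Z) (by rwa [one_smul])
      (mdiffAt_orbit E E' p 1) V
    rw [one_smul] at h3
    rw [tder_congr h1]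
    refine h3.symm.trans ?_
    have hG : ContMDiffAt (𝓘(ℝ, E).prod 𝓘(ℝ, E)) 𝓘(ℝ, E') ∞ (fun z : K × K => F (z.2 * z.1))
        (1, 1) :=
      ContMDiffAt.comp_of_eq (I' := 𝓘(ℝ, E)) (g := F) (f := fun z : K × K => z.2 * z.1) (y := 1) hFs
        (contMDiffAt_snd.mul contMDiffAt_fst) (by simp)
    have h4 := tder_tder_comm (hG.of_le two_le_smooth) V Z
    simp only [hFdef, mul_smul] at h4
    refine h4.trans ?_
    have h5 : (fun b : K => tder E E' (fun a : K => f (b • a • p)) 1 V) =ᶠ[𝓝 1]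
        fun k => tder E E' F k (leftField V k) := by
      filter_upwards [hFev] with b hb
      have h6 : (fun a : K => f (b • a • p)) = fun a => F (b * a) := by
        ext a
        simp only [hFdef, mul_smul]
      rw [h6, tder_comp_apply (E' := E) (by rwa [mul_one]) (mdiff_mul_left b 1), mul_one]
      rfl
    rw [tder_congr h5]
  have h1 := tder_mlieBracket (hf.of_le two_le_smooth)
    (isDiffFieldAt_infAct (E := E) (f := fun _ => X) (p := p) mdifferentiableAt_const)
    (isDiffFieldAt_infAct (E := E) (f := fun _ => Y) (p := p) mdifferentiableAt_const)
  have h2 := tder_mlieBracket (hFs.of_le two_le_smooth) (isDiffFieldAt_leftField X (1 : K))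
    (isDiffFieldAt_leftField Y (1 : K))
  change _ = tder E E' (fun k => tder E E' F k (leftField Y k)) 1 (leftField X (1 : K)) -
    tder E E' (fun k => tder E E' F k (leftField X k)) 1 (leftField Y (1 : K)) at h2
  rw [leftField_one, leftField_one] at h2
  have h1' : tder E' E' f p (mlieBracket 𝓘(ℝ, E') (fun q => infAct E E' q X)
      (fun q => infAct E E' q Y) p) =
      tder E' E' (fun q => tder E' E' f q (infAct E E' q Y)) p (infAct E E' p X) -
      tder E' E' (fun q => tder E' E' f q (infAct E E' q X)) p (infAct E E' p Y) := h1
  rw [key, key, hfdef, tder_chart_self] at h1'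
  have h3 : tder E E' F 1 (brk K X Y) = infAct E E' p (brk K X Y) := by
    rw [hFdef, tder_comp_apply (E' := E') (g := f) (f := fun k : K => k • p) (by
      rw [one_smul]; exact hf.mdifferentiableAt (by simp)) (mdiffAt_orbit E E' p 1), one_smul,
      hfdef, tder_chart_self]
    rfl
  rw [← h3]
  refine Eq.trans h1' ?_
  rw [← neg_sub]
  exact congrArg Neg.neg h2.symm

end Homogeneous

section Calc

variable {E : Type*} [NormedAddCommGroup E] [NormedSpace ℝ E]
  {M : Type*} [TopologicalSpace M] [ChartedSpace E M] [IsManifold 𝓘(ℝ, E) ∞ M]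
  {W : Type*} [NormedAddCommGroup W] [NormedSpace ℝ W]

/-- The differential along the diagonal of a smooth function of two variables with respect to the
second variable, read in a chart, is smooth. -/
theorem exists_smooth_tder_diagonal {g : M → M → W} {p : M}
    (hg : ContMDiffAt (𝓘(ℝ, E).prod 𝓘(ℝ, E)) 𝓘(ℝ, W) ∞ (Function.uncurry g) (p, p)) :
    ∃ B : M → E →L[ℝ] W, ContMDiffAt 𝓘(ℝ, E) 𝓘(ℝ, E →L[ℝ] W) ∞ B p ∧
      ∀ᶠ q in 𝓝 p, ∀ v, tder E W (g q) q v = B q (tder E E (extChartAt 𝓘(ℝ, E) p) q v) := by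
  set ψ := extChartAt 𝓘(ℝ, E) p with hψ
  have hps : p ∈ ψ.source := mem_extChartAt_source p
  have hψc : ContMDiffAt 𝓘(ℝ, E) 𝓘(ℝ, E) ∞ ψ p := contMDiffAt_extChartAt
  have hψs : ContMDiffAt 𝓘(ℝ, E) 𝓘(ℝ, E) ∞ ψ.symm (ψ p) :=
    (contMDiffOn_extChartAt_symm (n := ∞) p).contMDiffAt (extChartAt_target_mem_nhds p)
  refine ⟨fun q => tder E W (fun w => g q (ψ.symm (ψ q + w))) 0, ?_, ?_⟩
  · refine contMDiffAt_tder_of_fixed' (f := fun q w => g q (ψ.symm (ψ q + w))) ?_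
    have h0 : ψ.symm (ψ p + 0) = p := by rw [add_zero, ψ.left_inv hps]
    refine ContMDiffAt.comp_of_eq (I' := 𝓘(ℝ, E).prod 𝓘(ℝ, E)) (g := Function.uncurry g)
      (f := fun z : M × E => (z.1, ψ.symm (ψ z.1 + z.2))) (y := (p, p)) hg ?_ (by
        simp only [h0])
    refine contMDiffAt_fst.prodMk ?_
    refine ContMDiffAt.comp_of_eq (I' := 𝓘(ℝ, E)) (g := ψ.symm)
      (f := fun z : M × E => ψ z.1 + z.2) (y := ψ p) hψs ?_ (by simp)
    exact (ContMDiffAt.comp_of_eq hψc contMDiffAt_fst rfl).add contMDiffAt_snd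
  · have hev : ∀ᶠ q in 𝓝 p, MDifferentiableAt 𝓘(ℝ, E) 𝓘(ℝ, W) (g q) q := by
      have h1 : ∀ᶠ z in 𝓝 (p, p),
          MDifferentiableAt (𝓘(ℝ, E).prod 𝓘(ℝ, E)) 𝓘(ℝ, W) (Function.uncurry g) z :=
        ((contMDiffAt_iff_contMDiffAt_nhds (by simp)).1 (hg.of_le two_le_smooth)).mono
          fun q hq => hq.mdifferentiableAt two_ne_zero
      have h2 : Filter.Tendsto (fun q : M => (q, q)) (𝓝 p) (𝓝 (p, p)) :=
        continuousAt_id.prodMk continuousAt_id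
      filter_upwards [h2.eventually h1] with q hq
      exact MDifferentiableAt.comp q (I' := 𝓘(ℝ, E).prod 𝓘(ℝ, E)) (g := Function.uncurry g)
        (f := fun y => (q, y)) hq
        (mdifferentiableAt_const.prodMk mdifferentiableAt_id)
    filter_upwards [extChartAt_source_mem_nhds (I := 𝓘(ℝ, E)) p, hev] with q hq hgq v
    have h1 : g q =ᶠ[𝓝 q] fun y => (fun w => g q (ψ.symm (ψ q + w))) (ψ y - ψ q) := by
      filter_upwards [extChartAt_source_mem_nhds' (I := 𝓘(ℝ, E)) hq] with y hy
      simp only [add_sub_cancel, ψ.left_inv hy]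
    have h2 : MDifferentiableAt 𝓘(ℝ, E) 𝓘(ℝ, W) (fun w => g q (ψ.symm (ψ q + w))) 0 := by
      have h3 : MDifferentiableAt 𝓘(ℝ, E) 𝓘(ℝ, E) ψ.symm (ψ q + 0) := by
        rw [add_zero]; exact mdiffAt_chart_symm (ψ.map_source hq)
      have h4 : MDifferentiableAt 𝓘(ℝ, E) 𝓘(ℝ, E) (fun w => ψ.symm (ψ q + w)) 0 :=
        MDifferentiableAt.comp (0 : E) (I' := 𝓘(ℝ, E)) h3
          (differentiableAt_id.const_add (ψ q)).mdifferentiableAt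
      refine MDifferentiableAt.comp (0 : E) (I' := 𝓘(ℝ, E)) ?_ h4
      rwa [add_zero, ψ.left_inv hq]
    have hψq : MDifferentiableAt 𝓘(ℝ, E) 𝓘(ℝ, E) ψ q := mdiffAt_chart hq
    have hsub : MDifferentiableAt 𝓘(ℝ, E) 𝓘(ℝ, E) (fun y => ψ y - ψ q) q :=
      hψq.sub mdifferentiableAt_const
    rw [tder_congr h1, tder_comp_apply (E' := E) (f := fun y => ψ y - ψ q)
      (g := fun w => g q (ψ.symm (ψ q + w))) (by rwa [sub_self]) hsub,
      tder_sub hψq mdifferentiableAt_const, tder_const, sub_self, sub_zero]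

theorem exists_smooth_tder {f : M → W} {p : M} (hf : ContMDiffAt 𝓘(ℝ, E) 𝓘(ℝ, W) ∞ f p) :
    ∃ B : M → E →L[ℝ] W, ContMDiffAt 𝓘(ℝ, E) 𝓘(ℝ, E →L[ℝ] W) ∞ B p ∧
      ∀ᶠ q in 𝓝 p, ∀ v, tder E W f q v = B q (tder E E (extChartAt 𝓘(ℝ, E) p) q v) :=
  exists_smooth_tder_diagonal (g := fun _ => f)
    (ContMDiffAt.comp_of_eq (g := f) (f := Prod.snd) (x := (p, p)) hf contMDiffAt_snd rfl)

lemma contMDiffAt_tder_field {f : M → W} {X : M → E} {p : M}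
    (hf : ContMDiffAt 𝓘(ℝ, E) 𝓘(ℝ, W) ∞ f p) (hX : IsSmoothFieldAt X p) :
    ContMDiffAt 𝓘(ℝ, E) 𝓘(ℝ, W) ∞ (fun q => tder E W f q (X q)) p := by
  obtain ⟨B, hB, hBq⟩ := exists_smooth_tder hf
  refine (hB.clm_apply (isSmoothFieldAt_iff.1 hX)).congr_of_eventuallyEq ?_
  filter_upwards [hBq] with q hq
  exact hq _

end Calc

section Homogeneous

variable {E : Type*} [NormedAddCommGroup E] [NormedSpace ℝ E] [CompleteSpace E]
  [FiniteDimensional ℝ E]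
  {E' : Type*} [NormedAddCommGroup E'] [NormedSpace ℝ E'] [CompleteSpace E']
  [FiniteDimensional ℝ E']
  {K : Type*} [Group K] [TopologicalSpace K] [ChartedSpace E K] [LieGroup 𝓘(ℝ, E) ∞ K]
  {H : Subgroup K} [ChartedSpace E' (K ⧸ H)] [IsManifold 𝓘(ℝ, E') ∞ (K ⧸ H)]
  [hF : Fact (IsHomogeneousManifold (E := E) E' H)]
  [hN : Fact (∀ x : E, x ≠ 0 → 0 < nkill K x x)]

/-- The lift of tangent vectors to the Lie algebra, orthogonal to the isotropy algebra. -/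
def sig (E : Type*) [NormedAddCommGroup E] [NormedSpace ℝ E] [CompleteSpace E]
    [FiniteDimensional ℝ E] (E' : Type*) [NormedAddCommGroup E'] [NormedSpace ℝ E']
    {K : Type*} [Group K] [TopologicalSpace K] [ChartedSpace E K] [LieGroup 𝓘(ℝ, E) ∞ K]
    {H : Subgroup K} [ChartedSpace E' (K ⧸ H)] (p : K ⧸ H) : E' →L[ℝ] E :=
  orthInv (nkill K) (infAct E E' p)

lemma nkill_definite {x : E} (hx : nkill K x x = 0) : x = 0 := by
  by_contra h
  exact (hN.out x h).ne' hx

lemma sig_spec (p : K ⧸ H) : (∀ v, infAct E E' p (sig E E' p v) = v) ∧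
    ∀ v x, infAct E E' p x = 0 → nkill K (sig E E' p v) x = 0 :=
  orthInv_spec (nkill K) nkill_symm (fun _ => nkill_definite) (infAct E E' p)
    (infAct_surjective p)

lemma infAct_sig (p : K ⧸ H) (v : E') : infAct E E' p (sig E E' p v) = v := (sig_spec p).1 v

lemma nkill_sig (p : K ⧸ H) (v : E') {x : E} (hx : infAct E E' p x = 0) :
    nkill K (sig E E' p v) x = 0 := (sig_spec p).2 v x hx

lemma eq_sig {p : K ⧸ H} {x : E} (hx : ∀ y, infAct E E' p y = 0 → nkill K x y = 0) :
    sig E E' p (infAct E E' p x) = x := by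
  rw [← sub_eq_zero]
  refine nkill_definite (K := K) ?_
  have h1 : infAct E E' p (sig E E' p (infAct E E' p x) - x) = 0 := by
    rw [map_sub, infAct_sig, sub_self]
  have h2 : ∀ y z w : E, nkill K (y - z) w = nkill K y w - nkill K z w := fun y z w => by
    rw [map_sub]; rfl
  rw [h2, nkill_sig p _ h1, hx _ h1, sub_self]

lemma sig_smul (k : K) (p : K ⧸ H) (v : E') :
    sig E E' (k • p) (transl E' k p v) = adj E k (sig E E' p v) := by
  have h1 : transl E' k p v = infAct E E' (k • p) (adj E k (sig E E' p v)) := by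
    rw [infAct_smul, infAct_sig]
  rw [h1]
  refine eq_sig fun y hy => ?_
  have h2 : transl E' k p (infAct E E' p (adj E k⁻¹ y)) = 0 := by
    rw [← infAct_smul, adj_apply_inv, hy]
  have h3 : infAct E E' p (adj E k⁻¹ y) = 0 := by
    rw [← transl_inv_apply E k p (infAct E E' p (adj E k⁻¹ y)), h2, map_zero]
  have h4 := nkill_sig p v h3
  rwa [← nkill_adj k, adj_apply_inv] at h4

lemma mk_smul_base (k : K) : (k : K ⧸ H) = k • ((1 : K) : K ⧸ H) := by
  change _ = ((k * 1 : K) : K ⧸ H)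
  rw [mul_one]

lemma exists_smooth_sig (p : K ⧸ H) :
    ∃ B : K ⧸ H → E' →L[ℝ] E, ContMDiffAt 𝓘(ℝ, E') 𝓘(ℝ, E' →L[ℝ] E) ∞ B p ∧
      ∀ᶠ q in 𝓝 p, ∀ v, sig E E' q v = B q (tder E' E' (extChartAt 𝓘(ℝ, E') p) q v) := by
  obtain ⟨k₀, rfl⟩ := QuotientGroup.mk_surjective p
  obtain ⟨s, hs, hsk, hsq⟩ := exists_local_section E E' (H := H) k₀
  set o : K ⧸ H := ((1 : K) : K ⧸ H) with ho
  set χ := extChartAt 𝓘(ℝ, E') o with hχ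
  have hχc : ContMDiffAt 𝓘(ℝ, E') 𝓘(ℝ, E') ∞ χ o := contMDiffAt_extChartAt
  have hbase : (s (k₀ : K ⧸ H))⁻¹ • (k₀ : K ⧸ H) = o := by
    rw [hsk, mk_smul_base, inv_smul_smul]
  have hg : ContMDiffAt (𝓘(ℝ, E').prod 𝓘(ℝ, E')) 𝓘(ℝ, E') ∞
      (Function.uncurry fun (q y : K ⧸ H) => χ ((s q)⁻¹ • y)) ((k₀ : K ⧸ H), (k₀ : K ⧸ H)) := by
    refine ContMDiffAt.comp_of_eq (I' := 𝓘(ℝ, E')) (g := χ)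
      (f := fun z : (K ⧸ H) × (K ⧸ H) => (s z.1)⁻¹ • z.2) (y := o) hχc ?_ hbase
    refine (contMDiff_smul E E' K H).contMDiffAt.comp _ (ContMDiffAt.prodMk ?_ contMDiffAt_snd)
    exact ContMDiffAt.inv (ContMDiffAt.comp_of_eq hs contMDiffAt_fst rfl)
  obtain ⟨B, hB, hBq⟩ := exists_smooth_tder_diagonal hg
  refine ⟨fun q => (adj E (s q)).comp ((sig E E' o).comp (B q)), ?_, ?_⟩
  · refine ContMDiffAt.clm_comp (contMDiff_adj.contMDiffAt.comp _ hs) ?_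
    exact ContMDiffAt.clm_comp contMDiffAt_const hB
  · filter_upwards [hBq, hsq] with q hq hsq v
    have hqo : (s q)⁻¹ • q = o := by
      rw [inv_smul_eq_iff, ho, ← mk_smul_base, hsq]
    have h1 : tder E' E' (fun y => χ ((s q)⁻¹ • y)) q v = transl E' (s q)⁻¹ q v := by
      rw [tder_comp_apply (E' := E') (g := χ) (f := fun y : K ⧸ H => (s q)⁻¹ • y)
        (by rw [hqo]; exact hχc.mdifferentiableAt (by simp)) (mdiffAt_translation E E' _ q), hqo,
        hχ, tder_chart_self]
      rfl
    have h2 := sig_smul (E := E) (s q)⁻¹ q v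
    rw [← h1, hq, hqo] at h2
    change sig E E' q v = adj E (s q) (sig E E' o (B q _))
    rw [h2, adj_apply_inv]

/-- The lift of a smooth vector field is smooth. -/
lemma contMDiffAt_sig {Y : K ⧸ H → E'} {p : K ⧸ H} (hY : IsSmoothFieldAt Y p) :
    ContMDiffAt 𝓘(ℝ, E') 𝓘(ℝ, E) ∞ (fun q => sig E E' q (Y q)) p := by
  obtain ⟨B, hB, hBq⟩ := exists_smooth_sig (E := E) (E' := E') p
  refine (hB.clm_apply (isSmoothFieldAt_iff.1 hY)).congr_of_eventuallyEq ?_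
  filter_upwards [hBq] with q hq
  exact hq _

lemma mdifferentiableAt_sig {Y : K ⧸ H → E'} {p : K ⧸ H} (hY : IsDiffFieldAt Y p) :
    MDifferentiableAt 𝓘(ℝ, E') 𝓘(ℝ, E) (fun q => sig E E' q (Y q)) p := by
  obtain ⟨B, hB, hBq⟩ := exists_smooth_sig (E := E) (E' := E') p
  refine ((hB.mdifferentiableAt (by simp)).clm_apply
    (isDiffFieldAt_iff.1 hY)).congr_of_eventuallyEq ?_
  filter_upwards [hBq] with q hq
  exact hq _

/-- Equivariant fields of endomorphisms of the Lie algebra are smooth. -/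
lemma contMDiff_of_equivariant {Φ : K ⧸ H → E →L[ℝ] E}
    (hΦ : ∀ (k : K) q x, Φ (k • q) (adj E k x) = adj E k (Φ q x)) :
    ContMDiff 𝓘(ℝ, E') 𝓘(ℝ, E →L[ℝ] E) ∞ Φ := by
  intro p
  obtain ⟨k₀, rfl⟩ := QuotientGroup.mk_surjective p
  obtain ⟨s, hs, hsk, hsq⟩ := exists_local_section E E' (H := H) k₀
  set o : K ⧸ H := ((1 : K) : K ⧸ H) with ho
  have h1 : ContMDiffAt 𝓘(ℝ, E') 𝓘(ℝ, E →L[ℝ] E) ∞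
      (fun q => (adj E (s q)).comp ((Φ o).comp (adj E (s q)⁻¹))) (k₀ : K ⧸ H) := by
    refine ContMDiffAt.clm_comp (contMDiff_adj.contMDiffAt.comp _ hs) ?_
    exact ContMDiffAt.clm_comp contMDiffAt_const (contMDiff_adj.contMDiffAt.comp _ hs.inv)
  refine h1.congr_of_eventuallyEq ?_
  filter_upwards [hsq] with q hq
  ext x
  change Φ q x = adj E (s q) (Φ o (adj E (s q)⁻¹ x))
  rw [← hΦ, adj_apply_inv, ho, ← mk_smul_base, hq]

/-- The differential of an equivariant field of endomorphisms of the Lie algebra. -/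
lemma tder_of_equivariant {Φ : K ⧸ H → E →L[ℝ] E}
    (hΦ : ∀ (k : K) q x, Φ (k • q) (adj E k x) = adj E k (Φ q x)) (p : K ⧸ H) (w x : E) :
    tder E' (E →L[ℝ] E) Φ p (infAct E E' p w) x = brk K w (Φ p x) - Φ p (brk K w x) := by
  have hd : MDifferentiableAt 𝓘(ℝ, E') 𝓘(ℝ, E →L[ℝ] E) Φ p :=
    (contMDiff_of_equivariant hΦ).mdifferentiable (by simp) p
  have h1 : (fun k : K => Φ (k • p) (adj E k x)) = fun k : K => adj E k (Φ p x) :=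
    funext fun k => hΦ k p x
  have hd' : MDifferentiableAt 𝓘(ℝ, E') 𝓘(ℝ, E →L[ℝ] E) Φ ((1 : K) • p) := by rwa [one_smul]
  have h2 := tder_clm_apply (E := E) (M := K) (p := 1) (g := fun k : K => Φ (k • p))
    (h := fun k : K => adj E k x)
    (MDifferentiableAt.comp (1 : K) hd' (mdiffAt_orbit E E' p 1))
    (mdifferentiableAt_adj_apply 1 x) w
  rw [h1, tder_adj, tder_adj, ← brk_apply, ← brk_apply, adj_one, one_smul,
    tder_comp_apply (E' := E') (f := fun k : K => k • p) hd' (mdiffAt_orbit E E' p 1),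
    one_smul] at h2
  rw [h2]
  exact (add_sub_cancel_right _ _).symm

end Homogeneous

/-- The Lie bracket of vector fields, as a map to the model space. -/
def flatBracket {E : Type*} [NormedAddCommGroup E] [NormedSpace ℝ E]
    {M : Type*} [TopologicalSpace M] [ChartedSpace E M] (X Y : M → E) (p : M) : E :=
  mlieBracket 𝓘(ℝ, E) X Y p

section Homogeneous

variable {E : Type*} [NormedAddCommGroup E] [NormedSpace ℝ E] [CompleteSpace E]
  [FiniteDimensional ℝ E]
  {E' : Type*} [NormedAddCommGroup E'] [NormedSpace ℝ E'] [CompleteSpace E']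
  [FiniteDimensional ℝ E']
  {K : Type*} [Group K] [TopologicalSpace K] [ChartedSpace E K] [LieGroup 𝓘(ℝ, E) ∞ K]
  {H : Subgroup K} [ChartedSpace E' (K ⧸ H)] [IsManifold 𝓘(ℝ, E') ∞ (K ⧸ H)]

/-- The covariant derivative of the canonical connection of a homogeneous space. -/
def canDer (E : Type*) [NormedAddCommGroup E] [NormedSpace ℝ E] [CompleteSpace E]
    [FiniteDimensional ℝ E] {E' : Type*} [NormedAddCommGroup E'] [NormedSpace ℝ E']
    {K : Type*} [Group K] [TopologicalSpace K] [ChartedSpace E K] [LieGroup 𝓘(ℝ, E) ∞ K]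
    {H : Subgroup K} [ChartedSpace E' (K ⧸ H)] (Y : K ⧸ H → E') (p : K ⧸ H) : E' →L[ℝ] E' :=
  (infAct E E' p).comp (tder E' E (fun q => sig E E' q (Y q)) p -
    ((brk K).flip (sig E E' p (Y p))).comp (sig E E' p))

lemma canDer_apply (Y : K ⧸ H → E') (p : K ⧸ H) (v : E') :
    canDer E Y p v = infAct E E' p (tder E' E (fun q => sig E E' q (Y q)) p v -
      brk K (sig E E' p v) (sig E E' p (Y p))) := rfl

/-- The projection of the Lie algebra to the orthogonal of the isotropy algebra. -/
def horProj (E : Type*) [NormedAddCommGroup E] [NormedSpace ℝ E] [CompleteSpace E]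
    [FiniteDimensional ℝ E] (E' : Type*) [NormedAddCommGroup E'] [NormedSpace ℝ E']
    {K : Type*} [Group K] [TopologicalSpace K] [ChartedSpace E K] [LieGroup 𝓘(ℝ, E) ∞ K]
    {H : Subgroup K} [ChartedSpace E' (K ⧸ H)] (p : K ⧸ H) : E →L[ℝ] E :=
  (sig E E' p).comp (infAct E E' p)

lemma horProj_apply (p : K ⧸ H) (x : E) :
    horProj E E' p x = sig E E' p (infAct E E' p x) := rfl

variable [hF : Fact (IsHomogeneousManifold (E := E) E' H)]
  [hN : Fact (∀ x : E, x ≠ 0 → 0 < nkill K x x)]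

lemma horProj_smul (k : K) (p : K ⧸ H) (x : E) :
    horProj E E' (k • p) (adj E k x) = adj E k (horProj E E' p x) := by
  rw [horProj_apply, infAct_smul, sig_smul, horProj_apply]

lemma horProj_sig (p : K ⧸ H) (v : E') : horProj E E' p (sig E E' p v) = sig E E' p v := by
  rw [horProj_apply, infAct_sig]

lemma sig_injective (p : K ⧸ H) : Function.Injective (sig E E' p) :=
  Function.LeftInverse.injective (g := infAct E E' p) (infAct_sig p)

lemma mdifferentiableAt_brk {f g : K ⧸ H → E} {p : K ⧸ H}
    (hf : MDifferentiableAt 𝓘(ℝ, E') 𝓘(ℝ, E) f p) (hg : MDifferentiableAt 𝓘(ℝ, E') 𝓘(ℝ, E) g p) :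
    MDifferentiableAt 𝓘(ℝ, E') 𝓘(ℝ, E) (fun q => brk K (f q) (g q)) p :=
  (mdifferentiableAt_clm (brk K) hf).clm_apply hg

/-- Derivative of an equivariant field of endomorphisms applied to a function. -/
lemma tder_equivariant_apply {Φ : K ⧸ H → E →L[ℝ] E}
    (hΦ : ∀ (k : K) q x, Φ (k • q) (adj E k x) = adj E k (Φ q x)) {f : K ⧸ H → E} {p : K ⧸ H}
    (hf : MDifferentiableAt 𝓘(ℝ, E') 𝓘(ℝ, E) f p) (v : E') :
    tder E' E (fun q => Φ q (f q)) p v - brk K (sig E E' p v) (Φ p (f p)) =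
      Φ p (tder E' E f p v - brk K (sig E E' p v) (f p)) := by
  rw [tder_clm_apply ((contMDiff_of_equivariant (E' := E') hΦ).mdifferentiable (by simp) p) hf]
  have h1 := tder_of_equivariant (E' := E') hΦ p (sig E E' p v) (f p)
  rw [infAct_sig] at h1
  rw [h1, map_sub]
  abel

lemma sig_canDer {Y : K ⧸ H → E'} {p : K ⧸ H} (hY : IsDiffFieldAt Y p) (v : E') :
    sig E E' p (canDer E Y p v) = tder E' E (fun q => sig E E' q (Y q)) p v -
      brk K (sig E E' p v) (sig E E' p (Y p)) := by
  have h1 := tder_equivariant_apply (E := E) (E' := E') (H := H) (Φ := horProj E E')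
    horProj_smul (mdifferentiableAt_sig hY) v
  simp only [horProj_sig] at h1
  rw [canDer_apply, ← horProj_apply, ← h1]

lemma canDer_eq_of_sig {Y : K ⧸ H → E'} {p : K ⧸ H} {v u : E'}
    (h : tder E' E (fun q => sig E E' q (Y q)) p v -
      brk K (sig E E' p v) (sig E E' p (Y p)) = sig E E' p u) : canDer E Y p v = u := by
  rw [canDer_apply, h, infAct_sig]

/-- The Lie bracket of vector fields in terms of functions to the Lie algebra. -/
theorem mlieBracket_eq_infAct {X Y : K ⧸ H → E'} {p : K ⧸ H} (hX : IsDiffFieldAt X p)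
    (hY : IsDiffFieldAt Y p) :
    flatBracket X Y p =
      infAct E E' p (tder E' E (fun q => sig E E' q (Y q)) p (X p) -
        tder E' E (fun q => sig E E' q (X q)) p (Y p) -
          brk K (sig E E' p (X p)) (sig E E' p (Y p))) := by
  set f := extChartAt 𝓘(ℝ, E') p with hfdef
  have hf : ContMDiffAt 𝓘(ℝ, E') 𝓘(ℝ, E') ∞ f p := contMDiffAt_extChartAt
  have hf1 : tder E' E' f p = ContinuousLinearMap.id ℝ E' := tder_chart_self p
  set A : K ⧸ H → E →L[ℝ] E' := fun q => tder E E' (fun k : K => f (k • q)) 1 with hA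
  have hAd : MDifferentiableAt 𝓘(ℝ, E') 𝓘(ℝ, E →L[ℝ] E') A p :=
    (contMDiffAt_tder_chart_infAct p).mdifferentiableAt (by simp)
  have hAev : ∀ᶠ q in 𝓝 p, ∀ X : E, tder E' E' f q (infAct E E' q X) = A q X :=
    tder_chart_infAct p
  have hAp : A p = infAct E E' p := by
    ext x
    rw [← hAev.self_of_nhds x, hf1]
    rfl
  have key : ∀ (g : K ⧸ H → E), MDifferentiableAt 𝓘(ℝ, E') 𝓘(ℝ, E) g p → ∀ v : E',
      tder E' E' (fun q => tder E' E' f q (infAct E E' q (g q))) p v =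
        tder E' (E →L[ℝ] E') A p v (g p) + infAct E E' p (tder E' E g p v) := by
    intro g hg v
    have h1 : (fun q => tder E' E' f q (infAct E E' q (g q))) =ᶠ[𝓝 p] fun q => A q (g q) := by
      filter_upwards [hAev] with q hq
      exact hq _
    rw [tder_congr h1, tder_clm_apply hAd hg, hAp]
  have hbr : ∀ g h : K ⧸ H → E, MDifferentiableAt 𝓘(ℝ, E') 𝓘(ℝ, E) g p →
      MDifferentiableAt 𝓘(ℝ, E') 𝓘(ℝ, E) h p →
      (mlieBracket 𝓘(ℝ, E') (fun q => infAct E E' q (g q)) (fun q => infAct E E' q (h q)) p : E') =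
        (tder E' (E →L[ℝ] E') A p (infAct E E' p (g p)) (h p) +
          infAct E E' p (tder E' E h p (infAct E E' p (g p)))) -
        (tder E' (E →L[ℝ] E') A p (infAct E E' p (h p)) (g p) +
          infAct E E' p (tder E' E g p (infAct E E' p (h p)))) := by
    intro g h hg hh
    have h1 := tder_mlieBracket (hf.of_le two_le_smooth) (isDiffFieldAt_infAct hg)
      (isDiffFieldAt_infAct hh)
    have h1' : tder E' E' f p (mlieBracket 𝓘(ℝ, E') (fun q => infAct E E' q (g q))
        (fun q => infAct E E' q (h q)) p) =
        tder E' E' (fun q => tder E' E' f q (infAct E E' q (h q))) p (infAct E E' p (g p)) -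
        tder E' E' (fun q => tder E' E' f q (infAct E E' q (g q))) p (infAct E E' p (h p)) := h1
    rw [key h hh, key g hg, hf1] at h1'
    exact h1'
  have h1 := hbr _ _ (mdifferentiableAt_sig hX) (mdifferentiableAt_sig hY)
  have h2 := hbr (fun _ => sig E E' p (X p)) (fun _ => sig E E' p (Y p)) mdifferentiableAt_const
    mdifferentiableAt_const
  rw [mlieBracket_infAct, tder_const, tder_const] at h2
  simp only [infAct_sig, zero_apply, map_zero, add_zero] at h1 h2
  rw [map_sub, map_sub]
  refine Eq.trans h1 ?_
  rw [sub_eq_add_neg _ (infAct E E' p (brk K _ _)), h2]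
  abel

/-- The torsion of the canonical connection. -/
theorem canDer_torsion {X Y : K ⧸ H → E'} {p : K ⧸ H} (hX : IsDiffFieldAt X p)
    (hY : IsDiffFieldAt Y p) :
    canDer E Y p (X p) - canDer E X p (Y p) - flatBracket X Y p =
      -infAct E E' p (brk K (sig E E' p (X p)) (sig E E' p (Y p))) := by
  rw [canDer_apply, canDer_apply, brk_skew (sig E E' p (Y p)), mlieBracket_eq_infAct (E := E) hX hY]
  simp only [map_sub, map_neg]
  abel

/-- The canonical connection is metric. -/
theorem canDer_metric {X Y : K ⧸ H → E'} {p : K ⧸ H} (hX : IsDiffFieldAt X p)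
    (hY : IsDiffFieldAt Y p) (v : E') :
    tder E' ℝ (fun q => nkill K (sig E E' q (X q)) (sig E E' q (Y q))) p v =
      nkill K (sig E E' p (canDer E X p v)) (sig E E' p (Y p)) +
        nkill K (sig E E' p (X p)) (sig E E' p (canDer E Y p v)) := by
  rw [tder_bilin (nkill K) (mdifferentiableAt_sig hX) (mdifferentiableAt_sig hY), sig_canDer hX,
    sig_canDer hY]
  have h2 : ∀ y z w : E, nkill K (y - z) w = nkill K y w - nkill K z w := fun y z w => by
    rw [map_sub]; rfl
  rw [h2, map_sub, nkill_brk_left]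
  ring

/-- The canonical connection leaves invariant fields of endomorphisms parallel. -/
theorem canDer_endo {J : K ⧸ H → E' →L[ℝ] E'}
    (hJ : ∀ (k : K) p v, J (k • p) (transl E' k p v) = transl E' k p (J p v))
    {Y : K ⧸ H → E'} {p : K ⧸ H} (hY : IsDiffFieldAt Y p) (v : E') :
    canDer E (fun q => J q (Y q)) p v = J p (canDer E Y p v) := by
  have h1 := tder_equivariant_apply (E := E) (E' := E') (H := H)
    (Φ := fun q => (sig E E' q).comp ((J q).comp (infAct E E' q))) (fun k q x => by
      change sig E E' (k • q) (J (k • q) (infAct E E' (k • q) (adj E k x))) =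
        adj E k (sig E E' q (J q (infAct E E' q x)))
      rw [infAct_smul, hJ, sig_smul]) (mdifferentiableAt_sig hY) v
  rw [← sig_canDer hY] at h1
  simp only [ContinuousLinearMap.comp_apply, infAct_sig] at h1
  exact canDer_eq_of_sig h1

/-- The torsion of the canonical connection is parallel. -/
theorem canDer_torsion_parallel {X Y : K ⧸ H → E'} {p : K ⧸ H} (hX : IsDiffFieldAt X p)
    (hY : IsDiffFieldAt Y p) (w : E') :
    canDer E (fun q => -infAct E E' q (brk K (sig E E' q (X q)) (sig E E' q (Y q)))) p w =
      -infAct E E' p (brk K (sig E E' p (canDer E X p w)) (sig E E' p (Y p))) +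
      -infAct E E' p (brk K (sig E E' p (X p)) (sig E E' p (canDer E Y p w))) := by
  have hx := mdifferentiableAt_sig (E := E) hX
  have hy := mdifferentiableAt_sig (E := E) hY
  have hz := mdifferentiableAt_brk (K := K) (H := H) hx hy
  have h1 := tder_equivariant_apply (E := E) (E' := E') (H := H) (Φ := horProj E E')
    horProj_smul hz.neg w
  refine canDer_eq_of_sig ?_
  have h2 : (fun q => sig E E' q (-infAct E E' q (brk K (sig E E' q (X q)) (sig E E' q (Y q))))) =
      fun q => horProj E E' q (-brk K (sig E E' q (X q)) (sig E E' q (Y q))) := by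
    ext q
    rw [horProj_apply, map_neg (infAct E E' q)]
  have h3 := congrFun h2 p
  rw [h2, h3]
  refine h1.trans ?_
  rw [horProj_apply]
  congr 1
  have h4 : tder E' E (-fun q => brk K (sig E E' q (X q)) (sig E E' q (Y q))) p =
    - tder E' E (fun q => brk K (sig E E' q (X q)) (sig E E' q (Y q))) p := tder_neg hz
  rw [h4, Pi.neg_apply, neg_apply, tder_bilin (brk K) hx hy, sig_canDer hX, sig_canDer hY]
  simp only [map_sub, map_neg, sub_apply]
  rw [brk_brk]
  simp only [map_add]
  abel

end Homogeneous

section Homogeneous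

variable {E : Type*} [NormedAddCommGroup E] [NormedSpace ℝ E] [CompleteSpace E]
  [FiniteDimensional ℝ E]
  {E' : Type*} [NormedAddCommGroup E'] [NormedSpace ℝ E'] [CompleteSpace E']
  [FiniteDimensional ℝ E']
  {K : Type*} [Group K] [TopologicalSpace K] [ChartedSpace E K] [LieGroup 𝓘(ℝ, E) ∞ K]
  {H : Subgroup K} [ChartedSpace E' (K ⧸ H)] [IsManifold 𝓘(ℝ, E') ∞ (K ⧸ H)]
  [hF : Fact (IsHomogeneousManifold (E := E) E' H)]
  [hN : Fact (∀ x : E, x ≠ 0 → 0 < nkill K x x)]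

lemma contMDiffAt_brk {f g : K ⧸ H → E} {p : K ⧸ H}
    (hf : ContMDiffAt 𝓘(ℝ, E') 𝓘(ℝ, E) ∞ f p) (hg : ContMDiffAt 𝓘(ℝ, E') 𝓘(ℝ, E) ∞ g p) :
    ContMDiffAt 𝓘(ℝ, E') 𝓘(ℝ, E) ∞ (fun q => brk K (f q) (g q)) p :=
  ((brk K).contDiff.contMDiff.contMDiffAt.comp p hf).clm_apply hg

lemma isSmoothFieldAt_canDer {X Z : K ⧸ H → E'} {p : K ⧸ H} (hX : IsSmoothFieldAt X p)
    (hZ : IsSmoothFieldAt Z p) : IsSmoothFieldAt (fun q => canDer E Z q (X q)) p :=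
  isSmoothFieldAt_infAct ((contMDiffAt_tder_field (contMDiffAt_sig hZ) hX).sub
    (contMDiffAt_brk (contMDiffAt_sig hX) (contMDiffAt_sig hZ)))

lemma canDer_infAct {f : K ⧸ H → E} {p : K ⧸ H}
    (hf : MDifferentiableAt 𝓘(ℝ, E') 𝓘(ℝ, E) f p) (w : E') :
    canDer E (fun q => infAct E E' q (f q)) p w =
      infAct E E' p (tder E' E f p w - brk K (sig E E' p w) (f p)) := by
  have h1 := tder_equivariant_apply (E := E) (E' := E') (H := H) (Φ := horProj E E')
    horProj_smul hf w
  refine canDer_eq_of_sig ?_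
  exact h1

/-- The curvature of the canonical connection. -/
theorem canDer_curvature {X Y Z : K ⧸ H → E'} (hX : ∀ q, IsSmoothFieldAt X q)
    (hY : ∀ q, IsSmoothFieldAt Y q) (hZ : ∀ q, IsSmoothFieldAt Z q) (p : K ⧸ H) :
    canDer E (fun q => canDer E Z q (Y q)) p (X p) - canDer E (fun q => canDer E Z q (X q)) p (Y p)
      - canDer E Z p (flatBracket X Y p) =
    -infAct E E' p (brk K (brk K (sig E E' p (X p)) (sig E E' p (Y p)) -
      horProj E E' p (brk K (sig E E' p (X p)) (sig E E' p (Y p)))) (sig E E' p (Z p))) := by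
  have hx := mdifferentiableAt_sig (E := E) (hX p).isDiffFieldAt
  have hy := mdifferentiableAt_sig (E := E) (hY p).isDiffFieldAt
  have hz := mdifferentiableAt_sig (E := E) (hZ p).isDiffFieldAt
  have hzs := contMDiffAt_sig (E := E) (hZ p)
  have hXZ := (contMDiffAt_tder_field hzs (hX p)).mdifferentiableAt (by simp)
  have hYZ := (contMDiffAt_tder_field hzs (hY p)).mdifferentiableAt (by simp)
  have e1 : ∀ V : K ⧸ H → E', (∀ q, IsSmoothFieldAt V q) → ∀ w : E',
      canDer E (fun q => canDer E Z q (V q)) p w = infAct E E' p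
        (tder E' E (fun q => tder E' E (fun q => sig E E' q (Z q)) q (V q)) p w -
          (brk K (tder E' E (fun q => sig E E' q (V q)) p w) (sig E E' p (Z p)) +
            brk K (sig E E' p (V p)) (tder E' E (fun q => sig E E' q (Z q)) p w)) -
          brk K (sig E E' p w) (tder E' E (fun q => sig E E' q (Z q)) p (V p) -
            brk K (sig E E' p (V p)) (sig E E' p (Z p)))) := by
    intro V hV w
    have hv := mdifferentiableAt_sig (E := E) (hV p).isDiffFieldAt
    have hVZ := (contMDiffAt_tder_field hzs (hV p)).mdifferentiableAt (by simp)
    have hb := mdifferentiableAt_brk (K := K) (H := H) hv hz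
    have h1 := canDer_infAct (E := E) (hVZ.sub hb) w
    refine h1.trans ?_
    have h2 := tder_sub hVZ hb
    have h3 : tder E' E ((fun q => tder E' E (fun q => sig E E' q (Z q)) q (V q)) -
      fun q => brk K (sig E E' q (V q)) (sig E E' q (Z q))) p = _ := h2
    rw [h3, sub_apply, tder_bilin (brk K) hv hz]
    rfl
  have e2 := tder_mlieBracket (hzs.of_le two_le_smooth) (hX p).isDiffFieldAt (hY p).isDiffFieldAt
  have e2' : tder E' E (fun q => sig E E' q (Z q)) p (flatBracket X Y p) = _ := e2
  have e3 := mlieBracket_eq_infAct (E := E) (hX p).isDiffFieldAt (hY p).isDiffFieldAt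
  have e4 : sig E E' p (flatBracket X Y p) = horProj E E' p _ := congrArg (sig E E' p) e3
  have e5 := sig_canDer (E := E) (hY p).isDiffFieldAt (X p)
  have e6 := sig_canDer (E := E) (hX p).isDiffFieldAt (Y p)
  have e5' := horProj_sig (E := E) p (canDer E Y p (X p))
  have e6' := horProj_sig (E := E) p (canDer E X p (Y p))
  rw [e5] at e5'
  rw [e6] at e6'
  rw [e1 Y hY, e1 X hX, canDer_apply, e2', e4, ← map_sub, ← map_sub, ← map_neg]
  congr 1
  have j := brk_brk (K := K) (sig E E' p (X p)) (sig E E' p (Y p)) (sig E E' p (Z p))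
  have k1 := brk_skew (K := K) (sig E E' p (Y p)) (sig E E' p (X p))
  rw [k1] at e6'
  generalize sig E E' p (X p) = x at *
  generalize sig E E' p (Y p) = y at *
  generalize sig E E' p (Z p) = z at *
  generalize tder E' E (fun q => sig E E' q (Y q)) p (X p) = Xy at *
  generalize tder E' E (fun q => sig E E' q (X q)) p (Y p) = Yx at *
  have e7 : horProj E E' p (Xy - Yx - brk K x y) =
      Xy - Yx - (brk K x y + brk K x y) + horProj E E' p (brk K x y) := by
    have h1 : Xy - Yx - brk K x y = (Xy - brk K x y) - (Yx - -brk K x y) + brk K x y := by abel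
    rw [h1, map_add, map_sub, e5', e6']
    abel
  rw [e7]
  simp only [map_sub, map_add, sub_apply, add_apply]
  rw [j]
  abel

/-- The curvature of the canonical connection is parallel. -/
theorem canDer_curvature_parallel {X Y Z : K ⧸ H → E'} {p : K ⧸ H} (hX : IsDiffFieldAt X p)
    (hY : IsDiffFieldAt Y p) (hZ : IsDiffFieldAt Z p) (w : E') :
    canDer E (fun q => -infAct E E' q (brk K (brk K (sig E E' q (X q)) (sig E E' q (Y q)) -
      horProj E E' q (brk K (sig E E' q (X q)) (sig E E' q (Y q)))) (sig E E' q (Z q)))) p w =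
    -infAct E E' p (brk K (brk K (sig E E' p (canDer E X p w)) (sig E E' p (Y p)) -
      horProj E E' p (brk K (sig E E' p (canDer E X p w)) (sig E E' p (Y p)))) (sig E E' p (Z p)))
    + -infAct E E' p (brk K (brk K (sig E E' p (X p)) (sig E E' p (canDer E Y p w)) -
      horProj E E' p (brk K (sig E E' p (X p)) (sig E E' p (canDer E Y p w)))) (sig E E' p (Z p)))
    + -infAct E E' p (brk K (brk K (sig E E' p (X p)) (sig E E' p (Y p)) -
      horProj E E' p (brk K (sig E E' p (X p)) (sig E E' p (Y p))))
        (sig E E' p (canDer E Z p w))) := by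
  have hx := mdifferentiableAt_sig (E := E) hX
  have hy := mdifferentiableAt_sig (E := E) hY
  have hz := mdifferentiableAt_sig (E := E) hZ
  have hxy := mdifferentiableAt_brk (K := K) (H := H) hx hy
  have hΦ : ∀ (k : K) (q : K ⧸ H) (x : E),
      (ContinuousLinearMap.id ℝ E - horProj E E' (k • q)) (adj E k x) =
        adj E k ((ContinuousLinearMap.id ℝ E - horProj E E' q) x) := fun k q x => by
    simp only [sub_apply, ContinuousLinearMap.id_apply, horProj_smul, map_sub]
  have hq : MDifferentiableAt 𝓘(ℝ, E') 𝓘(ℝ, E) (fun q => (ContinuousLinearMap.id ℝ E -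
      horProj E E' q) (brk K (sig E E' q (X q)) (sig E E' q (Y q)))) p :=
    ((contMDiff_of_equivariant (E' := E')
      (Φ := fun q => ContinuousLinearMap.id ℝ E - horProj E E' q) hΦ).mdifferentiable (by simp) p).clm_apply hxy
  have hd := tder_equivariant_apply (E' := E')
    (Φ := fun q => ContinuousLinearMap.id ℝ E - horProj E E' q) hΦ hxy w
  have hg := mdifferentiableAt_brk (K := K) (H := H) hq hz
  have h1 := canDer_infAct (E := E) hg.neg w
  simp only [Pi.neg_apply, map_neg] at h1
  have h2 : tder E' E (-fun q => brk K ((ContinuousLinearMap.id ℝ E -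
      horProj E E' q) (brk K (sig E E' q (X q)) (sig E E' q (Y q)))) (sig E E' q (Z q))) p =
    - tder E' E (fun q => brk K ((ContinuousLinearMap.id ℝ E -
      horProj E E' q) (brk K (sig E E' q (X q)) (sig E E' q (Y q)))) (sig E E' q (Z q))) p :=
    tder_neg hg
  rw [h2, neg_apply, tder_bilin (brk K) hq hz, sub_eq_iff_eq_add.1 hd,
    tder_bilin (brk K) hx hy] at h1
  refine h1.trans ?_
  rw [sig_canDer hX, sig_canDer hY, sig_canDer hZ, ← map_neg (infAct E E' p),
    ← map_neg (infAct E E' p), ← map_neg (infAct E E' p), ← map_add (infAct E E' p),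
    ← map_add (infAct E E' p)]
  refine congrArg (infAct E E' p) ?_
  simp only [sub_apply, ContinuousLinearMap.id_apply]
  have j := brk_brk (K := K) (sig E E' p w) (brk K (sig E E' p (X p)) (sig E E' p (Y p)) -
      horProj E E' p (brk K (sig E E' p (X p)) (sig E E' p (Y p)))) (sig E E' p (Z p))
  have j2 := brk_brk (K := K) (sig E E' p w) (sig E E' p (X p)) (sig E E' p (Y p))
  rw [j2]
  rw [sub_neg_eq_add, j]
  simp only [map_sub, map_add, sub_apply, add_apply]
  abel

/-- The canonical connection is invariant. -/
theorem canDer_invariant (k : K) {Y : K ⧸ H → E'} {p : K ⧸ H} (hY : IsDiffFieldAt Y (k • p))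
    (v : E') :
    canDer E Y (k • p) (transl E' k p v) =
      transl E' k p (canDer E (fun q => transl E' k⁻¹ (k • q) (Y (k • q))) p v) := by
  have hy := mdifferentiableAt_sig (E := E) hY
  have hs : ∀ q, sig E E' q (transl E' k⁻¹ (k • q) (Y (k • q))) =
      adj E k⁻¹ (sig E E' (k • q) (Y (k • q))) := fun q => by
    have := sig_smul (E := E) k⁻¹ (k • q) (Y (k • q))
    rwa [inv_smul_smul] at this
  have hc : MDifferentiableAt 𝓘(ℝ, E') 𝓘(ℝ, E) (fun q => sig E E' (k • q) (Y (k • q))) p :=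
    MDifferentiableAt.comp p (I' := 𝓘(ℝ, E')) (g := fun q => sig E E' q (Y q)) hy
      (mdiffAt_translation E E' k p)
  rw [canDer_apply, canDer_apply, ← infAct_smul]
  congr 1
  simp only [hs]
  rw [tder_clm _ hc, map_sub, adj_apply_inv, adj_brk, adj_apply_inv, ← sig_smul,
    tder_comp_apply (E' := E') (g := fun q => sig E E' q (Y q)) (f := fun q : K ⧸ H => k • q) hy
      (mdiffAt_translation E E' k p)]
  rfl

/-- The Nomizu operator of the canonical connection vanishes. -/
theorem canDer_nomizu {X : E} (Y : E) {p : K ⧸ H} (hX : horProj E E' p X = X) :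
    canDer E (fun q => infAct E E' q Y) p (infAct E E' p X) + infAct E E' p (brk K X Y) = 0 := by
  rw [canDer_infAct mdifferentiableAt_const, tder_const, ← horProj_apply, hX]
  simp

end Homogeneous

section Isotropy

variable {E : Type*} [NormedAddCommGroup E] [NormedSpace ℝ E] [CompleteSpace E]
  {E' : Type*} [NormedAddCommGroup E'] [NormedSpace ℝ E'] [CompleteSpace E']
  {K : Type*} [Group K] [TopologicalSpace K] [ChartedSpace E K] [LieGroup 𝓘(ℝ, E) ∞ K]
  {H : Subgroup K} [ChartedSpace E' (K ⧸ H)] [IsManifold 𝓘(ℝ, E') ∞ (K ⧸ H)]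

lemma tder_conj_leftField (z k : K) (X : E) :
    tder E E (fun y => z * y * z⁻¹) k (leftField X k) =
      leftField (adj E z X) (z * k * z⁻¹) := by
  have h1 : (fun y : K => z * (k * y) * z⁻¹) =
      fun y => z * k * z⁻¹ * (z * y * z⁻¹) := by
    ext y; group
  have h2 := tder_comp_apply (E' := E) (g := fun y : K => z * y * z⁻¹) (f := fun y => k * y)
    (p := 1) (mdiff_conj z _) (mdiff_mul_left k 1) X
  have h3 := tder_comp_apply (E' := E) (g := fun y : K => z * k * z⁻¹ * y)
    (f := fun y => z * y * z⁻¹) (p := 1) (mdiff_mul_left _ _) (mdiff_conj z 1) X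
  rw [h1, h3] at h2
  simp only [mul_one, mul_inv_cancel] at h2
  exact h2.symm

/-- A vector fixed by the adjoint action of `Z` is tangent to a curve in the centralizer. -/
theorem exists_curve_centralizer [T2Space K] (Z : Subgroup K) (X : E)
    (hX : ∀ z ∈ Z, adj E z X = X) :
    ∃ γ : ℝ → K, γ 0 = 1 ∧ MDifferentiableAt 𝓘(ℝ, ℝ) 𝓘(ℝ, E) γ 0 ∧ tder ℝ E γ 0 1 = X ∧
      ∀ᶠ t in 𝓝 0, γ t ∈ Subgroup.centralizer (Z : Set K) := by
  have hv : ContMDiff 𝓘(ℝ, E) (𝓘(ℝ, E).prod 𝓘(ℝ, E)) 1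
      (fun k => (⟨k, (leftField X : K → E) k⟩ : TangentBundle 𝓘(ℝ, E) K)) := by
    have := contMDiff_mulInvariantVectorField (I := 𝓘(ℝ, E)) (G := K) (show GroupLieAlgebra 𝓘(ℝ, E) K from X)
    exact this.of_le (one_le_two.trans le_minSmoothness)
  obtain ⟨γ, hγ0, hγ⟩ := exists_isMIntegralCurveAt_of_contMDiffAt_boundaryless (t₀ := 0)
    (hv.contMDiffAt (x := 1))
  obtain ⟨ε, hε, hγ'⟩ := isMIntegralCurveAt_iff'.1 hγ
  have hball : Metric.ball (0 : ℝ) ε = Set.Ioo (-ε) ε := by rw [Real.ball_eq_Ioo]; simp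
  rw [hball] at hγ'
  have h0 := hγ.hasMFDerivAt
  refine ⟨γ, hγ0, h0.mdifferentiableAt, ?_, ?_⟩
  · have h1 : tder ℝ E γ 0 = _ := h0.mfderiv
    rw [h1, hγ0]
    change (1 : ℝ) • leftField X (1 : K) = X
    rw [one_smul, leftField_one]
  · filter_upwards [Ioo_mem_nhds (neg_lt_zero.2 hε) hε] with t ht
    rw [Subgroup.mem_centralizer_iff]
    intro z hz
    have hγz : IsMIntegralCurveOn (I := 𝓘(ℝ, E)) (fun t => z * γ t * z⁻¹) (leftField X : K → E)
        (Set.Ioo (-ε) ε) := by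
      intro s hs
      have h1 := HasMFDerivAt.comp_hasMFDerivWithinAt (g := fun y : K => z * y * z⁻¹) s
        (mdiff_conj z (γ s)).hasMFDerivAt (hγ' s hs)
      refine h1.congr_mfderiv ?_
      ext
      change tder E E (fun y => z * y * z⁻¹) (γ s) ((1 : ℝ) • leftField X (γ s)) =
        (1 : ℝ) • leftField X (z * γ s * z⁻¹)
      rw [one_smul, one_smul, tder_conj_leftField, hX z hz]
    have h2 := isMIntegralCurveOn_Ioo_eqOn_of_contMDiff_boundaryless (I := 𝓘(ℝ, E))
      (t₀ := 0) ⟨neg_lt_zero.2 hε, hε⟩ hv hγ' hγz (by simp [hγ0]) ht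
    exact (eq_mul_inv_iff_mul_eq.1 h2).symm

variable [hF : Fact (IsHomogeneousManifold (E := E) E' H)]

lemma infAct_base : infAct E E' ((1 : K) : K ⧸ H) = tder E E' (fun k : K => (k : K ⧸ H)) 1 := by
  have h1 : (fun k : K => k • ((1 : K) : K ⧸ H)) = fun k : K => (k : K ⧸ H) := by
    ext k
    change ((k * 1 : K) : K ⧸ H) = k
    rw [mul_one]
  rw [infAct, h1]

/-- The isotropy algebra of the centralizer of `Z` consists of the vectors fixed by `Z`. -/
theorem infAct_base_eq_zero_iff [T2Space K] {Z : Subgroup K}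
    (hH : H = Subgroup.centralizer (Z : Set K)) (X : E) :
    infAct E E' ((1 : K) : K ⧸ H) X = 0 ↔ ∀ z ∈ Z, adj E z X = X := by
  rw [infAct_base]
  constructor
  · intro hX z hz
    obtain ⟨γ, hγ, hγ0, hγH, hγX⟩ :=
      (submersion_slices (Manifold.IsSubmersion.isSubmersionAt hF.out (1 : K))).2 X hX
    have h1 : (fun t => z * γ t * z⁻¹) =ᶠ[𝓝 0] γ := by
      filter_upwards [hγH] with t ht
      have h2 : γ t ∈ H := by
        have := QuotientGroup.eq.1 ht.symm
        simpa using this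
      rw [hH, Subgroup.mem_centralizer_iff] at h2
      rw [h2 z hz, mul_inv_cancel_right]
    have h3 := tder_comp_apply (E' := E) (g := fun y : K => z * y * z⁻¹) (f := γ)
      (mdiff_conj z _) (hγ.mdifferentiableAt (by simp)) 1
    rw [tder_congr h1, hγX, hγ0] at h3
    exact h3.symm
  · intro hX
    obtain ⟨γ, hγ0, hγ, hγX, hγH⟩ := exists_curve_centralizer Z X hX
    have h1 : (fun t => (γ t : K ⧸ H)) =ᶠ[𝓝 0] fun _ => ((1 : K) : K ⧸ H) := by
      filter_upwards [hγH] with t ht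
      rw [← hH] at ht
      exact (QuotientGroup.eq.2 (by simpa using ht)).symm
    have h3 := tder_comp_apply (E' := E) (g := fun k : K => (k : K ⧸ H)) (f := γ)
      (mdiffAt_proj E E' H _) hγ 1
    rw [tder_congr h1, tder_const, hγX, hγ0] at h3
    exact h3.symm

end Isotropy

section Sections

variable {E : Type*} [NormedAddCommGroup E] [NormedSpace ℝ E]
  {M : Type*} [TopologicalSpace M] [ChartedSpace E M] [IsManifold 𝓘(ℝ, E) ∞ M]

lemma mem_baseSet_tangent {p q : M} (hq : q ∈ (extChartAt 𝓘(ℝ, E) p).source) :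
    q ∈ (trivializationAt E (TangentSpace 𝓘(ℝ, E) (M := M)) p).baseSet := by
  simpa using hq

lemma continuousLinearMapAt_eq_tder {p q : M} (hq : q ∈ (extChartAt 𝓘(ℝ, E) p).source) (v : E) :
    (trivializationAt E (TangentSpace 𝓘(ℝ, E) (M := M)) p).continuousLinearMapAt ℝ q v =
      tder E E (extChartAt 𝓘(ℝ, E) p) q v := by
  rw [← trivializationAt_eq_tder hq]
  exact congrFun (Trivialization.coe_linearMapAt_of_mem (R := ℝ) _ (mem_baseSet_tangent hq)) v

lemma tder_chart_symmL {p q : M} (hq : q ∈ (extChartAt 𝓘(ℝ, E) p).source) (w : E) :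
    tder E E (extChartAt 𝓘(ℝ, E) p) q
      ((trivializationAt E (TangentSpace 𝓘(ℝ, E) (M := M)) p).symmL ℝ q w) = w := by
  refine (continuousLinearMapAt_eq_tder hq _).symm.trans ?_
  exact Trivialization.continuousLinearMapAt_symmL _ (mem_baseSet_tangent hq) w

/-- Smoothness of a field of endomorphisms of the tangent bundle, read in a chart. -/
theorem contMDiffAt_endomorphism {A B : M → E →L[ℝ] E} {p : M}
    (hB : ContMDiffAt 𝓘(ℝ, E) 𝓘(ℝ, E →L[ℝ] E) ∞ B p)
    (hAB : ∀ᶠ q in 𝓝 p, ∀ v, tder E E (extChartAt 𝓘(ℝ, E) p) q (A q v) =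
      B q (tder E E (extChartAt 𝓘(ℝ, E) p) q v)) :
    ContMDiffAt 𝓘(ℝ, E) (𝓘(ℝ, E).prod 𝓘(ℝ, E →L[ℝ] E)) ∞
      (fun x => (⟨x, A x⟩ : TotalSpace (E →L[ℝ] E)
        fun x : M => TangentSpace 𝓘(ℝ, E) x →L[ℝ] TangentSpace 𝓘(ℝ, E) x)) p := by
  rw [contMDiffAt_hom_bundle]
  refine ⟨contMDiffAt_id, hB.congr_of_eventuallyEq ?_⟩
  filter_upwards [hAB, extChartAt_source_mem_nhds (I := 𝓘(ℝ, E)) p] with q hq hqs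
  ext w
  change (trivializationAt E (TangentSpace 𝓘(ℝ, E) (M := M)) p).continuousLinearMapAt ℝ q
    (A q ((trivializationAt E (TangentSpace 𝓘(ℝ, E) (M := M)) p).symmL ℝ q w)) = _
  refine (continuousLinearMapAt_eq_tder hqs _).trans ((hq _).trans ?_)
  rw [tder_chart_symmL hqs]

/-- Smoothness of a field of bilinear forms on the tangent bundle, read in a chart. -/
theorem contMDiffAt_bilinear_form {A B : M → E →L[ℝ] E →L[ℝ] ℝ} {p : M}
    (hB : ContMDiffAt 𝓘(ℝ, E) 𝓘(ℝ, E →L[ℝ] E →L[ℝ] ℝ) ∞ B p)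
    (hAB : ∀ᶠ q in 𝓝 p, ∀ v w, A q v w =
      B q (tder E E (extChartAt 𝓘(ℝ, E) p) q v) (tder E E (extChartAt 𝓘(ℝ, E) p) q w)) :
    ContMDiffAt 𝓘(ℝ, E) (𝓘(ℝ, E).prod 𝓘(ℝ, E →L[ℝ] E →L[ℝ] ℝ)) ∞
      (fun x => (TotalSpace.mk' (E →L[ℝ] E →L[ℝ] ℝ) x (A x) : TotalSpace (E →L[ℝ] E →L[ℝ] ℝ)
        fun x : M => TangentSpace 𝓘(ℝ, E) x →L[ℝ] TangentSpace 𝓘(ℝ, E) x →L[ℝ] ℝ)) p := by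
  rw [contMDiffAt_hom_bundle]
  refine ⟨contMDiffAt_id, hB.congr_of_eventuallyEq ?_⟩
  filter_upwards [hAB, extChartAt_source_mem_nhds (I := 𝓘(ℝ, E)) p] with q hq hqs
  ext v w
  refine (inCoordinates_apply_eq₂ (F₁ := E) (F₂ := E) (F₃ := ℝ)
    (E₁ := TangentSpace 𝓘(ℝ, E) (M := M)) (E₂ := TangentSpace 𝓘(ℝ, E) (M := M))
    (E₃ := Bundle.Trivial M ℝ) (mem_baseSet_tangent hqs) (mem_baseSet_tangent hqs)
    (Set.mem_univ _)).trans ?_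
  have h1 := hq ((trivializationAt E (TangentSpace 𝓘(ℝ, E) (M := M)) p).symmL ℝ q v)
    ((trivializationAt E (TangentSpace 𝓘(ℝ, E) (M := M)) p).symmL ℝ q w)
  rw [tder_chart_symmL hqs, tder_chart_symmL hqs] at h1
  refine Eq.trans ?_ h1
  simp only [Trivial.fiberBundle_trivializationAt', Trivial.linearMapAt_trivialization,
    LinearMap.id_coe, id_eq]
  have hs : ∀ u : E, ((trivializationAt E (TangentSpace 𝓘(ℝ, E) (M := M)) p).symm q u : E) =
      (trivializationAt E (TangentSpace 𝓘(ℝ, E) (M := M)) p).symmL ℝ q u := fun u =>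
    (Trivialization.symmL_apply _ (mem_baseSet_tangent hqs) u).symm
  exact congrArg₂ (fun a b : E => A q a b) (hs v) (hs w)

end Sections

lemma exists_pos_mul_sq_le {V : Type*} [NormedAddCommGroup V] [NormedSpace ℝ V]
    [FiniteDimensional ℝ V] (B : V →L[ℝ] V →L[ℝ] ℝ) (hB : ∀ v, v ≠ 0 → 0 < B v v) :
    ∃ c > 0, ∀ v, c * ‖v‖ ^ 2 ≤ B v v := by
  have hcont : Continuous fun v => B v v := B.continuous.clm_apply continuous_id
  rcases (Metric.sphere (0 : V) 1).eq_empty_or_nonempty with h | h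
  · refine ⟨1, one_pos, fun v => ?_⟩
    have hv : v = 0 := by
      by_contra hv
      have : ‖v‖⁻¹ • v ∈ Metric.sphere (0 : V) 1 := by
        simp [norm_smul, hv]
      rw [h] at this
      exact this
    simp [hv]
  · obtain ⟨u, hu, hmin⟩ := (isCompact_sphere (0 : V) 1).exists_isMinOn h hcont.continuousOn
    have hu0 : u ≠ 0 := by
      rintro rfl
      simp at hu
    refine ⟨B u u, hB u hu0, fun v => ?_⟩
    by_cases hv : v = 0
    · simp [hv]
    have hn : 0 < ‖v‖ := norm_pos_iff.2 hv
    have h1 : B u u ≤ B (‖v‖⁻¹ • v) (‖v‖⁻¹ • v) := hmin (by simp [norm_smul, hv])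
    simp only [map_smul, smul_apply, smul_eq_mul] at h1
    calc B u u * ‖v‖ ^ 2 ≤ (‖v‖⁻¹ * (‖v‖⁻¹ * B v v)) * ‖v‖ ^ 2 := by gcongr
      _ = B v v := by field_simp

section Homogeneous

variable {E : Type*} [NormedAddCommGroup E] [NormedSpace ℝ E] [CompleteSpace E]
  [FiniteDimensional ℝ E]
  {E' : Type*} [NormedAddCommGroup E'] [NormedSpace ℝ E'] [CompleteSpace E']
  [FiniteDimensional ℝ E']
  {K : Type*} [Group K] [TopologicalSpace K] [ChartedSpace E K] [LieGroup 𝓘(ℝ, E) ∞ K]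
  {H : Subgroup K} [ChartedSpace E' (K ⧸ H)] [IsManifold 𝓘(ℝ, E') ∞ (K ⧸ H)]
  [hF : Fact (IsHomogeneousManifold (E := E) E' H)]
  [hN : Fact (∀ x : E, x ≠ 0 → 0 < nkill K x x)]

/-- The inner products on the tangent spaces induced by the negative of the Killing form. -/
def canInner (E : Type*) [NormedAddCommGroup E] [NormedSpace ℝ E] [CompleteSpace E]
    [FiniteDimensional ℝ E] (E' : Type*) [NormedAddCommGroup E'] [NormedSpace ℝ E']
    {K : Type*} [Group K] [TopologicalSpace K] [ChartedSpace E K] [LieGroup 𝓘(ℝ, E) ∞ K]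
    {H : Subgroup K} [ChartedSpace E' (K ⧸ H)] (p : K ⧸ H) : E' →L[ℝ] E' →L[ℝ] ℝ :=
  (nkill K).bilinearComp (sig E E' p) (sig E E' p)

lemma canInner_apply (p : K ⧸ H) (u v : E') :
    canInner E E' p u v = nkill K (sig E E' p u) (sig E E' p v) := rfl

lemma canInner_pos (p : K ⧸ H) (v : E') (hv : v ≠ 0) : 0 < canInner E E' p v v :=
  hN.out _ fun h => hv (sig_injective (E := E) p (h.trans (map_zero _).symm))

lemma isVonNBounded_canInner (p : K ⧸ H) :
    Bornology.IsVonNBounded ℝ {v : E' | canInner E E' p v v < 1} := by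
  obtain ⟨c, hc, h⟩ := exists_pos_mul_sq_le (canInner E E' p) (canInner_pos (E := E) p)
  refine (NormedSpace.isVonNBounded_iff' (𝕜 := ℝ)).2 ⟨1 + c⁻¹, fun v hv => ?_⟩
  have h1 : c * ‖v‖ ^ 2 < 1 := (h v).trans_lt hv
  have h2 : ‖v‖ ^ 2 < c⁻¹ := by
    rw [← one_div, lt_div_iff₀ hc, mul_comm]; exact h1
  nlinarith [sq_nonneg (‖v‖ - 1)]

lemma contMDiffAt_bilinearComp {B : K ⧸ H → E' →L[ℝ] E} {p : K ⧸ H}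
    (hB : ContMDiffAt 𝓘(ℝ, E') 𝓘(ℝ, E' →L[ℝ] E) ∞ B p) :
    ContMDiffAt 𝓘(ℝ, E') 𝓘(ℝ, E' →L[ℝ] E' →L[ℝ] ℝ) ∞
      (fun q => (nkill K).bilinearComp (B q) (B q)) p := by
  have h : ContDiff ℝ ∞ fun b : E' →L[ℝ] E => (nkill K).bilinearComp b b := by
    refine contDiff_clm_apply_iff.2 fun u => contDiff_clm_apply_iff.2 fun v => ?_
    change ContDiff ℝ ∞ fun b : E' →L[ℝ] E => nkill K (b u) (b v)
    exact ((nkill K).contDiff.comp (contDiff_id.clm_apply contDiff_const)).clm_apply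
      (contDiff_id.clm_apply contDiff_const)
  exact h.contMDiff.contMDiffAt.comp p hB

lemma canDer_add {Y Y' : K ⧸ H → E'} {p : K ⧸ H} (hY : IsDiffFieldAt Y p)
    (hY' : IsDiffFieldAt Y' p) (v : E') :
    canDer E (fun q => Y q + Y' q) p v = canDer E Y p v + canDer E Y' p v := by
  rw [canDer_apply, canDer_apply, canDer_apply, ← map_add]
  simp only [map_add (sig E E' _)]
  rw [tder_add (mdifferentiableAt_sig hY) (mdifferentiableAt_sig hY'), map_add, add_apply]
  congr 1
  abel

lemma canDer_smul {Y : K ⧸ H → E'} {g : K ⧸ H → ℝ} {p : K ⧸ H} (hY : IsDiffFieldAt Y p)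
    (hg : MDifferentiableAt 𝓘(ℝ, E') 𝓘(ℝ, ℝ) g p) (v : E') :
    canDer E (fun q => g q • Y q) p v = g p • canDer E Y p v + tder E' ℝ g p v • Y p := by
  have h3 : tder E' E (fun q => g q • sig E E' q (Y q)) p v =
      tder E' ℝ g p v • sig E E' p (Y p) + g p • tder E' E (fun q => sig E E' q (Y q)) p v :=
    tder_bilin (ContinuousLinearMap.lsmul ℝ ℝ) hg (mdifferentiableAt_sig hY) v
  rw [canDer_apply, canDer_apply]
  simp only [map_smul (sig E E' _)]
  rw [h3, map_smul, map_sub, map_add, map_smul, map_smul, map_smul, infAct_sig, map_sub, smul_sub]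
  abel

lemma exists_smooth_canDer {Y : K ⧸ H → E'} {p : K ⧸ H} (hY : IsSmoothFieldAt Y p) :
    ∃ B : K ⧸ H → E' →L[ℝ] E', ContMDiffAt 𝓘(ℝ, E') 𝓘(ℝ, E' →L[ℝ] E') ∞ B p ∧
      ∀ᶠ q in 𝓝 p, ∀ v, tder E' E' (extChartAt 𝓘(ℝ, E') p) q (canDer E Y q v) =
        B q (tder E' E' (extChartAt 𝓘(ℝ, E') p) q v) := by
  have hs := contMDiffAt_sig (E := E) hY
  obtain ⟨S, hS, hSq⟩ := exists_smooth_sig (E := E) (E' := E') p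
  obtain ⟨C, hC, hCq⟩ := exists_smooth_tder hs
  refine ⟨fun q => (tder E E' (fun k : K => extChartAt 𝓘(ℝ, E') p (k • q)) 1).comp
    (C q - ((brk K).flip (sig E E' q (Y q))).comp (S q)), ?_, ?_⟩
  · refine (contMDiffAt_tder_chart_infAct p).clm_comp (hC.sub ?_)
    exact ((brk K).flip.contDiff.contMDiff.contMDiffAt.comp p hs).clm_comp hS
  · filter_upwards [hSq, hCq, tder_chart_infAct (E := E) (E' := E') p] with q h1 h2 h3 v
    rw [canDer_apply, h3, h1, h2]
    rfl

variable (E E' K H) in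
/-- The metric induced by the negative of the Killing form. -/
def canMetric : SmoothMetric E' (K ⧸ H) where
  inner := canInner E E'
  symm p u v := nkill_symm _ _
  pos p v hv := canInner_pos (E := E) (E' := E') p v hv
  isVonNBounded p := isVonNBounded_canInner (E := E) (E' := E') p
  contMDiff p := by
    obtain ⟨B, hB, hBq⟩ := exists_smooth_sig (E := E) (E' := E') p
    refine contMDiffAt_bilinear_form (A := canInner E E') (contMDiffAt_bilinearComp hB) ?_
    filter_upwards [hBq] with q hq v w
    rw [canInner_apply, hq, hq]
    rfl

lemma isCovariantDerivativeOn_canDer :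
    IsCovariantDerivativeOn (I := 𝓘(ℝ, E')) (M := K ⧸ H) E'
      (V := fun p : K ⧸ H => TangentSpace 𝓘(ℝ, E') p) (canDer E (E' := E') (H := H)) where
  add hY hY' _ := by
    ext v
    exact canDer_add (E := E) hY hY' v
  leibniz hY hg _ := by
    ext v
    exact canDer_smul (E := E) hY hg v

variable (E E' K H) in
/-- The canonical connection of the homogeneous space. -/
def canConnection : LinearConnection E' (K ⧸ H) where
  toFun := canDer E
  isCovariantDerivativeOnUniv := isCovariantDerivativeOn_canDer

theorem contMDiff_canConnection :
    ContMDiffCovariantDerivativeOn E' ∞ (canConnection E E' K H).toFun Set.univ where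
  contMDiff {Y} hY := by
    intro p _
    have hYp : IsSmoothFieldAt (E := E') (M := K ⧸ H) Y p :=
      (hY.contMDiffAt Filter.univ_mem).of_le (by simp)
    obtain ⟨B, hB, hBq⟩ := exists_smooth_canDer (E := E) hYp
    exact (contMDiffAt_endomorphism (A := canDer E (E' := E') Y) hB hBq).contMDiffWithinAt

end Homogeneous

/-- A cyclic tensor that is skew in its last two arguments and in which an endomorphism `J` is skew
in the last two arguments vanishes on the image of `J`. -/
lemma eq_zero_of_cyclic_of_skew {V : Type*} {a : V → V → V → ℝ} {J : V → V}
    (hcyc : ∀ u v w, a v u w = a w v u) (hJ : ∀ x y z, a x (J y) z = -a x y (J z)) (x y z : V) :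
    a (J x) y z = 0 := by
  have h1 := hcyc y (J x) z
  have h2 := hcyc (J x) z y
  have h3 := hcyc (J y) x z
  have h4 := hcyc (J z) y x
  have h5 := hcyc y x (J z)
  have h6 := hJ z x y
  have h7 := hJ y z x
  have h8 := hJ x y z
  linarith

section Connections

variable {E : Type*} [NormedAddCommGroup E] [NormedSpace ℝ E] [CompleteSpace E]
  [FiniteDimensional ℝ E]
  {M : Type*} [TopologicalSpace M] [ChartedSpace E M] [IsManifold 𝓘(ℝ, E) ∞ M]

lemma isDiffFieldAt_extend {x : M} (v : TangentSpace 𝓘(ℝ, E) x) :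
    IsDiffFieldAt (FiberBundle.extend E v) x :=
  FiberBundle.mdifferentiableAt_extend 𝓘(ℝ, E) E v

lemma IsComplexStructure.isDiffFieldAt_apply
    {J : ∀ x : M, TangentSpace 𝓘(ℝ, E) x →L[ℝ] TangentSpace 𝓘(ℝ, E) x} (hJ : IsComplexStructure J)
    {Y : ∀ x : M, TangentSpace 𝓘(ℝ, E) x} {x : M} (hY : IsDiffFieldAt Y x) :
    IsDiffFieldAt (fun y => J y (Y y)) x :=
  MDifferentiableAt.clm_bundle_apply ((hJ.smooth x).mdifferentiableAt (by simp)) hY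

variable {D D' : LinearConnection E M}

/-- The difference tensor of two connections. -/
lemma exists_difference (D D' : LinearConnection E M) (x : M) :
    ∃ A : TangentSpace 𝓘(ℝ, E) x →L[ℝ] TangentSpace 𝓘(ℝ, E) x →L[ℝ] TangentSpace 𝓘(ℝ, E) x,
      ∀ Y : ∀ x : M, TangentSpace 𝓘(ℝ, E) x, IsDiffFieldAt Y x → ∀ v, A (Y x) v = D Y x v - D' Y x v :=
  ⟨D.isCovariantDerivativeOnUniv.difference D'.isCovariantDerivativeOnUniv x, fun _ hY v =>
    congrArg (fun L => L v) (IsCovariantDerivativeOn.difference_apply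
      D.isCovariantDerivativeOnUniv D'.isCovariantDerivativeOnUniv (Set.mem_univ x) hY)⟩

lemma LinearConnection.Agree.torsion_eq (h : D.Agree D') (x : M) (u v : TangentSpace 𝓘(ℝ, E) x) :
    D.torsion x u v = D'.torsion x u v := by
  rw [CovariantDerivative.torsion_apply_eq_extend, CovariantDerivative.torsion_apply_eq_extend,
    h _ x (isDiffFieldAt_extend u), h _ x (isDiffFieldAt_extend v)]

lemma LinearConnection.Agree.smooth (h : D.Agree D')
    (hD : ContMDiffCovariantDerivativeOn E ∞ D.toFun Set.univ) :
    ContMDiffCovariantDerivativeOn E ∞ D'.toFun Set.univ where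
  contMDiff {Y} hY := by
    refine (hD.contMDiff hY).congr fun x _ => ?_
    have := h Y x ((hY.contMDiffAt Filter.univ_mem).mdifferentiableAt (by simp))
    exact congrArg (fun L => (⟨x, L⟩ : TotalSpace (E →L[ℝ] E)
      fun x : M => TangentSpace 𝓘(ℝ, E) x →L[ℝ] TangentSpace 𝓘(ℝ, E) x)) this.symm

lemma LinearConnection.Agree.isBismutConnection (h : D.Agree D') {g : SmoothMetric E M}
    {J : ∀ x : M, TangentSpace 𝓘(ℝ, E) x →L[ℝ] TangentSpace 𝓘(ℝ, E) x} (hJ : IsComplexStructure J)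
    (hD : IsBismutConnection g J D) : IsBismutConnection g J D' where
  smooth := h.smooth hD.smooth
  metric X Y x hX hY v := by
    rw [← h X x hX, ← h Y x hY]
    exact hD.metric X Y x hX hY v
  complex Y x hY v := by
    rw [← h Y x hY, ← h _ x (hJ.isDiffFieldAt_apply hY)]
    exact hD.complex Y x hY v
  skew x u v w := by
    rw [← h.torsion_eq, ← h.torsion_eq]
    exact hD.skew x u v w

/-- The Bismut connection of a Hermitian metric is unique. -/
theorem IsBismutConnection.agree {g : SmoothMetric E M}
    {J : ∀ x : M, TangentSpace 𝓘(ℝ, E) x →L[ℝ] TangentSpace 𝓘(ℝ, E) x} (hJ : IsComplexStructure J)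
    (hg : IsHermitianMetric g J) (hD : IsBismutConnection g J D)
    (hD' : IsBismutConnection g J D') : D.Agree D' := by
  intro Y x hY
  obtain ⟨A, hA⟩ := exists_difference D D' x
  have hex : ∀ u : TangentSpace 𝓘(ℝ, E) x, FiberBundle.extend E u x = u := fun u => by simp
  have hA' : ∀ u v : TangentSpace 𝓘(ℝ, E) x,
      A u v = D (FiberBundle.extend E u) x v - D' (FiberBundle.extend E u) x v := fun u v => by
    rw [← hA _ (isDiffFieldAt_extend u), hex]
  have hmet : ∀ v y z : TangentSpace 𝓘(ℝ, E) x, g.inner x (A y v) z = -g.inner x (A z v) y := by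
    intro v y z
    have h1 := hD.metric _ _ x (isDiffFieldAt_extend y) (isDiffFieldAt_extend z) v
    have h2 := hD'.metric _ _ x (isDiffFieldAt_extend y) (isDiffFieldAt_extend z) v
    have h3 : (g.inner x (D (FiberBundle.extend E y) x v) z +
        g.inner x y (D (FiberBundle.extend E z) x v) : ℝ) =
        g.inner x (D' (FiberBundle.extend E y) x v) z +
          g.inner x y (D' (FiberBundle.extend E z) x v) := by
      have h3 := h1.symm.trans h2
      rw [hex, hex] at h3
      exact h3
    rw [hA', hA', map_sub, map_sub, sub_apply, sub_apply, g.symm x (D _ x v) y,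
      g.symm x (D' _ x v) y]
    linarith
  have hcomp : ∀ v y : TangentSpace 𝓘(ℝ, E) x, A (J x y) v = J x (A y v) := by
    intro v y
    have h0 := isDiffFieldAt_extend y
    have h1 := hA _ (hJ.isDiffFieldAt_apply h0) v
    rw [hD.complex _ x h0, hD'.complex _ x h0, ← map_sub, ← hA _ h0, hex] at h1
    exact h1
  have htor : ∀ u v : TangentSpace 𝓘(ℝ, E) x,
      D.torsion x u v - D'.torsion x u v = A v u - A u v := by
    intro u v
    rw [CovariantDerivative.torsion_apply_eq_extend, CovariantDerivative.torsion_apply_eq_extend,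
      hA', hA', hex, hex]
    abel
  have hskew : ∀ u v w : TangentSpace 𝓘(ℝ, E) x,
      g.inner x (A v u - A u v) w = -g.inner x (A w u - A u w) v := by
    intro u v w
    rw [← htor, ← htor, map_sub, map_sub, sub_apply, sub_apply, hD.skew, hD'.skew]
    ring
  have hcyc : ∀ u v w : TangentSpace 𝓘(ℝ, E) x,
      g.inner x (A u v) w = g.inner x (A v w) u := by
    intro u v w
    have h1 := hskew u v w
    rw [map_sub, map_sub, sub_apply, sub_apply, hmet u v w, hmet w u v] at h1
    linarith
  have hgJ : ∀ u v : TangentSpace 𝓘(ℝ, E) x, g.inner x (J x u) v = -g.inner x u (J x v) := by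
    intro u v
    rw [← hg x u (J x v), hJ.sq_eq_neg, map_neg, neg_neg]
  have hzero : ∀ v y z : TangentSpace 𝓘(ℝ, E) x, g.inner x (A y (J x v)) z = 0 :=
    eq_zero_of_cyclic_of_skew (a := fun v y z => g.inner x (A y v) z) (J := J x) hcyc
      fun v y z => by rw [hcomp, hgJ]
  ext v
  rw [← sub_eq_zero, ← hA Y hY]
  by_contra hne
  have h1 := hzero (-J x v) (Y x) (A (Y x) v)
  rw [map_neg, hJ.sq_eq_neg, neg_neg] at h1
  exact (g.pos x _ hne).ne' h1

end Connections

section Homogeneous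

variable {E : Type*} [NormedAddCommGroup E] [NormedSpace ℝ E] [CompleteSpace E]
  [FiniteDimensional ℝ E]
  {E' : Type*} [NormedAddCommGroup E'] [NormedSpace ℝ E'] [CompleteSpace E']
  [FiniteDimensional ℝ E']
  {K : Type*} [Group K] [TopologicalSpace K] [ChartedSpace E K] [LieGroup 𝓘(ℝ, E) ∞ K]
  {H : Subgroup K} [ChartedSpace E' (K ⧸ H)] [IsManifold 𝓘(ℝ, E') ∞ (K ⧸ H)]
  [hF : Fact (IsHomogeneousManifold (E := E) E' H)]
  [hN : Fact (∀ x : E, x ≠ 0 → 0 < nkill K x x)]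

lemma mem_isotropyAlgebra {X : E} : (X : GroupLieAlgebra 𝓘(ℝ, E) K) ∈ isotropyAlgebra (E := E) E' H ↔
    infAct E E' ((1 : K) : K ⧸ H) X = 0 := by
  rw [infAct_base]
  exact Iff.rfl

lemma mem_isotropyComplement_iff_nkill {X : E} :
    (X : GroupLieAlgebra 𝓘(ℝ, E) K) ∈ isotropyComplement (E := E) E' H ↔
      ∀ y : E, infAct E E' ((1 : K) : K ⧸ H) y = 0 → nkill K y X = 0 := by
  refine forall_congr' fun y => ?_
  exact imp_congr (mem_isotropyAlgebra (E := E) (E' := E') (H := H) (X := y)) neg_eq_zero.symm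

lemma mem_isotropyComplement {X : E} :
    (X : GroupLieAlgebra 𝓘(ℝ, E) K) ∈ isotropyComplement (E := E) E' H ↔
    horProj E E' ((1 : K) : K ⧸ H) X = X := by
  rw [mem_isotropyComplement_iff_nkill]
  constructor
  · intro h
    exact eq_sig fun y hy => by rw [nkill_symm, h y hy]
  · intro h y hy
    rw [nkill_symm, ← h]
    exact nkill_sig _ _ hy

variable (E E' H) in
lemma isCompl_isotropyComplement :
    IsCompl (isotropyAlgebra (E := E) E' H) (isotropyComplement (E := E) E' H) := by
  refine isCompl_orthogonalBilin_of_definite (V := GroupLieAlgebra 𝓘(ℝ, E) K)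
    (killingForm ℝ (GroupLieAlgebra 𝓘(ℝ, E) K)) ?_ ?_ _
  · exact LieModule.traceForm_comm ℝ (GroupLieAlgebra 𝓘(ℝ, E) K) (GroupLieAlgebra 𝓘(ℝ, E) K)
  · intro x hx
    exact nkill_definite (E := E) (K := K) (x := x) (neg_eq_zero.2 hx)

lemma horProj_brk {p : K ⧸ H} {x : E} (hx : infAct E E' p x = 0) (y : E) :
    horProj E E' p (brk K x y) = brk K x (horProj E E' p y) := by
  have h1 := tder_of_equivariant (E' := E') (H := H) (Φ := horProj E E') horProj_smul p x y
  rw [hx, map_zero] at h1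
  exact (sub_eq_zero.1 h1.symm).symm

lemma lie_mem_isotropyComplement :
    ∀ X ∈ isotropyAlgebra (E := E) E' H, ∀ Y ∈ isotropyComplement (E := E) E' H,
      ⁅X, Y⁆ ∈ isotropyComplement (E := E) E' H := by
  intro X hX Y hY
  refine (mem_isotropyComplement (E := E)).2 ?_
  exact (horProj_brk (E := E) ((mem_isotropyAlgebra (E := E)).1 hX) Y).trans
    (congrArg (brk (E := E) K X) ((mem_isotropyComplement (E := E)).1 hY))

/-! ### The metric -/

lemma tder_proj_leftField (k : K) (X : E) :
    tder E E' (fun x : K => (x : K ⧸ H)) k (leftField X k) =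
      transl E' k ((1 : K) : K ⧸ H) (infAct E E' ((1 : K) : K ⧸ H) X) := by
  have h1 := tder_comp_apply (E' := E) (g := fun x : K => (x : K ⧸ H)) (f := fun y : K => k * y)
    (p := 1) (mdiffAt_proj E E' H _) (mdiff_mul_left k 1) X
  have h2 := tder_comp_apply (E' := E') (g := fun q : K ⧸ H => k • q)
    (f := fun y : K => (y : K ⧸ H)) (p := 1) (mdiffAt_translation E E' k _) (mdiffAt_proj E E' H _) X
  rw [infAct_base]
  refine Eq.trans ?_ h2
  refine Eq.trans ?_ h1.symm
  rw [mul_one]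
  rfl

lemma canInner_smul (k : K) (p : K ⧸ H) (u v : E') :
    canInner E E' (k • p) (transl E' k p u) (transl E' k p v) = canInner E E' p u v := by
  rw [canInner_apply, sig_smul, sig_smul, nkill_adj, canInner_apply]

lemma canInner_proj (k : K) {X Y : E} (hX : horProj E E' ((1 : K) : K ⧸ H) X = X)
    (hY : horProj E E' ((1 : K) : K ⧸ H) Y = Y) :
    canInner E E' ((k : K) : K ⧸ H) (tder E E' (fun x : K => (x : K ⧸ H)) k (leftField X k))
      (tder E E' (fun x : K => (x : K ⧸ H)) k (leftField Y k)) = nkill K X Y := by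
  rw [tder_proj_leftField, tder_proj_leftField, mk_smul_base, canInner_smul, canInner_apply,
    ← horProj_apply, ← horProj_apply, hX, hY]

lemma isCartanKillingMetric_canMetric : IsCartanKillingMetric (E := E) (canMetric E E' K H) :=
  fun k _ hX _ hY => canInner_proj (E := E) (E' := E') k
    ((mem_isotropyComplement (E := E)).1 hX) ((mem_isotropyComplement (E := E)).1 hY)

lemma exists_tder_proj_leftField (k : K) (u : E') :
    ∃ X : E, horProj E E' ((1 : K) : K ⧸ H) X = X ∧
      tder E E' (fun x : K => (x : K ⧸ H)) k (leftField X k) = u := by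
  refine ⟨sig E E' ((1 : K) : K ⧸ H) (transl E' k⁻¹ (k • ((1 : K) : K ⧸ H)) u), horProj_sig _ _, ?_⟩
  rw [tder_proj_leftField, infAct_sig]
  have := transl_inv_apply E (E' := E') k⁻¹ (k • ((1 : K) : K ⧸ H)) u
  rwa [inv_inv, inv_smul_smul] at this

lemma IsCartanKillingMetric.inner_eq {g : SmoothMetric E' (K ⧸ H)}
    (hg : IsCartanKillingMetric (E := E) g) : g.inner = canInner E E' := by
  funext p
  obtain ⟨k, rfl⟩ := QuotientGroup.mk_surjective p
  refine ContinuousLinearMap.ext fun u => ContinuousLinearMap.ext fun v => ?_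
  obtain ⟨X, hX, hXu⟩ := exists_tder_proj_leftField (E := E) (E' := E') (H := H) k u
  obtain ⟨Y, hY, hYv⟩ := exists_tder_proj_leftField (E := E) (E' := E') (H := H) k v
  have h1 := hg k X ((mem_isotropyComplement (E := E)).2 hX) Y ((mem_isotropyComplement (E := E)).2 hY)
  have h2 := canInner_proj k hX hY
  rw [hXu, hYv] at h2
  refine Eq.trans ?_ h2.symm
  refine Eq.trans ?_ h1
  exact (congrArg₂ (fun a b : E' => g.inner (k : K ⧸ H) a b) hXu hYv).symm

lemma IsCartanKillingMetric.eq_canMetric {g : SmoothMetric E' (K ⧸ H)}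
    (hg : IsCartanKillingMetric (E := E) g) : g = canMetric E E' K H := by
  have h := hg.inner_eq
  cases g
  cases h
  rfl

/-! ### The canonical connection -/

lemma canConnection_torsion (p : K ⧸ H) (u v : TangentSpace 𝓘(ℝ, E') p) :
    ((canConnection E E' K H).torsion p u v : E') =
      -infAct E E' p (brk K (sig E E' p u) (sig E E' p v)) := by
  refine (CovariantDerivative.torsion_apply_eq_extend _ _ _).trans ?_
  refine (canDer_torsion (E := E) (isDiffFieldAt_extend (E := E') (M := K ⧸ H) (x := p) u)
    (isDiffFieldAt_extend (E := E') (M := K ⧸ H) (x := p) v)).trans ?_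
  have hex : ∀ u : TangentSpace 𝓘(ℝ, E') p, FiberBundle.extend E' u p = u := fun u => by simp
  exact congrArg₂ (fun a b : E' => -infAct E E' p (brk K (sig E E' p a) (sig E E' p b)))
    (hex u) (hex v)

lemma nkill_infAct (p : K ⧸ H) (x : E) (w : E') :
    nkill K (sig E E' p (infAct E E' p x)) (sig E E' p w) = nkill K x (sig E E' p w) := by
  have h1 : infAct E E' p (sig E E' p (infAct E E' p x) - x) = 0 := by
    rw [map_sub, infAct_sig, sub_self]
  have h2 := nkill_sig (E := E) p w h1
  rw [map_sub, sub_eq_zero] at h2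
  rw [nkill_symm, h2, nkill_symm]

lemma canInner_torsion_skew (p : K ⧸ H) (u v w : E') :
    canInner E E' p (-infAct E E' p (brk K (sig E E' p u) (sig E E' p v))) w =
      -canInner E E' p (-infAct E E' p (brk K (sig E E' p u) (sig E E' p w))) v := by
  have hneg : ∀ x y : E, nkill K (-x) y = -nkill K x y := fun x y => by rw [map_neg]; rfl
  rw [canInner_apply, canInner_apply, ← map_neg (infAct E E' p), ← map_neg (infAct E E' p),
    nkill_infAct, nkill_infAct, hneg, hneg, nkill_brk_left, nkill_symm]

theorem isBismutConnection_canConnection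
    {J : ∀ p : K ⧸ H, TangentSpace 𝓘(ℝ, E') p →L[ℝ] TangentSpace 𝓘(ℝ, E') p}
    (hJ : IsInvariantEndo J) :
    IsBismutConnection (canMetric E E' K H) J (canConnection E E' K H) where
  smooth := contMDiff_canConnection
  metric X Y p hX hY v := canDer_metric (E := E) (E' := E') hX hY v
  complex Y p hY v := canDer_endo (E := E) (E' := E') (J := J) hJ hY v
  skew p u v w := by
    refine ((congrArg (fun a : E' => canInner E E' p a w) (canConnection_torsion p u v)).trans
      ?_).trans (congrArg (fun a : E' => -canInner E E' p a v) (canConnection_torsion p u w)).symm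
    exact canInner_torsion_skew (E := E) (E' := E') p u v w

lemma inverse_translationDeriv (h : IsHomogeneousManifold (E := E) E' H) (k : K) (p : K ⧸ H) :
    (translationDeriv (E' := E') k p).inverse = transl E' k⁻¹ (k • p) := by
  have := Fact.mk h
  have h1 : ∀ v, transl E' k p (transl E' k⁻¹ (k • p) v) = v := fun v => by
    have := transl_inv_apply E (E' := E') k⁻¹ (k • p) v
    rwa [inv_inv, inv_smul_smul] at this
  exact ContinuousLinearMap.inverse_eq (ContinuousLinearMap.ext h1)
    (ContinuousLinearMap.ext (transl_inv_apply E (E' := E') k p))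

lemma mpullback_translation (h : IsHomogeneousManifold (E := E) E' H) (k : K) (Y : K ⧸ H → E') (q : K ⧸ H) :
    mpullback 𝓘(ℝ, E') 𝓘(ℝ, E') (fun q : K ⧸ H => k • q) Y q = transl E' k⁻¹ (k • q) (Y (k • q)) :=
  congrArg (fun L : E' →L[ℝ] E' => L (Y (k • q))) (inverse_translationDeriv h k q)

lemma isDiffFieldAt_mpullback (h : IsHomogeneousManifold (E := E) E' H)
    (hn : ∀ x : E, x ≠ 0 → 0 < nkill K x x) (k : K) {Y : K ⧸ H → E'} {p : K ⧸ H}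
    (hY : IsDiffFieldAt Y (k • p)) :
    IsDiffFieldAt (mpullback 𝓘(ℝ, E') 𝓘(ℝ, E') (fun q : K ⧸ H => k • q) Y) p := by
  have := Fact.mk h
  have := Fact.mk hn
  have hy := mdifferentiableAt_sig (E := E) hY
  have hc : MDifferentiableAt 𝓘(ℝ, E') 𝓘(ℝ, E) (fun q => sig E E' (k • q) (Y (k • q))) p :=
    MDifferentiableAt.comp p (I' := 𝓘(ℝ, E')) (g := fun q => sig E E' q (Y q)) hy
      (mdiffAt_translation E E' k p)
  have h1 := isDiffFieldAt_infAct (E := E) (E' := E') (mdifferentiableAt_clm (adj E k⁻¹) hc)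
  have h2 : (fun q => infAct E E' q (adj E k⁻¹ (sig E E' (k • q) (Y (k • q))))) =
      mpullback 𝓘(ℝ, E') 𝓘(ℝ, E') (fun q : K ⧸ H => k • q) Y := by
    funext q
    refine Eq.trans ?_ (mpullback_translation h k Y q).symm
    have h3 := infAct_smul (E := E) (E' := E') k⁻¹ (k • q) (sig E E' (k • q) (Y (k • q)))
    rw [infAct_sig, inv_smul_smul] at h3
    exact h3
  rw [← h2]
  exact h1

theorem isCanonicalConnection_canConnection : IsCanonicalConnection E (canConnection E E' K H) where
  smooth := contMDiff_canConnection
  invariant k Y p hY v := by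
    have h1 : mpullback 𝓘(ℝ, E') 𝓘(ℝ, E') (fun q : K ⧸ H => k • q) Y =
        fun q => transl E' k⁻¹ (k • q) (Y (k • q)) :=
      funext fun q => mpullback_translation hF.out k Y q
    rw [h1]
    exact canDer_invariant (E := E) (E' := E') k hY v
  nomizu X hX Y _ := canDer_nomizu (E := E) (E' := E') Y (mem_isotropyComplement.1 hX)

lemma LinearConnection.Agree.isCanonicalConnection {D D' : LinearConnection E' (K ⧸ H)}
    (h : D.Agree D') (hD : IsCanonicalConnection E D) : IsCanonicalConnection E D' where
  smooth := h.smooth hD.smooth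
  invariant k Y p hY v := by
    rw [← h Y _ hY, ← h _ p (isDiffFieldAt_mpullback hF.out hN.out k hY)]
    exact hD.invariant k Y p hY v
  nomizu X hX Y hY := by
    have h1 : IsDiffFieldAt (fundamentalField (E' := E') (H := H) Y) ((1 : K) : K ⧸ H) :=
      isDiffFieldAt_infAct (E := E) (E' := E') (f := fun _ => Y) mdifferentiableAt_const
    rw [← h _ _ h1]
    exact hD.nomizu X hX Y hY

/-- The canonical connection is unique. -/
theorem IsCanonicalConnection.agree {D D' : LinearConnection E' (K ⧸ H)}
    (hD : IsCanonicalConnection E D) (hD' : IsCanonicalConnection E D') : D.Agree D' := by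
  have h0 : ∀ Y : ∀ p : K ⧸ H, TangentSpace 𝓘(ℝ, E') p, IsDiffFieldAt Y ((1 : K) : K ⧸ H) →
      D Y ((1 : K) : K ⧸ H) = D' Y ((1 : K) : K ⧸ H) := by
    intro Y hY
    obtain ⟨A, hA⟩ := exists_difference D D' ((1 : K) : K ⧸ H)
    have hrep : ∀ u : E', ∃ X ∈ isotropyComplement (E := E) E' H,
        fundamentalField (E' := E') (H := H) X ((1 : K) : K ⧸ H) = u := fun u =>
      ⟨sig E E' ((1 : K) : K ⧸ H) u, (mem_isotropyComplement (E := E)).2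
        (horProj_sig (E := E) (E' := E') _ _), infAct_sig (E := E) (E' := E') _ u⟩
    ext v
    rw [← sub_eq_zero, ← hA Y hY]
    obtain ⟨X, hX, hXv⟩ := hrep v
    obtain ⟨W, hW, hWY⟩ := hrep (Y ((1 : K) : K ⧸ H))
    have h1 : IsDiffFieldAt (fundamentalField (E' := E') (H := H) W) ((1 : K) : K ⧸ H) :=
      isDiffFieldAt_infAct (E := E) (E' := E') (f := fun _ => W) mdifferentiableAt_const
    have h2 := hA _ h1 v
    rw [← hXv, eq_neg_of_add_eq_zero_left (hD.nomizu X hX W hW),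
      eq_neg_of_add_eq_zero_left (hD'.nomizu X hX W hW), sub_self, hXv] at h2
    exact (congrArg (fun a => A a v) hWY).symm.trans h2
  intro Y p hY
  obtain ⟨k, rfl⟩ := QuotientGroup.mk_surjective p
  change IsDiffFieldAt Y ((k : K) : K ⧸ H) at hY
  rw [mk_smul_base] at hY ⊢
  ext v
  have hv : transl E' k ((1 : K) : K ⧸ H) (transl E' k⁻¹ (k • ((1 : K) : K ⧸ H)) v) = v := by
    have := transl_inv_apply E (E' := E') k⁻¹ (k • ((1 : K) : K ⧸ H)) v
    rwa [inv_inv, inv_smul_smul] at this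
  have h1 := hD.invariant k Y _ hY (transl E' k⁻¹ (k • ((1 : K) : K ⧸ H)) v)
  have h2 := hD'.invariant k Y _ hY (transl E' k⁻¹ (k • ((1 : K) : K ⧸ H)) v)
  rw [← h0 _ (isDiffFieldAt_mpullback hF.out hN.out k hY), ← h1] at h2
  have h3 : translationDeriv k ((1 : K) : K ⧸ H) (transl E' k⁻¹ (k • ((1 : K) : K ⧸ H)) v) = v := hv
  rw [h3] at h2
  exact h2.symm

lemma IsSmoothField.isSmoothFieldAt {X : K ⧸ H → E'}
    (hX : IsSmoothField (E := E') (M := K ⧸ H) X) (p : K ⧸ H) : IsSmoothFieldAt X p := hX p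

theorem hasParallelTorsion_canConnection : HasParallelTorsion (canConnection E E' K H) := by
  intro W X Y hW hX hY p
  have h1 : (fun q => (canConnection E E' K H).torsion q (X q) (Y q)) =
      fun q => -infAct E E' q (brk K (sig E E' q (X q)) (sig E E' q (Y q))) :=
    funext fun q => canConnection_torsion q (X q) (Y q)
  rw [h1, canConnection_torsion, canConnection_torsion]
  exact canDer_torsion_parallel (E := E) (E' := E') (hX.isSmoothFieldAt p).isDiffFieldAt
    (hY.isSmoothFieldAt p).isDiffFieldAt (W p)

lemma connectionCurvature_canConnection {X Y Z : K ⧸ H → E'}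
    (hX : ∀ q, IsSmoothFieldAt X q) (hY : ∀ q, IsSmoothFieldAt Y q) (hZ : ∀ q, IsSmoothFieldAt Z q)
    (p : K ⧸ H) :
    connectionCurvature (canConnection E E' K H) X Y Z p =
    -infAct E E' p (brk K (brk K (sig E E' p (X p)) (sig E E' p (Y p)) -
      horProj E E' p (brk K (sig E E' p (X p)) (sig E E' p (Y p)))) (sig E E' p (Z p))) :=
  canDer_curvature hX hY hZ p

theorem hasParallelCurvature_canConnection : HasParallelCurvature (canConnection E E' K H) := by
  intro W X Y Z hW hX hY hZ p
  have hW' := IsSmoothField.isSmoothFieldAt (E' := E') hW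
  have hX' := IsSmoothField.isSmoothFieldAt (E' := E') hX
  have hY' := IsSmoothField.isSmoothFieldAt (E' := E') hY
  have hZ' := IsSmoothField.isSmoothFieldAt (E' := E') hZ
  have h0 : connectionCurvature (canConnection E E' K H) X Y Z = _ :=
    funext (connectionCurvature_canConnection (E := E) hX' hY' hZ')
  have h1 := connectionCurvature_canConnection (E := E)
    (fun q => isSmoothFieldAt_canDer (E := E) (hW' q) (hX' q)) hY' hZ' p
  have h2 := connectionCurvature_canConnection (E := E) hX'
    (fun q => isSmoothFieldAt_canDer (E := E) (hW' q) (hY' q)) hZ' p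
  have h3 := connectionCurvature_canConnection (E := E) hX' hY'
    (fun q => isSmoothFieldAt_canDer (E := E) (hW' q) (hZ' q)) p
  rw [h0]
  refine (canDer_curvature_parallel (E := E) (E' := E') (hX' p).isDiffFieldAt
    (hY' p).isDiffFieldAt (hZ' p).isDiffFieldAt (W p)).trans ?_
  exact (congrArg₂ (fun a b : E' => a + b) (congrArg₂ (fun a b : E' => a + b) h1 h2) h3).symm

end Homogeneous

section Homogeneous

variable {E : Type*} [NormedAddCommGroup E] [NormedSpace ℝ E] [CompleteSpace E]
  [FiniteDimensional ℝ E]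
  {E' : Type*} [NormedAddCommGroup E'] [NormedSpace ℝ E'] [CompleteSpace E']
  [FiniteDimensional ℝ E']
  {K : Type*} [Group K] [TopologicalSpace K] [ChartedSpace E K] [LieGroup 𝓘(ℝ, E) ∞ K]
  {H : Subgroup K} [ChartedSpace E' (K ⧸ H)] [IsManifold 𝓘(ℝ, E') ∞ (K ⧸ H)]
  [hF : Fact (IsHomogeneousManifold (E := E) E' H)]
  [hN : Fact (∀ x : E, x ≠ 0 → 0 < nkill K x x)]

/-- Invariant almost complex structures of a flag manifold preserve the inner product at the base
point. -/
theorem canInner_base_apply_of_invariant [T2Space K] {Z : Subgroup K} (hZ : IsTorus Z)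
    (hH : H = Subgroup.centralizer (Z : Set K)) {J : K ⧸ H → E' →L[ℝ] E'}
    (hJ : ∀ (k : K) p v, J (k • p) (transl E' k p v) = transl E' k p (J p v))
    (hJJ : ∀ p v, J p (J p v) = -v) (u v : E') :
    canInner E E' ((1 : K) : K ⧸ H) (J ((1 : K) : K ⧸ H) u) (J ((1 : K) : K ⧸ H) v) =
      canInner E E' ((1 : K) : K ⧸ H) u v := by
  set o : K ⧸ H := ((1 : K) : K ⧸ H) with ho
  obtain ⟨t, hth, habel, ht⟩ := exists_selfcentralizing hN.out hZ
    (show Submodule ℝ E from isotropyAlgebra (E := E) E' H)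
    (fun x => mem_isotropyAlgebra.trans (infAct_base_eq_zero_iff hH x))
  have hinf : ∀ s ∈ t, infAct E E' o s = 0 := fun s hs => mem_isotropyAlgebra.1 (hth hs)
  let Φ : K ⧸ H → E →L[ℝ] E := fun q => (sig E E' q).comp ((J q).comp (infAct E E' q))
  have hΦ : ∀ (k : K) q x, Φ (k • q) (adj E k x) = adj E k (Φ q x) := fun k q x => by
    change sig E E' (k • q) (J (k • q) (infAct E E' (k • q) (adj E k x))) =
      adj E k (sig E E' q (J q (infAct E E' q x)))
    rw [infAct_smul, hJ, sig_smul]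
  have hΦs : ∀ s ∈ t, ∀ x, Φ o (brk K s x) = brk K s (Φ o x) := fun s hs x => by
    have h1 := tder_of_equivariant (E' := E') hΦ o s x
    rw [hinf s hs, map_zero] at h1
    exact (sub_eq_zero.1 h1.symm).symm
  have key := isometric_of_commute_abelian (L := GroupLieAlgebra 𝓘(ℝ, E) K)
    (κ := -killingForm ℝ (GroupLieAlgebra 𝓘(ℝ, E) K))
    (fun x y => nkill_symm (E := E) (K := K) x y) (fun x hx => hN.out x hx)
    (fun x y z => nkill_brk (E := E) (K := K) x y z)
    (show Submodule ℝ (GroupLieAlgebra 𝓘(ℝ, E) K) from t) habel ht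
    (isotropyComplement (E := E) E' H)
    (fun s hs x hx => lie_mem_isotropyComplement (E := E) s (hth hs) x hx)
    (fun s hs x hx => (nkill_symm (E := E) (K := K) x s).trans
      ((mem_isotropyComplement_iff_nkill (E := E)).1 hx s (hinf s hs)))
    (show GroupLieAlgebra 𝓘(ℝ, E) K →ₗ[ℝ] GroupLieAlgebra 𝓘(ℝ, E) K from (Φ o).toLinearMap)
    (fun x _ => (mem_isotropyComplement (E := E)).2 (horProj_sig (E := E) (E' := E') o _))
    (fun x hx => by
      have h1 : Φ o (Φ o x) = -horProj E E' o x := by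
        change sig E E' o (J o (infAct E E' o (sig E E' o (J o (infAct E E' o x))))) =
          -sig E E' o (infAct E E' o x)
        rw [infAct_sig, hJJ, map_neg]
      exact h1.trans (congrArg Neg.neg ((mem_isotropyComplement (E := E)).1 hx)))
    (fun s hs x _ => hΦs s hs x)
    (x := sig E E' o u) (y := sig E E' o v)
    ((mem_isotropyComplement (E := E)).2 (horProj_sig (E := E) (E' := E') o u))
    ((mem_isotropyComplement (E := E)).2 (horProj_sig (E := E) (E' := E') o v))
  have hs : ∀ w, Φ o (sig E E' o w) = sig E E' o (J o w) := fun w => by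
    change sig E E' o (J o (infAct E E' o (sig E E' o w))) = _
    rw [infAct_sig]
  rw [canInner_apply, canInner_apply, ← hs, ← hs]
  exact key

theorem canInner_apply_of_invariant [T2Space K] {Z : Subgroup K} (hZ : IsTorus Z)
    (hH : H = Subgroup.centralizer (Z : Set K)) {J : K ⧸ H → E' →L[ℝ] E'}
    (hJ : ∀ (k : K) p v, J (k • p) (transl E' k p v) = transl E' k p (J p v))
    (hJJ : ∀ p v, J p (J p v) = -v) (p : K ⧸ H) (u v : E') :
    canInner E E' p (J p u) (J p v) = canInner E E' p u v := by
  obtain ⟨k, rfl⟩ := QuotientGroup.mk_surjective p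
  rw [mk_smul_base]
  have hv : ∀ v, transl E' k ((1 : K) : K ⧸ H) (transl E' k⁻¹ (k • ((1 : K) : K ⧸ H)) v) = v := by
    intro v
    have := transl_inv_apply E (E' := E') k⁻¹ (k • ((1 : K) : K ⧸ H)) v
    rwa [inv_inv, inv_smul_smul] at this
  rw [← hv u, ← hv v, hJ, hJ, canInner_smul, canInner_smul,
    canInner_base_apply_of_invariant hZ hH hJ hJJ]

end Homogeneous

theorem mainTheorem10
    {E : Type*} [NormedAddCommGroup E] [NormedSpace ℝ E] [FiniteDimensional ℝ E] [CompleteSpace E]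
    {E' : Type*} [NormedAddCommGroup E'] [NormedSpace ℝ E'] [FiniteDimensional ℝ E']
    [CompleteSpace E']
    {K : Type*} [Group K] [TopologicalSpace K] [ChartedSpace E K] [LieGroup 𝓘(ℝ, E) ∞ K]
    [T2Space K] [CompactSpace K] [ConnectedSpace K]
    (hK : LieAlgebra.IsSemisimple ℝ (GroupLieAlgebra 𝓘(ℝ, E) K))
    (Z : Subgroup K) (hZ : IsTorus Z)
    (H : Subgroup K) (hH : H = Subgroup.centralizer (Z : Set K))
    [ChartedSpace E' (K ⧸ H)] [IsManifold 𝓘(ℝ, E') ∞ (K ⧸ H)]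
    (hF : IsHomogeneousManifold (E := E) E' H) :
    -- `𝔨 = 𝔥 ⊕ 𝔪` is a reductive decomposition
    IsCompl (isotropyAlgebra (E := E) E' H) (isotropyComplement (E := E) E' H) ∧
    (∀ X ∈ isotropyAlgebra (E := E) E' H, ∀ Y ∈ isotropyComplement (E := E) E' H,
      ⁅X, Y⁆ ∈ isotropyComplement (E := E) E' H) ∧
    -- the form `-B` induces a Riemannian metric on `K/H`
    (∃! g : SmoothMetric E' (K ⧸ H), IsCartanKillingMetric (E := E) g) ∧
    ∀ g : SmoothMetric E' (K ⧸ H), IsCartanKillingMetric (E := E) g →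
      ∀ J : ∀ p : K ⧸ H, TangentSpace 𝓘(ℝ, E') p →L[ℝ] TangentSpace 𝓘(ℝ, E') p,
        IsComplexStructure J → IsInvariantEndo J →
          IsHermitianMetric g J ∧
          -- the Bismut connection exists, is unique, and is the canonical connection
          (∃ D : LinearConnection E' (K ⧸ H), IsBismutConnection g J D) ∧
          (∀ D D' : LinearConnection E' (K ⧸ H),
            IsBismutConnection g J D → IsBismutConnection g J D' → D.Agree D') ∧
          (∀ D : LinearConnection E' (K ⧸ H),
            IsBismutConnection g J D ↔ IsCanonicalConnection E D) ∧
          IsBTP g J ∧ IsBAS g J := by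

  have hn : ∀ x : E, x ≠ 0 → 0 < nkill K x x := fun x hx => nkill_pos hK hx
  have := Fact.mk hF
  have := Fact.mk hn
  refine ⟨isCompl_isotropyComplement E E' H, lie_mem_isotropyComplement,
    ⟨canMetric E E' K H, isCartanKillingMetric_canMetric, fun g hg => hg.eq_canMetric⟩,
    fun g hg J hJ hJK => ?_⟩
  obtain rfl := hg.eq_canMetric
  have hherm : IsHermitianMetric (canMetric E E' K H) J := fun p u v =>
    canInner_apply_of_invariant (E := E) (E' := E') hZ hH (J := J) hJK hJ.sq_eq_neg p u v
  have hbis : IsBismutConnection (canMetric E E' K H) J (canConnection E E' K H) :=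
    isBismutConnection_canConnection hJK
  have huniq : ∀ D D' : LinearConnection E' (K ⧸ H),
      IsBismutConnection (canMetric E E' K H) J D → IsBismutConnection (canMetric E E' K H) J D' →
        D.Agree D' := fun D D' hD hD' => hD.agree hJ hherm hD'
  refine ⟨hherm, ⟨_, hbis⟩, huniq, fun D => ⟨fun hD => ?_, fun hD => ?_⟩,
    ⟨hJ, hherm, _, hbis, hasParallelTorsion_canConnection⟩,
    ⟨hJ, hherm, _, hbis, hasParallelTorsion_canConnection, hasParallelCurvature_canConnection⟩⟩
  · exact (huniq _ _ hbis hD).isCanonicalConnection isCanonicalConnection_canConnection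
  · exact (isCanonicalConnection_canConnection.agree hD).isBismutConnection hJ hbis
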